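/- Let $n\ge 2$, $0<\alpha<2$, $s>\frac n2+1$, $r>s_n:=\frac{n+2}{2}$ and $c\in\mathbb R$. Here $\mathcal F$ is the Fourier transform with kernel $e^{\mp 2\pi i x\cdot\xi}$, $\langle y\rangle=(1+|y|^2)^{1/2}$, $(-\Delta)^{a}$ has symbol $|2\pi\xi|^{2a}$, $J^{a}=(I-\Delta)^{a/2}$ has symbol $\langle 2\pi\xi\rangle^{a}$, and $\|f\|_{H^a}=\|J^af\|_{L^2(\mathbb R^n)}$. Let $\nu=(\nu_1,\dots,\nu_n)\in\mathbb R^n$ with $\nu_1>0$, put $|\overline\nu|=(\nu_2^2+\dots+\nu_n^2)^{1/2}$, and let $C$ be the best constant in $\|J^{-1}\partial_{x_j}f\|_{L^2}\le C\|f\|_{L^2}$, $f\in L^2(\mathbb R^n)$, $j=2,\dots,n$, that is, $C=\sup_{2\le j\le n}\,\sup_{f\ne0}\|J^{-1}\partial_{x_j}f\|_{L^2}/\|f\|_{L^2}$. Assume that one of the following holds: * Case 1: $\nu_2=\dots=\nu_n=0$; * Case 2: $(\nu_2,\dots,\nu_n)\neq0$ and there is $\epsilon$ with $$0<\epsilon<\frac{\nu_1}{|\overline\nu|\sqrt{n-1}}-\frac{\alpha\sqrt{n-1}\,|\overline\nu|}{4\nu_1}C^2,\qquad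 0<|\overline\nu|<\min\Big\{\frac{2\nu_1}{C\sqrt{\alpha(n-1)}},\frac{\nu_1(1+\alpha)}{\alpha\epsilon\sqrt{n-1}}\Big\}.$$ Then there is a constant $K>0$, depending only on $n,\alpha,s,r,\nu,c$, such that the following holds for every weight $\varphi$, every $T>0$ and every solution $u$ as below. The weight is $\varphi(x)=\phi(\nu\cdot x+\delta)$ with $\delta\in\mathbb R$ and $\phi:\mathbb R\to[0,\infty)$ a $C^\infty$ non-decreasing function such that $\phi'\ge0$, $\phi'\equiv1$ on $[0,1]$, $\sup_{\mathbb R}|\phi^{(j)}|\le c$ for $0\le j\le4$, and $\sqrt\phi$ is $C^2$ with $\sup_{\mathbb R}|(\sqrt\phi)^{(j)}|\le c$ for $j=1,2$. The function $u\in C((0,T):H^s(\mathbb R^n))$ is real valued and solves $$\partial_tu-\partial_{x_1}(-\Delta)^{\alpha/2}u+u\,\partial_{x_1}u=0$$ on $(0,T)\times\mathbb R^n$ in the sense of distributions. Conclusion: for almost every $t\in(0,T)$ the distribution $(-\Delta)^{\frac12(s+\frac\alpha2)}u(t)$ is a locally integrable function on the open set $\{\partial_{x_1}\varphi>0\}$,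 jointly measurable in $(t,x)$, and $$\Big(\int_0^T\!\!\int_{\mathbb R^n}\big((-\Delta)^{\frac12(s+\frac\alpha2)}u\big)^2\,\partial_{x_1}\varphi\,dx\,dt\Big)^{1/2}\le K\Big(1+T+\|\nabla u\|_{L^1_TL^\infty_x}+T\|u\|_{L^\infty_TH^{r}_x}\Big)^{1/2}\|u\|_{L^\infty_TH^{s}_x},$$ where the time norms are over $(0,T)$ and the right-hand side may be infinite. -/

import Mathlib

open MeasureTheory Set Filter Topology FourierTransform LineDeriv
open scoped SchwartzMap ENNReal ContDiff

noncomputable section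

namespace FZK

/-- Euclidean space `ℝⁿ`. -/
abbrev E (n : ℕ) : Type := EuclideanSpace ℝ (Fin n)

/-- Real-valued `L²(ℝⁿ)`. -/
abbrev L2 (n : ℕ) : Type := Lp ℝ 2 (volume : Measure (E n))

variable {n : ℕ}

/-- The `j`-th vector of the canonical basis. -/
def basisVec (j : Fin n) : E n := EuclideanSpace.single j 1

/-- The `L²` Fourier transform (Plancherel extension, kernel `exp (-2πi x·ξ)`) of a real-valued
`L²` function. -/
def fourierL2 (f : L2 n) : Lp ℂ 2 (volume : Measure (E n)) :=
  𝓕 (Complex.ofRealCLM.compLp f)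

/-- The `L²` norm of `m(D) f`, where `m(D)` is the Fourier multiplier with symbol `m`; by
Plancherel it is the `L²` norm of `m · 𝓕 f`. It is `∞` when `m · 𝓕 f` is not in `L²`. -/
def multiplierNorm (m : E n → ℂ) (f : L2 n) : ℝ≥0∞ :=
  eLpNorm (fun ξ => m ξ * fourierL2 f ξ) 2 volume

/-- The Japanese bracket `⟨2πξ⟩ = (1 + |2πξ|²)^{1/2}`. -/
def bracket (ξ : E n) : ℝ := Real.sqrt (1 + (2 * Real.pi * ‖ξ‖) ^ 2)

/-- The norm of `H^s(ℝⁿ)`, `s ≥ 0`: the `L²` norm of `J^s f`, where `J = (1 - Δ)^{1/2}` has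
symbol `⟨2πξ⟩`. A function `f ∈ L²` is in `H^s` exactly when this is finite. -/
def sobolevNorm (s : ℝ) (f : L2 n) : ℝ≥0∞ :=
  multiplierNorm (fun ξ => ((bracket ξ ^ s : ℝ) : ℂ)) f

/-- `u ∈ C((0,T) : H^s(ℝⁿ))`. -/
def ContinuousInSobolev (s T : ℝ) (u : ℝ → L2 n) : Prop :=
  ∀ t ∈ Ioo 0 T, sobolevNorm s (u t) < ⊤ ∧
    Tendsto (fun τ => sobolevNorm s (u τ - u t)) (𝓝 t) (𝓝 0)

/-- The fractional Laplacian `(-Δ)^a` of a Schwartz function: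
`𝓕 ((-Δ)^a ψ) (ξ) = |2πξ|^{2a} 𝓕 ψ (ξ)`. -/
def fracLaplacian (a : ℝ) (ψ : 𝓢(E n, ℂ)) : E n → ℂ :=
  𝓕⁻ (fun ξ : E n => (((2 * Real.pi * ‖ξ‖) ^ (2 * a) : ℝ) : ℂ) * (𝓕 ψ) ξ)

/-- The distribution `(-Δ)^a f`, for `f ∈ L²`, tested against a Schwartz function:
`⟨(-Δ)^a f, ψ⟩ = ∫ f (-Δ)^a ψ`. -/
def fracLaplacianPairing (a : ℝ) (f : L2 n) (ψ : 𝓢(E n, ℂ)) : ℂ :=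
  ∫ x, (f x : ℂ) * fracLaplacian a ψ x

/-- On the open set `Ω`, the distribution `(-Δ)^a f` is the locally integrable function `g`. -/
def IsFracLaplacianOn (a : ℝ) (f : L2 n) (Ω : Set (E n)) (g : E n → ℝ) : Prop :=
  LocallyIntegrableOn g Ω ∧
    ∀ ψ : 𝓢(E n, ℂ), HasCompactSupport ψ → tsupport ψ ⊆ Ω →
      ∫ x, (g x : ℂ) * ψ x = fracLaplacianPairing a f ψ

/-- `u` solves `∂_t u - ∂_{x₁} (-Δ)^{α/2} u + u ∂_{x₁} u = 0` for `0 < t < T` in the sense of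
distributions: for every Schwartz function `ψ` and every `t ∈ (0,T)`,
`d/dt ∫ u ψ = - ∫ u (-Δ)^{α/2} ∂_{x₁} ψ + (1/2) ∫ u² ∂_{x₁} ψ`. -/
def IsSolution [NeZero n] (α T : ℝ) (u : ℝ → L2 n) : Prop :=
  ∀ ψ : 𝓢(E n, ℂ), ∀ t ∈ Ioo 0 T,
    HasDerivAt (fun τ : ℝ => ∫ x, (u τ x : ℂ) * ψ x)
      (- fracLaplacianPairing (α / 2) (u t) (∂_{basisVec (0 : Fin n)} ψ)
        + (1 / 2 : ℂ) * ∫ x, ((u t x : ℂ) ^ 2) * (∂_{basisVec (0 : Fin n)} ψ) x) t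

/-- `G` is the weak gradient of `f`. -/
def IsWeakGradient (f : L2 n) (G : E n → E n) : Prop :=
  LocallyIntegrable G ∧
    ∀ ψ : E n → ℝ, ContDiff ℝ ∞ ψ → HasCompactSupport ψ → ∀ j : Fin n,
      ∫ x, f x * fderiv ℝ ψ x (basisVec j) = - ∫ x, G x j * ψ x

/-- `‖∇f‖_{L^∞}`: the essential supremum of the Euclidean length of the weak gradient of `f`
(which is unique almost everywhere), and `∞` if there is no weak gradient. -/
def gradSupNorm (f : L2 n) : ℝ≥0∞ :=
  ⨅ (G : E n → E n) (_ : IsWeakGradient f G), eLpNorm G ⊤ volume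

/-- `‖u‖_{L^∞_T H^s_x}`. -/
def normLinfSobolev (s T : ℝ) (u : ℝ → L2 n) : ℝ≥0∞ :=
  essSup (fun t => sobolevNorm s (u t)) (volume.restrict (Ioo 0 T))

/-- `‖∇u‖_{L¹_T L^∞_x}`. -/
def normGradL1Linf (T : ℝ) (u : ℝ → L2 n) : ℝ≥0∞ :=
  ∫⁻ t in Ioo 0 T, gradSupNorm (u t)

/-- The best constant `C` in `‖J^{-1} ∂_{x_j} f‖_{L²} ≤ C ‖f‖_{L²}`, `f ∈ L²(ℝⁿ)`,
`j = 2, …, n` (indices different from the first one). -/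
def derivBesselConst (n : ℕ) [NeZero n] : ℝ :=
  (⨆ (j : Fin n) (_ : j ≠ 0) (f : L2 n) (_ : f ≠ 0),
    multiplierNorm
      (fun ξ => 2 * Real.pi * Complex.I * (ξ j : ℂ) * ((bracket ξ)⁻¹ : ℝ)) f / ‖f‖ₑ).toReal

/-- `|ν̄| = (ν₂² + … + νₙ²)^{1/2}`. -/
def transverseNorm [NeZero n] (ν : E n) : ℝ :=
  Real.sqrt (∑ j ∈ Finset.univ.filter (fun j : Fin n => j ≠ 0), ν j ^ 2)

/-- The two admissible cases for the direction `ν`. -/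
def AdmissibleDirection [NeZero n] (α : ℝ) (ν : E n) : Prop :=
  (0 < ν 0 ∧ ∀ j : Fin n, j ≠ 0 → ν j = 0) ∨
  (0 < ν 0 ∧ (∃ j : Fin n, j ≠ 0 ∧ ν j ≠ 0) ∧
    ∃ ε : ℝ, 0 < ε ∧
      ε < ν 0 / (transverseNorm ν * Real.sqrt (n - 1))
        - α * Real.sqrt (n - 1) * transverseNorm ν / (4 * ν 0) * derivBesselConst n ^ 2 ∧
      0 < transverseNorm ν ∧
      transverseNorm ν <
        min (2 * ν 0 / (derivBesselConst n * Real.sqrt (α * (n - 1))))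
          (ν 0 * (1 + α) / (α * ε * Real.sqrt (n - 1))))

/-- `φ` is a weight `φ(x) = ϕ(ν·x + δ)` with a profile `ϕ` all of whose bounds hold with the
constant `c`. -/
def AdmissibleWeight (ν : E n) (c : ℝ) (φ : E n → ℝ) : Prop :=
  ∃ (ϕ : ℝ → ℝ) (δ : ℝ),
    ContDiff ℝ ∞ ϕ ∧ Monotone ϕ ∧
    (∀ x, φ x = ϕ (inner ℝ ν x + δ)) ∧
    (∀ y ∈ Icc (0 : ℝ) 1, deriv ϕ y = 1) ∧
    (∀ j ≤ 4, ∀ y, |iteratedDeriv j ϕ y| ≤ c) ∧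
    (∀ y, 0 ≤ deriv ϕ y) ∧
    (∀ y, 0 ≤ ϕ y) ∧
    ContDiff ℝ 2 (fun y => Real.sqrt (ϕ y)) ∧
    (∀ j : ℕ, 1 ≤ j → j ≤ 2 → ∀ y, |iteratedDeriv j (fun z => Real.sqrt (ϕ z)) y| ≤ c)

/-- `∂_{x₁} φ`. -/
def partialOne [NeZero n] (φ : E n → ℝ) (x : E n) : ℝ :=
  fderiv ℝ φ x (basisVec (0 : Fin n))

end FZK

end

/-!
# Local smoothing for a fractional dispersive equation

The proof is Kato's energy argument. Let `v = J^s u`, with the symbol `⟨2πξ⟩^s` smoothly truncated at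
high frequencies (`moll`), so that every pairing below is finite, and differentiate the weighted
energy `⟨φ v, v⟩` in time.

*Dispersion.* The commutator of `φ` with `∂₁(-Δ)^{α/2}` is analysed without pseudodifferential
calculus. The symbol `ξ₁|ξ|^α` is an integral of the sines `sin (2π ξ·z)`, `z = σ y`, over `σ > 0` and
a Gaussian vector `y` (`integral_sinKer`). The multiplier `i sin (2π ξ·z)` is half the difference of the
translations by `z` and `-z`, and the real part of its pairing with `φ v` sees only the differences `φ(x + z) - φ(x)`. By the error bound
of the trapezoidal rule and the Lipschitz continuity of `h = √(ϕ'(ν·x + δ))`, these differences are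
`(ν·z) h(x) h(x + z) + O(|z|³)` (`exists_weightData`). The main part reassembles to the quadratic form,
evaluated at `h v`, of the Fourier multiplier `|ξ|^{α-2} (ν₁|ξ|² + α ξ₁ (ν·ξ))` up to a constant
(`integral_cosKer`), and the remainder is an operator bounded on `L²`, as `α < 2`. In the admissible
directions that multiplier is elliptic (`exists_elliptic`), and the energy inequality gains
`-c ‖|D|^{α/2}(h v)‖²` (`commutator_estimate`).

*Transport.* The term `u ∂₁u` costs at most `‖⟨2πξ⟩ û‖_{L¹} ‖u‖²_{H^s}` (`abs_re_inner_transport_le`),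
and since `r > n/2 + 1` the first factor is controlled by `‖u‖_{H^r}`. The term
`‖∇u‖_{L¹_T L^∞_x}` on the right-hand side of the theorem is therefore not needed.

*Conclusion.* Integration in time and removal of the truncation give the smoothing effect
`h J^s u ∈ L²_T H^{α/2}` (`exists_energy_estimate`, `exists_smoothing`, `exists_global_smoothing`). The
commutator `[h, |D|^{α/2}]` is bounded on `L²`, by the same superposition of translations, and
`|2πξ|^{s+α/2}` differs from `⟨2πξ⟩^s |2πξ|^{α/2}` by a bounded multiple of `⟨2πξ⟩^s`; hence
`h (-Δ)^{(s+α/2)/2} u` is an `L²` function (`localDeriv`, `fracLaplacianPairing_eq_inner`). Division by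
`h` gives the locally integrable function on `{h > 0}` (`isFracLaplacianOn_of_pairing`), a jointly
measurable version of it comes from `exists_measurable_representative`, and
`∂₁φ = ν₁ h²` turns the bound into the weighted one.
-/

noncomputable section

namespace FZK

variable {n : ℕ}

/-! ### Multipliers, translations and the Fourier transform on `L²` -/

/-- Complex-valued `L²(ℝⁿ)`. -/
abbrev L2C (n : ℕ) : Type := Lp ℂ 2 (volume : Measure (E n))

open Classical in
/-- Multiplication of an `L²` function by `m`; the value is `0` when the product is not in `L²`. -/
def mulOp (m : E n → ℂ) (f : L2C n) : L2C n :=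
  if h : MemLp (fun x => m x * f x) 2 volume then h.toLp _ else 0

/-- `m` is measurable and bounded by `C`. -/
def BddMeas (m : E n → ℂ) (C : ℝ) : Prop := Measurable m ∧ ∀ x, ‖m x‖ ≤ C

theorem coeFn_mulOp_of_memLp {m : E n → ℂ} {f : L2C n}
    (h : MemLp (fun x => m x * f x) 2 volume) : mulOp m f =ᵐ[volume] fun x => m x * f x := by
  rw [mulOp, dif_pos h]; exact h.coeFn_toLp

theorem BddMeas.memLp {m : E n → ℂ} {C : ℝ} (hm : BddMeas m C) (f : L2C n) :
    MemLp (fun x => m x * f x) 2 volume :=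
  MemLp.of_le_mul (c := C) (Lp.memLp f)
    (hm.1.aestronglyMeasurable.mul (Lp.aestronglyMeasurable f))
    (Eventually.of_forall fun x => by
      rw [norm_mul]; exact mul_le_mul_of_nonneg_right (hm.2 x) (norm_nonneg _))

theorem BddMeas.coeFn {m : E n → ℂ} {C : ℝ} (hm : BddMeas m C) (f : L2C n) :
    mulOp m f =ᵐ[volume] fun x => m x * f x := coeFn_mulOp_of_memLp (hm.memLp f)

theorem BddMeas.nonneg {m : E n → ℂ} {C : ℝ} (hm : BddMeas m C) : 0 ≤ C :=
  (norm_nonneg _).trans (hm.2 0)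

theorem BddMeas.norm_le {m : E n → ℂ} {C : ℝ} (hm : BddMeas m C) (f : L2C n) :
    ‖mulOp m f‖ ≤ C * ‖f‖ := by
  refine Lp.norm_le_mul_norm_of_ae_le_mul ?_
  filter_upwards [hm.coeFn f] with x hx
  rw [hx, norm_mul]; exact mul_le_mul_of_nonneg_right (hm.2 x) (norm_nonneg _)

theorem BddMeas.mul {m k : E n → ℂ} {C D : ℝ} (hm : BddMeas m C) (hk : BddMeas k D) :
    BddMeas (fun x => m x * k x) (C * D) :=
  ⟨hm.1.mul hk.1, fun x => by
    rw [norm_mul]; exact mul_le_mul (hm.2 x) (hk.2 x) (norm_nonneg _) hm.nonneg⟩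

theorem BddMeas.conj {m : E n → ℂ} {C : ℝ} (hm : BddMeas m C) :
    BddMeas (fun x => starRingEnd ℂ (m x)) C :=
  ⟨Complex.continuous_conj.measurable.comp hm.1, fun x => by
    rw [RCLike.norm_conj]; exact hm.2 x⟩

theorem BddMeas.add_apply {m : E n → ℂ} {C : ℝ} (hm : BddMeas m C) (f g : L2C n) :
    mulOp m (f + g) = mulOp m f + mulOp m g := by
  refine Lp.ext ?_
  filter_upwards [hm.coeFn (f + g), hm.coeFn f, hm.coeFn g, Lp.coeFn_add f g,
    Lp.coeFn_add (mulOp m f) (mulOp m g)] with x h1 h2 h3 h4 h5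
  rw [h1, h5, h4, Pi.add_apply, Pi.add_apply, h2, h3, mul_add]

theorem BddMeas.smul_apply {m : E n → ℂ} {C : ℝ} (hm : BddMeas m C) (c : ℂ) (f : L2C n) :
    mulOp m (c • f) = c • mulOp m f := by
  refine Lp.ext ?_
  filter_upwards [hm.coeFn (c • f), hm.coeFn f, Lp.coeFn_smul c f,
    Lp.coeFn_smul c (mulOp m f)] with x h1 h2 h4 h5
  rw [h1, h5, h4, Pi.smul_apply, Pi.smul_apply, h2, smul_eq_mul, smul_eq_mul]; ring

/-- Multiplication by a bounded measurable function, as a bounded operator on `L²`. -/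
def BddMeas.clm {m : E n → ℂ} {C : ℝ} (hm : BddMeas m C) : L2C n →L[ℂ] L2C n :=
  LinearMap.mkContinuous
    { toFun := mulOp m, map_add' := hm.add_apply, map_smul' := hm.smul_apply } C hm.norm_le

theorem BddMeas.continuous {m : E n → ℂ} {C : ℝ} (hm : BddMeas m C) :
    Continuous (mulOp m : L2C n → L2C n) := hm.clm.continuous

theorem inner_eq_integral (f g : L2C n) :
    inner ℂ f g = ∫ x, starRingEnd ℂ (f x) * g x := by
  rw [L2.inner_def]; refine integral_congr_ae (Eventually.of_forall fun x => ?_)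
  simp only [RCLike.inner_apply]; rw [mul_comm]

theorem integrable_conj_mul (f g : L2C n) :
    Integrable (fun x => starRingEnd ℂ (f x) * g x) volume := by
  refine (L2.integrable_inner (𝕜 := ℂ) f g).congr (Eventually.of_forall fun x => ?_)
  simp only [RCLike.inner_apply]; rw [mul_comm]

theorem integrable_norm_mul_norm (f g : L2C n) :
    Integrable (fun x => ‖f x‖ * ‖g x‖) volume := by
  refine (integrable_conj_mul f g).norm.congr (Eventually.of_forall fun x => ?_)
  simp

theorem integral_norm_mul_norm_le (f g : L2C n) :
    ∫ x, ‖f x‖ * ‖g x‖ ≤ ‖f‖ * ‖g‖ := by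
  have hF := (Lp.memLp f).norm
  have hG := (Lp.memLp g).norm
  have h := integral_mul_norm_le_Lp_mul_Lq (μ := (volume : Measure (E n)))
    (f := fun x => f x) (g := fun x => g x) (p := 2) (q := 2)
    (by constructor <;> norm_num) (by simpa using Lp.memLp f) (by simpa using Lp.memLp g)
  refine h.trans (le_of_eq ?_)
  rw [Lp.norm_def, Lp.norm_def, (Lp.memLp f).eLpNorm_eq_integral_rpow_norm (by norm_num) (by norm_num),
    (Lp.memLp g).eLpNorm_eq_integral_rpow_norm (by norm_num) (by norm_num),
    ENNReal.toReal_ofReal (by positivity), ENNReal.toReal_ofReal (by positivity)]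
  norm_num

theorem norm_sq_eq_integral (f : L2C n) : ‖f‖ ^ 2 = ∫ x, ‖f x‖ ^ 2 := by
  have := inner_eq_integral f f
  rw [inner_self_eq_norm_sq_to_K] at this
  have h2 : ∀ x, starRingEnd ℂ (f x) * f x = ((‖f x‖ ^ 2 : ℝ) : ℂ) := fun x => by
    rw [mul_comm, Complex.mul_conj, Complex.normSq_eq_norm_sq]
  simp_rw [h2] at this
  rw [integral_complex_ofReal] at this
  have h3 := congrArg Complex.re this
  rw [Complex.ofReal_re] at h3
  rw [← h3, ← Complex.ofReal_re (‖f‖ ^ 2)]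
  congr 1; push_cast; rfl

theorem integrable_norm_sq (f : L2C n) : Integrable (fun x => ‖f x‖ ^ 2) volume := by
  simpa [sq] using integrable_norm_mul_norm f f

theorem BddMeas.inner_left {m : E n → ℂ} {C : ℝ} (hm : BddMeas m C) (f g : L2C n) :
    inner ℂ (mulOp m f) g = inner ℂ f (mulOp (fun x => starRingEnd ℂ (m x)) g) := by
  rw [inner_eq_integral, inner_eq_integral]
  refine integral_congr_ae ?_
  filter_upwards [hm.coeFn f, hm.conj.coeFn g] with x h1 h2
  rw [h1, h2, map_mul]; ring

theorem BddMeas.mulOp_mulOp {m k : E n → ℂ} {C D : ℝ} (hm : BddMeas m C) (hk : BddMeas k D)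
    (f : L2C n) : mulOp m (mulOp k f) = mulOp (fun x => m x * k x) f := by
  refine Lp.ext ?_
  filter_upwards [hm.coeFn (mulOp k f), hk.coeFn f, (hm.mul hk).coeFn f] with x h1 h2 h3
  rw [h1, h2, h3, mul_assoc]

theorem inner_fourier (f g : L2C n) : inner ℂ (𝓕 f) (𝓕 g) = inner ℂ f g :=
  Lp.inner_fourier_eq f g

theorem norm_fourier (f : L2C n) : ‖𝓕 f‖ = ‖f‖ := Lp.norm_fourier_eq f

theorem norm_fourierInv (f : L2C n) : ‖𝓕⁻ f‖ = ‖f‖ := by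
  rw [← norm_fourier, FourierTransform.fourier_fourierInv_eq]

/-- On `L¹ ∩ L²` the `L²` Fourier transform is given by the Fourier integral. -/
theorem fourier_toLp_ae {k : E n → ℂ} (h1 : Integrable k) (h2 : MemLp k 2 volume) :
    ((𝓕 (h2.toLp k) : L2C n) : E n → ℂ) =ᵐ[volume] 𝓕 k := by
  have hcont : Continuous (𝓕 k) :=
    VectorFourier.fourierIntegral_continuous Real.continuous_fourierChar
      (by exact continuous_inner) h1
  refine ae_eq_of_integral_contDiff_smul_eq ((Lp.memLp _).locallyIntegrable (by norm_num : (1 : ℝ≥0∞) ≤ 2))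
    hcont.locallyIntegrable fun θ hθ hc => ?_
  have hc' : HasCompactSupport (fun x => (θ x : ℂ)) := hc.comp_left (g := fun r : ℝ => (r : ℂ)) (by simp)
  have hθ' : ContDiff ℝ ∞ (fun x => (θ x : ℂ)) := Complex.ofRealCLM.contDiff.comp hθ
  set Θ : 𝓢(E n, ℂ) := hc'.toSchwartzMap hθ' with hΘ
  have hΘv : ∀ x, Θ x = (θ x : ℂ) := fun x => rfl
  have e1 := congrArg (fun T => T Θ) (Lp.fourier_toTemperedDistribution_eq (h2.toLp k))
  simp only [TemperedDistribution.fourier_apply, Lp.toTemperedDistribution_apply] at e1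
  have e2 : ∫ x, (𝓕 Θ) x • (h2.toLp k) x = ∫ x, (𝓕 Θ) x • k x :=
    integral_congr_ae (by filter_upwards [h2.coeFn_toLp] with x hx; rw [hx])
  have e3 : ∫ x, (𝓕 (fun y => (Θ y))) x • k x = ∫ x, Θ x • (𝓕 k) x := by
    have := VectorFourier.integral_fourierIntegral_smul_eq_flip (L := innerₗ (E n))
      (μ := volume) (ν := volume) Real.continuous_fourierChar (by exact continuous_inner)
      Θ.integrable h1
    rw [flip_innerₗ] at this
    exact this
  calc ∫ x, θ x • (𝓕 (h2.toLp k)) x = ∫ x, Θ x • (𝓕 (h2.toLp k)) x := by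
        simp only [hΘv, Complex.real_smul, smul_eq_mul]
    _ = ∫ x, Θ x • (𝓕 k) x := by rw [← e1, e2, ← e3]; rfl
    _ = ∫ x, θ x • (𝓕 k) x := by simp only [hΘv, Complex.real_smul, smul_eq_mul]

theorem fourierInv_toLp_ae {k : E n → ℂ} (h1 : Integrable k) (h2 : MemLp k 2 volume) :
    ((𝓕⁻ (h2.toLp k) : L2C n) : E n → ℂ) =ᵐ[volume] 𝓕⁻ k := by
  have hcont : Continuous (𝓕⁻ k) := by
    rw [Real.fourierInv_eq_fourier_comp_neg]
    exact VectorFourier.fourierIntegral_continuous Real.continuous_fourierChar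
      (by exact continuous_inner) h1.comp_neg
  refine ae_eq_of_integral_contDiff_smul_eq ((Lp.memLp _).locallyIntegrable (by norm_num : (1 : ℝ≥0∞) ≤ 2))
    hcont.locallyIntegrable fun θ hθ hc => ?_
  have hc' : HasCompactSupport (fun x => (θ x : ℂ)) := hc.comp_left (g := fun r : ℝ => (r : ℂ)) (by simp)
  have hθ' : ContDiff ℝ ∞ (fun x => (θ x : ℂ)) := Complex.ofRealCLM.contDiff.comp hθ
  set Θ : 𝓢(E n, ℂ) := hc'.toSchwartzMap hθ' with hΘ
  have hΘv : ∀ x, Θ x = (θ x : ℂ) := fun x => rfl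
  have e1 := congrArg (fun T => T Θ) (Lp.fourierInv_toTemperedDistribution_eq (h2.toLp k))
  simp only [TemperedDistribution.fourierInv_apply, Lp.toTemperedDistribution_apply] at e1
  have e2 : ∫ x, (𝓕⁻ Θ) x • (h2.toLp k) x = ∫ x, (𝓕⁻ Θ) x • k x :=
    integral_congr_ae (by filter_upwards [h2.coeFn_toLp] with x hx; rw [hx])
  have e3 : ∫ x, (𝓕⁻ (fun y => (Θ y))) x • k x = ∫ x, Θ x • (𝓕⁻ k) x := by
    have := VectorFourier.integral_fourierIntegral_smul_eq_flip (L := -innerₗ (E n))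
      (μ := volume) (ν := volume) Real.continuous_fourierChar
      (by exact (continuous_inner (𝕜 := ℝ) (E := E n)).neg)
      Θ.integrable h1
    have hf : (-innerₗ (E n)).flip = -innerₗ (E n) := by
      ext x y; simp [real_inner_comm]
    rw [hf] at this
    exact this
  calc ∫ x, θ x • (𝓕⁻ (h2.toLp k)) x = ∫ x, Θ x • (𝓕⁻ (h2.toLp k)) x := by
        simp only [hΘv, Complex.real_smul, smul_eq_mul]
    _ = ∫ x, Θ x • (𝓕⁻ k) x := by rw [← e1, e2, ← e3, SchwartzMap.fourierInv_coe]
    _ = ∫ x, θ x • (𝓕⁻ k) x := by simp only [hΘv, Complex.real_smul, smul_eq_mul]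

/-- The translation `f ↦ f (· + z)` on `L²`. -/
def tr (z : E n) : L2C n →L[ℂ] L2C n :=
  (Lp.compMeasurePreservingₗᵢ ℂ (fun x => x + z)
    (measurePreserving_add_right volume z)).toContinuousLinearMap

theorem coeFn_tr (z : E n) (f : L2C n) : tr z f =ᵐ[volume] fun x => f (x + z) :=
  Lp.coeFn_compMeasurePreserving f (measurePreserving_add_right volume z)

theorem norm_tr (z : E n) (f : L2C n) : ‖tr z f‖ = ‖f‖ :=
  Lp.norm_compMeasurePreserving f (measurePreserving_add_right volume z)

theorem continuous_tr (f : L2C n) : Continuous fun z : E n => tr z f := by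
  have h : Continuous fun z : E n => (⟨fun x => x + z, by fun_prop⟩ : C(E n, E n)) :=
    ContinuousMap.continuous_of_continuous_uncurry _ (continuous_snd.add continuous_fst)
  exact (continuous_const (y := f)).compMeasurePreservingLp h
    (fun z => measurePreserving_add_right volume z) (by norm_num)

/-- The character `ξ ↦ exp (2πi ξ·z)`. -/
def chr (z ξ : E n) : ℂ := Complex.exp (2 * Real.pi * Complex.I * (inner ℝ ξ z : ℝ))

theorem norm_chr (z ξ : E n) : ‖chr z ξ‖ = 1 := by
  rw [chr, show (2 * Real.pi * Complex.I * (inner ℝ ξ z : ℝ) : ℂ)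
    = ((2 * Real.pi * inner ℝ ξ z : ℝ) : ℂ) * Complex.I by push_cast; ring]
  exact Complex.norm_exp_ofReal_mul_I _

theorem chr_eq_fourierChar (z ξ : E n) : chr z ξ = (Real.fourierChar (inner ℝ ξ z) : ℂ) := by
  rw [chr, Real.fourierChar_apply]; congr 1; push_cast; ring

theorem continuous_chr : Continuous fun p : E n × E n => chr p.1 p.2 := by
  unfold chr; fun_prop

theorem bddMeas_chr (z : E n) : BddMeas (chr z) 1 :=
  ⟨(continuous_chr.comp (by fun_prop : Continuous fun ξ : E n => (z, ξ))).measurable,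
    fun ξ => (norm_chr z ξ).le⟩

theorem dense_schwartz : DenseRange fun g : 𝓢(E n, ℂ) => g.toLp 2 (volume : Measure (E n)) :=
  SchwartzMap.denseRange_toLpCLM (F := ℂ) (E := E n) (p := 2) (by norm_num)

theorem ext_of_schwartz {G₁ G₂ : L2C n → L2C n} (h1 : Continuous G₁) (h2 : Continuous G₂)
    (h : ∀ g : 𝓢(E n, ℂ), G₁ (g.toLp 2) = G₂ (g.toLp 2)) (f : L2C n) : G₁ f = G₂ f :=
  congrFun (DenseRange.equalizer dense_schwartz h1 h2 (funext h)) f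

theorem continuous_fourier : Continuous (fun f : L2C n => (𝓕 f : L2C n)) :=
  (Lp.fourierTransformₗᵢ (E n) ℂ).continuous

theorem continuous_fourierInv : Continuous (fun f : L2C n => (𝓕⁻ f : L2C n)) :=
  (Lp.fourierTransformₗᵢ (E n) ℂ).symm.continuous

/-- A translation is the Fourier multiplier with symbol a character. -/
theorem fourier_tr (z : E n) (f : L2C n) : 𝓕 (tr z f) = mulOp (chr z) (𝓕 f) := by
  refine ext_of_schwartz (G₁ := fun f => 𝓕 (tr z f)) (G₂ := fun f => mulOp (chr z) (𝓕 f))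
    (continuous_fourier.comp (tr z).continuous)
    ((bddMeas_chr z).continuous.comp continuous_fourier) (fun g => ?_) f
  have hi : Integrable (fun x => g (x + z)) := g.integrable.comp_add_right z
  have hm : MemLp (fun x => g (x + z)) 2 volume :=
    (g.memLp 2 volume).comp_measurePreserving (measurePreserving_add_right volume z)
  have e1 : tr z (g.toLp 2) = hm.toLp _ := by
    refine Lp.ext ?_
    filter_upwards [coeFn_tr z (g.toLp 2), hm.coeFn_toLp,
      (measurePreserving_add_right volume z).quasiMeasurePreserving.ae_eq_comp
        (g.coeFn_toLp 2 volume)] with x h1 h2 h3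
    rw [h1, h2]; exact h3
  simp only [e1]
  refine Lp.ext ?_
  filter_upwards [fourier_toLp_ae hi hm, (bddMeas_chr z).coeFn (𝓕 (g.toLp 2)),
    fourier_toLp_ae g.integrable (g.memLp 2 volume)] with ξ h1 h2 h3
  rw [h1, h2]
  have : (𝓕 (g.toLp 2) : L2C n) ξ = 𝓕 (fun x => g x) ξ := h3
  rw [this, Real.fourier_eq, Real.fourier_eq, ← integral_const_mul,
    ← integral_add_right_eq_self (fun v => chr z ξ * (Real.fourierChar (-inner ℝ v ξ) • g v)) z]
  refine integral_congr_ae (Eventually.of_forall fun x => ?_)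
  simp only [Circle.smul_def, smul_eq_mul, chr_eq_fourierChar, inner_add_left, neg_add,
    AddChar.map_add_eq_mul, Circle.coe_mul, real_inner_comm ξ z, AddChar.map_neg_eq_inv]
  have h0 : (Real.fourierChar (inner ℝ z ξ) : ℂ) ≠ 0 := Circle.coe_ne_zero _
  rw [Circle.coe_inv, Circle.coe_inv]
  field_simp

theorem fourier_modulation (z : E n) (f : L2C n) : 𝓕 (mulOp (chr z) f) = tr (-z) (𝓕 f) := by
  refine ext_of_schwartz (G₁ := fun f => 𝓕 (mulOp (chr z) f)) (G₂ := fun f => tr (-z) (𝓕 f))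
    (continuous_fourier.comp (bddMeas_chr z).continuous)
    ((tr (-z)).continuous.comp continuous_fourier) (fun g => ?_) f
  have hi : Integrable (fun x => chr z x * g x) :=
    g.integrable.bdd_mul (bddMeas_chr z).1.aestronglyMeasurable
      (Eventually.of_forall (bddMeas_chr z).2)
  have hm : MemLp (fun x => chr z x * g x) 2 volume :=
    ((bddMeas_chr z).memLp (g.toLp 2)).ae_eq (by
      filter_upwards [g.coeFn_toLp 2 volume] with x hx; rw [hx])
  have e1 : mulOp (chr z) (g.toLp 2) = hm.toLp _ := by
    refine Lp.ext ?_
    filter_upwards [(bddMeas_chr z).coeFn (g.toLp 2), hm.coeFn_toLp,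
        g.coeFn_toLp 2 volume] with x h1 h2 h3
    rw [h1, h2, h3]
  simp only [e1]
  refine Lp.ext ?_
  filter_upwards [fourier_toLp_ae hi hm, coeFn_tr (-z) (𝓕 (g.toLp 2)),
    (measurePreserving_add_right volume (-z)).quasiMeasurePreserving.ae_eq_comp
      (fourier_toLp_ae g.integrable (g.memLp 2 volume))] with ξ h1 h2 h3
  rw [h1, h2]
  have : (𝓕 (g.toLp 2) : L2C n) (ξ + -z) = 𝓕 (fun x => g x) (ξ + -z) := h3
  rw [this, Real.fourier_eq, Real.fourier_eq]
  refine integral_congr_ae (Eventually.of_forall fun x => ?_)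
  simp only [Circle.smul_def, smul_eq_mul, chr_eq_fourierChar, inner_add_right, neg_add,
    AddChar.map_add_eq_mul, Circle.coe_mul, inner_neg_right, neg_neg]
  ring

/-! ### Gaussian integrals -/

/-- The Gaussian probability measure with density `exp (-π|y|²)`. -/
def gm (n : ℕ) : Measure (E n) :=
  volume.withDensity fun y => ENNReal.ofReal (Real.exp (-Real.pi * ‖y‖ ^ 2))

theorem measurable_gaussianDensity :
    Measurable fun y : E n => Real.exp (-Real.pi * ‖y‖ ^ 2) := by fun_prop

theorem integral_gm {F : Type*} [NormedAddCommGroup F] [NormedSpace ℝ F] (f : E n → F) :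
    ∫ y, f y ∂gm n = ∫ y, Real.exp (-Real.pi * ‖y‖ ^ 2) • f y := by
  rw [gm, integral_withDensity_eq_integral_toReal_smul
    (measurable_gaussianDensity.ennreal_ofReal)
    (Eventually.of_forall fun y => ENNReal.ofReal_lt_top)]
  simp only [ENNReal.toReal_ofReal (Real.exp_pos _).le]

theorem integrable_gm_iff {F : Type*} [NormedAddCommGroup F] [NormedSpace ℝ F] {f : E n → F} :
    Integrable f (gm n) ↔ Integrable fun y => Real.exp (-Real.pi * ‖y‖ ^ 2) • f y := by
  rw [gm, integrable_withDensity_iff_integrable_smul'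
    (measurable_gaussianDensity.ennreal_ofReal)
    (Eventually.of_forall fun y => ENNReal.ofReal_lt_top)]
  simp only [ENNReal.toReal_ofReal (Real.exp_pos _).le]

theorem integrable_gaussian {b : ℝ} (hb : 0 < b) :
    Integrable fun y : E n => Real.exp (-b * ‖y‖ ^ 2) := by
  have := (GaussianFourier.integrable_cexp_neg_mul_sq_norm_add (b := b) (V := E n)
    (by simpa using hb) 0 0).norm
  refine this.congr (Eventually.of_forall fun y => ?_)
  simp only [Complex.norm_exp]
  congr 1
  have : (-(b:ℂ) * (‖y‖:ℂ) ^ 2 + 0 * (inner ℝ 0 y : ℝ)) = ((-b * ‖y‖ ^ 2 : ℝ) : ℂ) := by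
    push_cast; ring
  rw [this, Complex.ofReal_re]

/-- All moments of the Gaussian measure are finite. -/
theorem integrable_moment (k : ℕ) : Integrable (fun y : E n => (1 + ‖y‖) ^ k) (gm n) := by
  rw [integrable_gm_iff]
  refine Integrable.mono' ((integrable_gaussian (n := n) one_pos).const_mul
    ((k.factorial : ℝ) * Real.exp 2)) (by fun_prop) (Eventually.of_forall fun y => ?_)
  have hx : (0 : ℝ) ≤ 1 + ‖y‖ := by positivity
  rw [norm_smul, Real.norm_of_nonneg (Real.exp_pos _).le, Real.norm_of_nonneg (by positivity)]
  have h1 : (1 + ‖y‖) ^ k ≤ k.factorial * Real.exp (1 + ‖y‖) := by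
    have := Real.pow_div_factorial_le_exp _ hx k
    rwa [div_le_iff₀ (by positivity), mul_comm] at this
  calc Real.exp (-Real.pi * ‖y‖ ^ 2) * (1 + ‖y‖) ^ k
      ≤ Real.exp (-Real.pi * ‖y‖ ^ 2) * (k.factorial * Real.exp (1 + ‖y‖)) := by gcongr
    _ = k.factorial * Real.exp (1 + ‖y‖ - Real.pi * ‖y‖ ^ 2) := by
        rw [mul_left_comm, ← Real.exp_add]; ring_nf
    _ ≤ k.factorial * Real.exp (2 + -1 * ‖y‖ ^ 2) := by
        gcongr
        nlinarith [Real.pi_gt_three, sq_nonneg (‖y‖ - 1 / 2), sq_nonneg ‖y‖, norm_nonneg y,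
          mul_le_mul_of_nonneg_right Real.pi_gt_three.le (sq_nonneg ‖y‖)]
    _ = k.factorial * Real.exp 2 * Real.exp (-1 * ‖y‖ ^ 2) := by rw [Real.exp_add]; ring

theorem integrable_of_le_moment {F : Type*} [NormedAddCommGroup F] {f : E n → F}
    (hf : Continuous f) {C : ℝ} {k : ℕ} (h : ∀ y, ‖f y‖ ≤ C * (1 + ‖y‖) ^ k) :
    Integrable f (gm n) :=
  ((integrable_moment k).const_mul C).mono' hf.aestronglyMeasurable (Eventually.of_forall h)

theorem integral_exp_gm (η : E n) :
    ∫ y, Complex.exp (2 * Real.pi * Complex.I * (inner ℝ η y : ℝ)) ∂gm n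
      = (Real.exp (-Real.pi * ‖η‖ ^ 2) : ℂ) := by
  have h := GaussianFourier.integral_cexp_neg_mul_sq_norm_add (b := Real.pi) (V := E n)
    (by simpa using Real.pi_pos) (2 * Real.pi * Complex.I) η
  rw [integral_gm]
  have hpi : (Real.pi : ℂ) ≠ 0 := by exact_mod_cast Real.pi_ne_zero
  rw [div_self hpi, Complex.one_cpow, one_mul] at h
  have h1 : ((Real.exp (-Real.pi * ‖η‖ ^ 2) : ℝ) : ℂ)
      = Complex.exp ((2 * Real.pi * Complex.I) ^ 2 * (‖η‖ : ℂ) ^ 2 / (4 * Real.pi)) := by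
    rw [Complex.ofReal_exp]
    congr 1
    rw [mul_pow, mul_pow, Complex.I_sq]; push_cast; field_simp; ring
  rw [h1, ← h]
  refine integral_congr_ae (Eventually.of_forall fun y => ?_)
  simp only [Complex.real_smul, Complex.ofReal_exp]
  rw [Complex.exp_add]; push_cast; rfl

instance : IsFiniteMeasure (gm n) := by
  have h := integrable_moment (n := n) 0
  simp only [pow_zero] at h
  rcases (integrable_const_iff.1 h) with h | h
  · exact absurd h one_ne_zero
  · exact h

theorem integral_cos_gm (η : E n) :
    ∫ y, Real.cos (2 * Real.pi * inner ℝ η y) ∂gm n = Real.exp (-Real.pi * ‖η‖ ^ 2) := by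
  have h1 : ∀ y : E n, (2 * Real.pi * Complex.I * (inner ℝ η y : ℝ) : ℂ)
      = ((2 * Real.pi * inner ℝ η y : ℝ) : ℂ) * Complex.I := fun y => by push_cast; ring
  have hi : Integrable (fun y : E n =>
      Complex.exp (2 * Real.pi * Complex.I * (inner ℝ η y : ℝ))) (gm n) :=
    integrable_of_le_moment (C := 1) (k := 0) (by fun_prop) fun y => by
      rw [h1, Complex.norm_exp_ofReal_mul_I]; simp
  have h := congrArg Complex.re (integral_exp_gm η)
  rw [← Complex.reCLM_apply, ← ContinuousLinearMap.integral_comp_comm _ hi] at h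
  simp only [Complex.reCLM_apply, Complex.ofReal_re] at h
  rw [← h]
  refine integral_congr_ae (Eventually.of_forall fun y => ?_)
  simp only
  rw [h1, Complex.exp_ofReal_mul_I_re]

theorem integral_inner_mul_sin_gm (e η : E n) :
    ∫ y, inner ℝ e y * Real.sin (2 * Real.pi * inner ℝ η y) ∂gm n
      = inner ℝ e η * Real.exp (-Real.pi * ‖η‖ ^ 2) := by
  have hd := (hasDerivAt_integral_of_dominated_loc_of_deriv_le (μ := gm n) (𝕜 := ℝ)
    (F := fun (t : ℝ) y => Real.cos (2 * Real.pi * inner ℝ (η + t • e) y))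
    (F' := fun (t : ℝ) y => -Real.sin (2 * Real.pi * inner ℝ (η + t • e) y)
      * (2 * Real.pi * inner ℝ e y)) (x₀ := 0) (s := univ)
    (bound := fun y => 2 * Real.pi * ‖e‖ * (1 + ‖y‖) ^ 1) univ_mem
    (Eventually.of_forall fun t => by fun_prop)
    (integrable_of_le_moment (C := 1) (k := 0) (by fun_prop)
      fun y => by simpa using Real.abs_cos_le_one _) (by fun_prop)
    (Eventually.of_forall fun y t _ => ?_) ((integrable_moment 1).const_mul _)
    (Eventually.of_forall fun y t _ => ?_)).2
  · simp only [integral_cos_gm] at hd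
    have hd2 : HasDerivAt (fun t : ℝ => Real.exp (-Real.pi * ‖η + t • e‖ ^ 2))
        (Real.exp (-Real.pi * ‖η‖ ^ 2) * (-Real.pi * (2 * inner ℝ η e))) 0 := by
      have h1 : HasDerivAt (fun t : ℝ => η + t • e) e 0 := by
        simpa using ((hasDerivAt_id (0:ℝ)).smul_const e).const_add η
      have h2 := ((h1.norm_sq).const_mul (-Real.pi)).exp
      simpa using h2
    have h3 := hd.unique hd2
    simp only [zero_smul, add_zero] at h3
    have h4 : ∀ y : E n, -Real.sin (2 * Real.pi * inner ℝ η y) * (2 * Real.pi * inner ℝ e y)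
        = (-(2 * Real.pi)) * (inner ℝ e y * Real.sin (2 * Real.pi * inner ℝ η y)) := fun y => by ring
    simp only [h4, integral_const_mul] at h3
    have hpi := Real.pi_pos
    rw [real_inner_comm η e]
    have h5 : (2 * Real.pi) * (∫ y, inner ℝ e y * Real.sin (2 * Real.pi * inner ℝ η y) ∂gm n
      - inner ℝ η e * Real.exp (-Real.pi * ‖η‖ ^ 2)) = 0 := by linarith
    rcases mul_eq_zero.1 h5 with h | h
    · linarith
    · linarith
  · rw [norm_mul, norm_neg, Real.norm_eq_abs, Real.norm_eq_abs, abs_mul,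
      abs_of_pos (by positivity : 0 < 2 * Real.pi)]
    have h1 := abs_real_inner_le_norm e y
    have h2 := Real.abs_sin_le_one (2 * Real.pi * inner ℝ (η + t • e) y)
    have hpi := Real.pi_pos
    calc _ ≤ 1 * (2 * Real.pi * (‖e‖ * ‖y‖)) := by gcongr
      _ ≤ _ := by
        have : 0 ≤ 2 * Real.pi * ‖e‖ := by positivity
        rw [one_mul, pow_one]; nlinarith
  · have h1 : HasDerivAt (fun t : ℝ => 2 * Real.pi * inner ℝ (η + t • e) y)
        (2 * Real.pi * inner ℝ e y) t := by
      simp only [inner_add_left, inner_smul_left, conj_trivial]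
      simpa using (((hasDerivAt_id t).mul_const (inner ℝ e y)).const_add
        (inner ℝ η y)).const_mul (2 * Real.pi)
    exact h1.cos

theorem integral_inner_mul_inner_mul_cos_gm (e ν η : E n) :
    ∫ y, inner ℝ e y * inner ℝ ν y * Real.cos (2 * Real.pi * inner ℝ η y) ∂gm n
      = (2 * Real.pi)⁻¹ * (inner ℝ e ν - 2 * Real.pi * inner ℝ e η * inner ℝ ν η)
        * Real.exp (-Real.pi * ‖η‖ ^ 2) := by
  have hpi := Real.pi_pos
  have hd := (hasDerivAt_integral_of_dominated_loc_of_deriv_le (μ := gm n) (𝕜 := ℝ)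
    (F := fun (t : ℝ) y => inner ℝ e y * Real.sin (2 * Real.pi * inner ℝ (η + t • ν) y))
    (F' := fun (t : ℝ) y => inner ℝ e y * (Real.cos (2 * Real.pi * inner ℝ (η + t • ν) y)
      * (2 * Real.pi * inner ℝ ν y))) (x₀ := 0) (s := univ)
    (bound := fun y => 2 * Real.pi * (‖e‖ * ‖ν‖) * (1 + ‖y‖) ^ 2) univ_mem
    (Eventually.of_forall fun t => by fun_prop)
    (integrable_of_le_moment (C := ‖e‖) (k := 1) (by fun_prop)
      fun y => ?_) (by fun_prop)
    (Eventually.of_forall fun y t _ => ?_) ((integrable_moment 2).const_mul _)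
    (Eventually.of_forall fun y t _ => ?_)).2
  · simp only [integral_inner_mul_sin_gm] at hd
    have hd2 : HasDerivAt (fun t : ℝ => inner ℝ e (η + t • ν) *
          Real.exp (-Real.pi * ‖η + t • ν‖ ^ 2))
        (inner ℝ e ν * Real.exp (-Real.pi * ‖η‖ ^ 2) + inner ℝ e η *
          (Real.exp (-Real.pi * ‖η‖ ^ 2) * (-Real.pi * (2 * inner ℝ η ν)))) 0 := by
      have h1 : HasDerivAt (fun t : ℝ => η + t • ν) ν 0 := by
        simpa using ((hasDerivAt_id (0:ℝ)).smul_const ν).const_add η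
      have h2 := ((h1.norm_sq).const_mul (-Real.pi)).exp
      have h3 := ((hasDerivAt_const (0:ℝ) e).inner ℝ h1).mul h2
      simp only [zero_smul, add_zero, inner_zero_left] at h3
      exact h3
    have h3 := hd.unique hd2
    simp only [zero_smul, add_zero] at h3
    have h4 : ∀ y : E n, inner ℝ e y * (Real.cos (2 * Real.pi * inner ℝ η y)
        * (2 * Real.pi * inner ℝ ν y))
        = (2 * Real.pi) * (inner ℝ e y * inner ℝ ν y *
          Real.cos (2 * Real.pi * inner ℝ η y)) := fun y => by ring
    simp only [h4, integral_const_mul] at h3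
    rw [real_inner_comm η ν, mul_assoc, ← div_eq_inv_mul, eq_div_iff (by positivity), mul_comm, h3]
    ring
  · rw [norm_mul, Real.norm_eq_abs, Real.norm_eq_abs]
    have h1 := abs_real_inner_le_norm e y
    have h2 := Real.abs_sin_le_one (2 * Real.pi * inner ℝ (η + (0:ℝ) • ν) y)
    calc _ ≤ (‖e‖ * ‖y‖) * 1 := by gcongr
      _ ≤ _ := by rw [pow_one]; nlinarith [norm_nonneg e]
  · rw [norm_mul, norm_mul, Real.norm_eq_abs, Real.norm_eq_abs, Real.norm_eq_abs, abs_mul (2 * Real.pi),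
      abs_of_pos (by positivity : 0 < 2 * Real.pi)]
    have h1 := abs_real_inner_le_norm e y
    have h1' := abs_real_inner_le_norm ν y
    have h2 := Real.abs_cos_le_one (2 * Real.pi * inner ℝ (η + t • ν) y)
    calc _ ≤ (‖e‖ * ‖y‖) * (1 * (2 * Real.pi * (‖ν‖ * ‖y‖))) := by gcongr
      _ = 2 * Real.pi * (‖e‖ * ‖ν‖) * ‖y‖ ^ 2 := by ring
      _ ≤ _ := by gcongr; linarith
  · have h1 : HasDerivAt (fun t : ℝ => 2 * Real.pi * inner ℝ (η + t • ν) y)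
        (2 * Real.pi * inner ℝ ν y) t := by
      simp only [inner_add_left, inner_smul_left, conj_trivial]
      simpa using (((hasDerivAt_id t).mul_const (inner ℝ ν y)).const_add
        (inner ℝ η y)).const_mul (2 * Real.pi)
    exact h1.sin.const_mul _

/-- The weight `σ^(-1-θ) min(1, σ^k)` is integrable on the half line for `0 < θ < k`. -/
theorem integrableOn_weight {θ : ℝ} {k : ℕ} (h0 : 0 < θ) (hk : θ < k) :
    IntegrableOn (fun σ : ℝ => σ ^ (-1 - θ) * min 1 (σ ^ k)) (Ioi 0) := by
  rw [← Ioc_union_Ioi_eq_Ioi zero_le_one]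
  refine IntegrableOn.union ?_ ?_
  · have h : IntegrableOn (fun σ : ℝ => σ ^ (k - 1 - θ)) (Ioc 0 1) :=
      (intervalIntegrable_iff_integrableOn_Ioc_of_le zero_le_one).1
        (intervalIntegral.intervalIntegrable_rpow' (by linarith))
    refine h.congr_fun (fun σ hσ => ?_) measurableSet_Ioc
    simp only
    rw [min_eq_right (pow_le_one₀ hσ.1.le hσ.2), ← Real.rpow_natCast σ k, ← Real.rpow_add hσ.1]
    congr 1; ring
  · refine (integrableOn_Ioi_rpow_of_lt (by linarith : -1 - θ < -1) one_pos).congr_fun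
      (fun σ hσ => ?_) measurableSet_Ioi
    simp only
    rw [min_eq_left (one_le_pow₀ (le_of_lt hσ)), mul_one]

/-- The difference of Gaussians `exp (-πa²σ²) - exp (-4πa²σ²)`. -/
def gdiff (a σ : ℝ) : ℝ := Real.exp (-Real.pi * (a * σ) ^ 2) - Real.exp (-Real.pi * (2 * (a * σ)) ^ 2)

/-- The constant `∫₀^∞ σ^(-1-θ) (exp (-πσ²) - exp (-4πσ²)) dσ`. -/
def subConst (θ : ℝ) : ℝ := ∫ σ in Ioi (0 : ℝ), σ ^ (-1 - θ) * gdiff 1 σ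

theorem gdiff_nonneg (a σ : ℝ) : 0 ≤ gdiff a σ := by
  unfold gdiff
  rw [sub_nonneg]; apply Real.exp_le_exp.2
  nlinarith [Real.pi_pos, sq_nonneg (a * σ), mul_nonneg Real.pi_pos.le (sq_nonneg (a * σ))]

theorem gdiff_le (a σ : ℝ) : gdiff a σ ≤ (1 + 4 * Real.pi * a ^ 2) * min 1 (σ ^ 2) := by
  unfold gdiff
  have hpi := Real.pi_pos
  have h1 : Real.exp (-Real.pi * (a * σ) ^ 2) ≤ 1 :=
    Real.exp_le_one_iff.2 (by nlinarith [mul_nonneg hpi.le (sq_nonneg (a * σ))])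
  have h2 := Real.add_one_le_exp (-Real.pi * (2 * (a * σ)) ^ 2)
  have h3 := (Real.exp_pos (-Real.pi * (2 * (a * σ)) ^ 2)).le
  have h4 : 0 ≤ Real.pi * a ^ 2 := by positivity
  rcases le_total 1 (σ ^ 2) with h | h
  · rw [min_eq_left h]; nlinarith
  · rw [min_eq_right h]; nlinarith [sq_nonneg σ, mul_nonneg h4 (sq_nonneg σ)]

theorem integrableOn_gdiff {θ : ℝ} (h0 : 0 < θ) (h2 : θ < 2) (a : ℝ) :
    IntegrableOn (fun σ : ℝ => σ ^ (-1 - θ) * gdiff a σ) (Ioi 0) := by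
  refine ((integrableOn_weight (k := 2) h0 (by exact_mod_cast h2)).const_mul
    (1 + 4 * Real.pi * a ^ 2)).mono' (by unfold gdiff; fun_prop) ?_
  filter_upwards [ae_restrict_mem measurableSet_Ioi] with σ hσ
  have : 0 ≤ σ ^ (-1 - θ) := Real.rpow_nonneg (le_of_lt hσ) _
  rw [Real.norm_of_nonneg (mul_nonneg this (gdiff_nonneg _ _)), mul_left_comm]
  exact mul_le_mul_of_nonneg_left (gdiff_le a σ) this

theorem subConst_pos {θ : ℝ} (h0 : 0 < θ) (h2 : θ < 2) : 0 < subConst θ := by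
  unfold subConst
  rw [setIntegral_pos_iff_support_of_nonneg_ae]
  · have : Function.support (fun σ : ℝ => σ ^ (-1 - θ) * gdiff 1 σ) ∩ Ioi 0 = Ioi 0 := by
      refine inter_eq_right.2 fun σ hσ => ?_
      have hσ' : 0 < σ := hσ
      refine (mul_pos (Real.rpow_pos_of_pos hσ' _) ?_).ne'
      unfold gdiff
      rw [sub_pos]; apply Real.exp_lt_exp.2
      have : 0 < Real.pi * σ ^ 2 := by positivity
      nlinarith
    rw [this]; simp
  · filter_upwards [ae_restrict_mem measurableSet_Ioi] with σ hσ
    exact mul_nonneg (Real.rpow_nonneg (le_of_lt hσ) _) (gdiff_nonneg _ _)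
  · exact integrableOn_gdiff h0 h2 1

theorem integral_gdiff {θ : ℝ} (h0 : 0 < θ) {a : ℝ} (ha : 0 ≤ a) :
    ∫ σ in Ioi (0 : ℝ), σ ^ (-1 - θ) * gdiff a σ = a ^ θ * subConst θ := by
  rcases ha.eq_or_lt with rfl | ha
  · simp [gdiff, Real.zero_rpow h0.ne']
  · have h := integral_comp_mul_left_Ioi (fun σ : ℝ => σ ^ (-1 - θ) * gdiff 1 σ) 0 ha
    rw [mul_zero, smul_eq_mul] at h
    have h2 : ∫ σ in Ioi (0 : ℝ), (a * σ) ^ (-1 - θ) * gdiff 1 (a * σ)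
        = a ^ (-1 - θ) * ∫ σ in Ioi (0 : ℝ), σ ^ (-1 - θ) * gdiff a σ := by
      rw [← integral_const_mul]
      refine setIntegral_congr_fun measurableSet_Ioi fun σ hσ => ?_
      simp only [gdiff, one_mul]
      rw [Real.mul_rpow ha.le (le_of_lt hσ), mul_assoc]
    rw [h2] at h
    have h3 : a ^ θ * a * a ^ (-1 - θ) = 1 := by
      rw [← Real.rpow_add_one ha.ne', ← Real.rpow_add ha, ← Real.rpow_zero a]; congr 1; ring
    have h4 : a ^ θ * subConst θ = a ^ θ * a * (a⁻¹ * subConst θ) := by field_simp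
    rw [h4]; unfold subConst; rw [← h, ← mul_assoc, h3, one_mul]

/-- Integration by parts of the moments of the difference of Gaussians. -/
theorem integral_moment_gdiff {θ : ℝ} (h0 : 0 < θ) (h2 : θ < 2) {a : ℝ} (ha : 0 < a) :
    IntegrableOn (fun σ : ℝ => σ ^ (1 - θ) * (4 * Real.exp (-Real.pi * (2 * (a * σ)) ^ 2)
      - Real.exp (-Real.pi * (a * σ) ^ 2))) (Ioi 0) ∧
    2 * Real.pi * ∫ σ in Ioi (0 : ℝ), σ ^ (1 - θ) * (4 * Real.exp (-Real.pi * (2 * (a * σ)) ^ 2)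
      - Real.exp (-Real.pi * (a * σ) ^ 2)) = θ * (a ^ (θ - 2) * subConst θ) := by
  have hpi := Real.pi_pos
  have hint : IntegrableOn (fun σ : ℝ => σ ^ (1 - θ) * (4 * Real.exp (-Real.pi * (2 * (a * σ)) ^ 2)
      - Real.exp (-Real.pi * (a * σ) ^ 2))) (Ioi 0) := by
    have e1 := (integrableOn_rpow_mul_exp_neg_mul_sq (b := Real.pi * (2 * a) ^ 2) (by positivity)
      (s := 1 - θ) (by linarith)).const_mul 4
    have e2 := integrableOn_rpow_mul_exp_neg_mul_sq (b := Real.pi * a ^ 2) (by positivity)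
      (s := 1 - θ) (by linarith)
    refine (e1.sub e2).congr (Eventually.of_forall fun σ => ?_)
    simp only [Pi.sub_apply]
    ring_nf
  refine ⟨hint, ?_⟩
  have hint2 := integrableOn_gdiff h0 h2 a
  have hF := integral_Ioi_of_hasDerivAt_of_tendsto (a := 0) (m := 0)
    (f := fun σ : ℝ => σ ^ (-θ) * gdiff a σ)
    (f' := fun σ : ℝ => -θ * (σ ^ (-1 - θ) * gdiff a σ) + 2 * Real.pi * a ^ 2 *
      (σ ^ (1 - θ) * (4 * Real.exp (-Real.pi * (2 * (a * σ)) ^ 2)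
      - Real.exp (-Real.pi * (a * σ) ^ 2)))) ?_ ?_ ?_ ?_
  · rw [integral_add (hint2.const_mul _) (hint.const_mul _), integral_const_mul, integral_const_mul,
      integral_gdiff h0 ha.le] at hF
    have : (0 : ℝ) ^ (-θ) * gdiff a 0 = 0 := by simp [gdiff]
    rw [this] at hF
    have h3 : a ^ θ = a ^ (θ - 2) * a ^ 2 := by
      rw [← Real.rpow_natCast a 2, ← Real.rpow_add ha]; norm_num
    rw [h3] at hF
    have h4 : a ^ 2 ≠ 0 := by positivity
    apply mul_left_cancel₀ h4
    linarith
  · have hle : ∀ σ : ℝ, 0 ≤ σ → σ ^ (-θ) * gdiff a σ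
        ≤ (1 + 4 * Real.pi * a ^ 2) * σ ^ (2 - θ) := fun σ hσ => by
      rcases hσ.eq_or_lt with rfl | hσ
      · simp [gdiff, Real.zero_rpow (by linarith : 2 - θ ≠ 0)]
      · have h1 : σ ^ (2 - θ) = σ ^ (-θ) * σ ^ 2 := by
          rw [← Real.rpow_natCast σ 2, ← Real.rpow_add hσ]; congr 1; push_cast; ring
        rw [h1, mul_left_comm]
        refine mul_le_mul_of_nonneg_left ((gdiff_le a σ).trans ?_) (Real.rpow_nonneg hσ.le _)
        gcongr; exact min_le_right _ _
    have h00 : (0 : ℝ) ^ (-θ) * gdiff a 0 = 0 := by simp [gdiff]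
    rw [ContinuousWithinAt, h00]
    refine tendsto_of_tendsto_of_tendsto_of_le_of_le' tendsto_const_nhds
      (?_ : Tendsto (fun σ : ℝ => (1 + 4 * Real.pi * a ^ 2) * σ ^ (2 - θ)) _ _) ?_ ?_
    · have := (((Real.continuous_rpow_const (by linarith : 0 ≤ 2 - θ)).tendsto 0).const_mul
        (1 + 4 * Real.pi * a ^ 2)).mono_left (nhdsWithin_le_nhds (s := Ici 0))
      simpa [Real.zero_rpow (by linarith : 2 - θ ≠ 0)] using this
    · filter_upwards [self_mem_nhdsWithin] with σ hσ
      exact mul_nonneg (Real.rpow_nonneg hσ _) (gdiff_nonneg _ _)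
    · filter_upwards [self_mem_nhdsWithin] with σ hσ using hle σ hσ
  · intro σ hσ
    have hσ' : 0 < σ := hσ
    have e1 := Real.hasDerivAt_rpow_const (x := σ) (p := -θ) (Or.inl hσ'.ne')
    have l1 : HasDerivAt (fun σ : ℝ => a * σ) a σ := by
      simpa using (hasDerivAt_id σ).const_mul a
    have e2 := (((l1.pow 2).const_mul (-Real.pi)).exp).sub
      ((((l1.const_mul 2).pow 2).const_mul (-Real.pi)).exp)
    refine (e1.mul e2).congr_deriv ?_
    have p1 : σ ^ (-θ - 1) = σ ^ (-1 - θ) := by congr 1; ring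
    have p2 : σ ^ (1 - θ) = σ ^ (-θ) * σ := by
      rw [← Real.rpow_add_one hσ'.ne']; congr 1; ring
    simp only [Pi.sub_apply, Pi.pow_apply, p1, p2, gdiff]
    push_cast
    ring
  · exact (hint2.const_mul _).add (hint.const_mul _)
  · refine tendsto_of_tendsto_of_tendsto_of_le_of_le' tendsto_const_nhds
      (?_ : Tendsto (fun σ : ℝ => (1 + 4 * Real.pi * a ^ 2) * σ ^ (-θ)) _ _) ?_ ?_
    · simpa using (tendsto_rpow_neg_atTop h0).const_mul (1 + 4 * Real.pi * a ^ 2)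
    · filter_upwards [eventually_ge_atTop 0] with σ hσ
      exact mul_nonneg (Real.rpow_nonneg hσ _) (gdiff_nonneg _ _)
    · filter_upwards [eventually_ge_atTop 0] with σ hσ
      rw [mul_comm]
      refine mul_le_mul_of_nonneg_right ((gdiff_le a σ).trans ?_) (Real.rpow_nonneg hσ _)
      have : 0 ≤ 1 + 4 * Real.pi * a ^ 2 := by positivity
      nlinarith [min_le_left 1 (σ ^ 2)]

/-! ### Fractional powers of frequencies as superpositions of translations -/

/-- The parameter measure `dσ × exp (-π|y|²) dy` on `(0,∞) × ℝⁿ`; a parameter `(σ, y)` stands for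
the translation by `σ y`. -/
def pm (n : ℕ) : Measure (ℝ × E n) := (volume.restrict (Ioi 0)).prod (gm n)

instance : SFinite (pm n) := by unfold pm; infer_instance

/-- The angle `2π ξ·z`. -/
def ang (ξ z : E n) : ℝ := 2 * Real.pi * inner ℝ ξ z

@[fun_prop]
theorem Measurable.ang {X : Type*} [MeasurableSpace X] {f g : X → E n} (hf : Measurable f)
    (hg : Measurable g) : Measurable fun x => ang (f x) (g x) := by
  unfold FZK.ang; fun_prop

theorem chr_eq_exp_ang (z ξ : E n) : chr z ξ = Complex.exp ((ang ξ z : ℝ) * Complex.I) := by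
  unfold chr ang; congr 1; push_cast; ring

@[fun_prop]
theorem Measurable.chr {X : Type*} [MeasurableSpace X] {f g : X → E n} (hf : Measurable f)
    (hg : Measurable g) : Measurable fun x => chr (f x) (g x) := by
  simp_rw [chr_eq_exp_ang]; fun_prop

theorem ang_smul (ξ : E n) (σ : ℝ) (y : E n) :
    ang ξ (σ • y) = 2 * Real.pi * inner ℝ (σ • ξ) y := by
  rw [ang, inner_smul_left, inner_smul_right]; rfl

theorem two_mul_ang_smul (ξ : E n) (σ : ℝ) (y : E n) :
    2 * ang ξ (σ • y) = 2 * Real.pi * inner ℝ ((2 * σ) • ξ) y := by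
  rw [ang, inner_smul_left, inner_smul_right]; simp only [conj_trivial]; ring

theorem abs_ang_le (ξ : E n) {σ : ℝ} (hσ : 0 < σ) (y : E n) :
    |ang ξ (σ • y)| ≤ σ * (2 * Real.pi * (1 + ‖ξ‖) * (1 + ‖y‖)) := by
  have h1 := abs_real_inner_le_norm ξ y
  have hpi := Real.pi_pos
  rw [ang, inner_smul_right, abs_mul (2 * Real.pi), abs_mul σ, abs_of_pos hσ,
    abs_of_pos (by positivity : 0 < 2 * Real.pi)]
  have : ‖ξ‖ * ‖y‖ ≤ (1 + ‖ξ‖) * (1 + ‖y‖) := by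
    gcongr <;> linarith
  calc 2 * Real.pi * (σ * |inner ℝ ξ y|) ≤ 2 * Real.pi * (σ * ((1 + ‖ξ‖) * (1 + ‖y‖))) := by
        gcongr; linarith
    _ = _ := by ring

theorem one_le_angBound (ξ y : E n) : 1 ≤ 2 * Real.pi * (1 + ‖ξ‖) * (1 + ‖y‖) := by
  have h1 : 1 ≤ 2 * Real.pi := by linarith [Real.pi_gt_three]
  have h2 : 1 ≤ 1 + ‖ξ‖ := by linarith [norm_nonneg ξ]
  have h3 : 1 ≤ 1 + ‖y‖ := by linarith [norm_nonneg y]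
  exact one_le_mul_of_one_le_of_one_le (one_le_mul_of_one_le_of_one_le h1 h2) h3

theorem one_sub_cos_nonneg (x : ℝ) : 0 ≤ 1 - Real.cos x := by linarith [Real.cos_le_one x]

theorem one_sub_cos_le_min {x σ X : ℝ} (hX : 1 ≤ X) (h : |x| ≤ σ * X) :
    1 - Real.cos x ≤ 2 * X ^ 2 * min 1 (σ ^ 2) := by
  have hX2 : 1 ≤ X ^ 2 := one_le_pow₀ hX
  rcases le_total 1 (σ ^ 2) with h1 | h1
  · rw [min_eq_left h1]; linarith [Real.neg_one_le_cos x]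
  · rw [min_eq_right h1]
    have h2 := Real.one_sub_sq_div_two_le_cos (x := x)
    have h3 : x ^ 2 ≤ (σ * X) ^ 2 := sq_le_sq' (by linarith [neg_abs_le x]) (by linarith [le_abs_self x])
    nlinarith [mul_nonneg (sq_nonneg σ) (sq_nonneg X)]

theorem abs_cos_sub_cos_two_mul_le (x : ℝ) :
    |Real.cos x - Real.cos (2 * x)| ≤ 3 * (1 - Real.cos x) := by
  have h1 : Real.cos x - Real.cos (2 * x) = (1 - Real.cos x) * (1 + 2 * Real.cos x) := by
    rw [Real.cos_two_mul]; ring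
  rw [h1, abs_mul, abs_of_nonneg (one_sub_cos_nonneg x), mul_comm]
  refine mul_le_mul_of_nonneg_right (abs_le.2 ⟨?_, ?_⟩) (one_sub_cos_nonneg x)
  · linarith [Real.neg_one_le_cos x]
  · linarith [Real.cos_le_one x]

theorem abs_sin_sub_le {x σ X : ℝ} (hσ : 0 < σ) (hX : 1 ≤ X) (h : |x| ≤ σ * X) :
    |Real.sin x - Real.sin (2 * x) / 2| ≤ 2 * X ^ 3 * (σ * min 1 (σ ^ 2)) := by
  have h1 : Real.sin x - Real.sin (2 * x) / 2 = Real.sin x * (1 - Real.cos x) := by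
    rw [Real.sin_two_mul]; ring
  have h2 := one_sub_cos_le_min hX h
  have h3 : |Real.sin x| ≤ σ * X := (Real.abs_sin_le_abs (x := x)).trans h
  rw [h1, abs_mul, abs_of_nonneg (one_sub_cos_nonneg x)]
  calc _ ≤ (σ * X) * (2 * X ^ 2 * min 1 (σ ^ 2)) :=
        mul_le_mul h3 h2 (one_sub_cos_nonneg x) (by positivity)
    _ = _ := by ring

theorem norm_chr_sub_chr_le (z ξ : E n) :
    ‖chr z ξ - chr ((2 : ℝ) • z) ξ‖ ≤ min 2 |ang ξ z| := by
  refine le_min ((norm_sub_le _ _).trans (by rw [norm_chr, norm_chr]; norm_num)) ?_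
  have h : chr ((2 : ℝ) • z) ξ = chr z ξ * chr z ξ := by
    rw [chr_eq_exp_ang, chr_eq_exp_ang, ← Complex.exp_add]; congr 1
    unfold ang; rw [inner_smul_right]; push_cast; ring
  rw [h, show chr z ξ - chr z ξ * chr z ξ = - (chr z ξ * (chr z ξ - 1)) by ring, norm_neg,
    norm_mul, norm_chr, one_mul, chr_eq_exp_ang, mul_comm]
  exact Real.norm_exp_I_mul_ofReal_sub_one_le

theorem norm_chr_sub_chr_le_min {σ : ℝ} (hσ : 0 < σ) (ξ y : E n) :
    ‖chr (σ • y) ξ - chr ((2 : ℝ) • σ • y) ξ‖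
      ≤ 2 * (2 * Real.pi * (1 + ‖ξ‖) * (1 + ‖y‖)) * min 1 σ := by
  have h1 := norm_chr_sub_chr_le (σ • y) ξ
  have h2 := abs_ang_le ξ hσ y
  have h3 := one_le_angBound ξ y
  rcases le_total 1 σ with h | h
  · rw [min_eq_left h]; linarith [min_le_left 2 |ang ξ (σ • y)|]
  · rw [min_eq_right h]; nlinarith [min_le_right 2 |ang ξ (σ • y)|]

/-- A function on parameter space with the standard pointwise bound is integrable. -/
theorem integrable_pm_of_le {F : Type*} [NormedAddCommGroup F] {f : ℝ × E n → F} {θ : ℝ} {k : ℕ}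
    (h0 : 0 < θ) (hk : θ < k) (hf : AEStronglyMeasurable f (pm n)) {C : ℝ} {l : ℕ}
    (h : ∀ σ : ℝ, 0 < σ → ∀ y, ‖f (σ, y)‖
      ≤ C * (σ ^ (-1 - θ) * min 1 (σ ^ k) * (1 + ‖y‖) ^ l)) : Integrable f (pm n) := by
  have h1 : Integrable (fun p : ℝ × E n =>
      (p.1 ^ (-1 - θ) * min 1 (p.1 ^ k)) * (1 + ‖p.2‖) ^ l) (pm n) :=
    (integrableOn_weight h0 hk).mul_prod (integrable_moment l)
  refine (h1.const_mul C).mono' hf ?_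
  have h2 : ∀ᵐ p ∂(pm n), 0 < p.1 := by
    have : ∀ᵐ σ ∂(volume.restrict (Ioi (0 : ℝ))), 0 < σ := ae_restrict_mem measurableSet_Ioi
    exact Measure.quasiMeasurePreserving_fst.ae this
  filter_upwards [h2] with p hp using h p.1 hp p.2

theorem ae_pm_pos : ∀ᵐ p ∂(pm n), 0 < p.1 := by
  have : ∀ᵐ σ ∂(volume.restrict (Ioi (0 : ℝ))), 0 < σ := ae_restrict_mem measurableSet_Ioi
  exact Measure.quasiMeasurePreserving_fst.ae this

/-- The density of the representation of `ξ₁|ξ|^α` by sines. -/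
def sinKer (α : ℝ) (e ξ : E n) (p : ℝ × E n) : ℝ :=
  p.1 ^ (-1 - α) * p.1⁻¹ * inner ℝ e p.2
    * (Real.sin (ang ξ (p.1 • p.2)) - Real.sin (2 * ang ξ (p.1 • p.2)) / 2)

theorem sinKer_le (α : ℝ) (e ξ : E n) {σ : ℝ} (hσ : 0 < σ) (y : E n) :
    |sinKer α e ξ (σ, y)| ≤ (2 * ‖e‖ * (2 * Real.pi * (1 + ‖ξ‖)) ^ 3)
      * (σ ^ (-1 - α) * min 1 (σ ^ 2) * (1 + ‖y‖) ^ 4) := by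
  have h1 := abs_real_inner_le_norm e y
  have h2 := abs_sin_sub_le hσ (one_le_angBound ξ y) (abs_ang_le ξ hσ y)
  have hr := Real.rpow_pos_of_pos hσ (-1 - α)
  have h3 : |inner ℝ e y| ≤ ‖e‖ * (1 + ‖y‖) := h1.trans (by gcongr; linarith)
  simp only [sinKer]
  rw [abs_mul, abs_mul, abs_mul, abs_of_pos hr, abs_of_pos (inv_pos.2 hσ)]
  calc _ ≤ σ ^ (-1 - α) * σ⁻¹ * (‖e‖ * (1 + ‖y‖)) *
        (2 * (2 * Real.pi * (1 + ‖ξ‖) * (1 + ‖y‖)) ^ 3 * (σ * min 1 (σ ^ 2))) := by gcongr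
    _ = (σ⁻¹ * σ) * ((2 * ‖e‖ * (2 * Real.pi * (1 + ‖ξ‖)) ^ 3)
      * (σ ^ (-1 - α) * min 1 (σ ^ 2) * (1 + ‖y‖) ^ 4)) := by ring
    _ = _ := by rw [inv_mul_cancel₀ hσ.ne', one_mul]

theorem measurable_sinKer (α : ℝ) (e : E n) :
    Measurable fun q : (ℝ × E n) × E n => sinKer α e q.2 q.1 := by
  unfold sinKer; fun_prop

theorem integrable_sinKer {α : ℝ} (h0 : 0 < α) (h2 : α < 2) (e ξ : E n) :
    Integrable (sinKer α e ξ) (pm n) :=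
  integrable_pm_of_le (k := 2) h0 (by exact_mod_cast h2)
    ((measurable_sinKer α e).comp (by fun_prop : Measurable fun p : ℝ × E n => (p, ξ))).aestronglyMeasurable
    fun σ hσ y => sinKer_le α e ξ hσ y

theorem integrable_inner_mul_sin_gm (e η : E n) :
    Integrable (fun y => inner ℝ e y * Real.sin (2 * Real.pi * inner ℝ η y)) (gm n) :=
  integrable_of_le_moment (C := ‖e‖) (k := 1) (by fun_prop) fun y => by
    rw [norm_mul, Real.norm_eq_abs, Real.norm_eq_abs]
    have h1 := abs_real_inner_le_norm e y
    have h2 := Real.abs_sin_le_one (2 * Real.pi * inner ℝ η y)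
    calc _ ≤ (‖e‖ * ‖y‖) * 1 := by gcongr
      _ ≤ _ := by rw [pow_one]; nlinarith [norm_nonneg e]

/-- `ξ₁|ξ|^α` as a superposition of sines: the Gaussian integral in `y` produces the difference of
Gaussians `gdiff`, whose scaling in `σ` produces the power of `|ξ|`. -/
theorem integral_sinKer {α : ℝ} (h0 : 0 < α) (h2 : α < 2) (e ξ : E n) :
    ∫ p, sinKer α e ξ p ∂pm n = inner ℝ e ξ * ‖ξ‖ ^ α * subConst α := by
  rw [pm, integral_prod _ (integrable_sinKer h0 h2 e ξ), mul_assoc,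
    ← integral_gdiff h0 (norm_nonneg ξ), ← integral_const_mul]
  refine setIntegral_congr_fun measurableSet_Ioi fun σ hσ => ?_
  have hσ' : 0 < σ := hσ
  have h3 : ∀ y, sinKer α e ξ (σ, y) = σ ^ (-1 - α) * σ⁻¹ *
      (inner ℝ e y * Real.sin (2 * Real.pi * inner ℝ (σ • ξ) y)
        - inner ℝ e y * Real.sin (2 * Real.pi * inner ℝ ((2 * σ) • ξ) y) / 2) := fun y => by
    simp only [sinKer]; rw [two_mul_ang_smul, ang_smul]; ring
  simp only [h3]
  rw [integral_const_mul, integral_sub (integrable_inner_mul_sin_gm _ _)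
    ((integrable_inner_mul_sin_gm _ _).div_const 2), integral_div, integral_inner_mul_sin_gm,
    integral_inner_mul_sin_gm, inner_smul_right, inner_smul_right, norm_smul, norm_smul,
    Real.norm_of_nonneg hσ'.le, Real.norm_of_nonneg (by positivity : 0 ≤ 2 * σ)]
  unfold gdiff
  rw [mul_comm ‖ξ‖ σ, ← mul_assoc 2 σ ‖ξ‖]
  field_simp

/-- The density of the symbol of the quadratic form of the commutator. -/
def cosKer (α : ℝ) (e ν ξ : E n) (p : ℝ × E n) : ℝ :=
  p.1 ^ (-1 - α) * (inner ℝ e p.2 * inner ℝ ν p.2)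
    * (Real.cos (ang ξ (p.1 • p.2)) - Real.cos (2 * ang ξ (p.1 • p.2)))

theorem measurable_cosKer (α : ℝ) (e ν : E n) :
    Measurable fun q : (ℝ × E n) × E n => cosKer α e ν q.2 q.1 := by
  unfold cosKer; fun_prop

theorem cosKer_le_one_sub_cos (α : ℝ) (e ν ξ : E n) {σ : ℝ} (hσ : 0 < σ) (y : E n) :
    |cosKer α e ν ξ (σ, y)| ≤ (3 * ‖e‖ * ‖ν‖) *
      (σ ^ (-1 - α) * (1 + ‖y‖) ^ 2 * (1 - Real.cos (ang ξ (σ • y)))) := by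
  have h1 : |inner ℝ e y| ≤ ‖e‖ * (1 + ‖y‖) :=
    (abs_real_inner_le_norm e y).trans (by gcongr; linarith)
  have h2 : |inner ℝ ν y| ≤ ‖ν‖ * (1 + ‖y‖) :=
    (abs_real_inner_le_norm ν y).trans (by gcongr; linarith)
  have hr := Real.rpow_pos_of_pos hσ (-1 - α)
  simp only [cosKer]
  rw [abs_mul, abs_mul, abs_mul, abs_of_pos hr]
  calc _ ≤ σ ^ (-1 - α) * ((‖e‖ * (1 + ‖y‖)) * (‖ν‖ * (1 + ‖y‖)))
        * (3 * (1 - Real.cos (ang ξ (σ • y)))) := by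
        gcongr; exact abs_cos_sub_cos_two_mul_le _
    _ = _ := by ring

theorem integrable_cosKer {α : ℝ} (h0 : 0 < α) (h2 : α < 2) (e ν ξ : E n) :
    Integrable (cosKer α e ν ξ) (pm n) :=
  integrable_pm_of_le (k := 2) (l := 4)
    (C := 3 * ‖e‖ * ‖ν‖ * (2 * (2 * Real.pi * (1 + ‖ξ‖)) ^ 2)) h0 (by exact_mod_cast h2)
    ((measurable_cosKer α e ν).comp (by fun_prop : Measurable fun p : ℝ × E n => (p, ξ))).aestronglyMeasurable
    fun σ hσ y => by
      refine (cosKer_le_one_sub_cos α e ν ξ hσ y).trans ?_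
      have h3 := one_sub_cos_le_min (one_le_angBound ξ y) (abs_ang_le ξ hσ y)
      have hr := Real.rpow_pos_of_pos hσ (-1 - α)
      calc _ ≤ (3 * ‖e‖ * ‖ν‖) * (σ ^ (-1 - α) * (1 + ‖y‖) ^ 2 *
            (2 * (2 * Real.pi * (1 + ‖ξ‖) * (1 + ‖y‖)) ^ 2 * min 1 (σ ^ 2))) := by gcongr
        _ = _ := by ring

theorem integrable_inner_mul_inner_mul_cos_gm (e ν η : E n) :
    Integrable (fun y => inner ℝ e y * inner ℝ ν y * Real.cos (2 * Real.pi * inner ℝ η y)) (gm n) :=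
  integrable_of_le_moment (C := ‖e‖ * ‖ν‖) (k := 2) (by fun_prop) fun y => by
    have h1 : |inner ℝ e y| ≤ ‖e‖ * (1 + ‖y‖) :=
      (abs_real_inner_le_norm e y).trans (by gcongr; linarith)
    have h2 : |inner ℝ ν y| ≤ ‖ν‖ * (1 + ‖y‖) :=
      (abs_real_inner_le_norm ν y).trans (by gcongr; linarith)
    rw [norm_mul, norm_mul, Real.norm_eq_abs, Real.norm_eq_abs, Real.norm_eq_abs]
    calc _ ≤ (‖e‖ * (1 + ‖y‖)) * (‖ν‖ * (1 + ‖y‖)) * 1 := by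
          gcongr; exact Real.abs_cos_le_one _
      _ = _ := by ring

/-- The symbol of the quadratic form of the commutator, up to constants `ν·∇_ξ (ξ₁|ξ|^α)`. -/
theorem integral_cosKer {α : ℝ} (h0 : 0 < α) (h2 : α < 2) (e ν : E n) {ξ : E n} (hξ : ξ ≠ 0) :
    ∫ p, cosKer α e ν ξ p ∂pm n = (2 * Real.pi)⁻¹ * subConst α * ‖ξ‖ ^ (α - 2) *
      (inner ℝ e ν * ‖ξ‖ ^ 2 + α * (inner ℝ e ξ * inner ℝ ν ξ)) := by
  have hpi := Real.pi_pos
  have hξ' : 0 < ‖ξ‖ := norm_pos_iff.2 hξ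
  obtain ⟨hM, hM2⟩ := integral_moment_gdiff h0 h2 hξ'
  have hG := integrableOn_gdiff h0 h2 ‖ξ‖
  rw [pm, integral_prod _ (integrable_cosKer h0 h2 e ν ξ)]
  have key : ∀ σ ∈ Ioi (0:ℝ), ∫ y, cosKer α e ν ξ (σ, y) ∂gm n
      = (2 * Real.pi)⁻¹ * inner ℝ e ν * (σ ^ (-1 - α) * gdiff ‖ξ‖ σ)
        + inner ℝ e ξ * inner ℝ ν ξ * (σ ^ (1 - α) *
          (4 * Real.exp (-Real.pi * (2 * (‖ξ‖ * σ)) ^ 2)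
            - Real.exp (-Real.pi * (‖ξ‖ * σ) ^ 2))) := fun σ hσ => by
    have hσ' : 0 < σ := hσ
    have h3 : ∀ y, cosKer α e ν ξ (σ, y) = σ ^ (-1 - α) *
        (inner ℝ e y * inner ℝ ν y * Real.cos (2 * Real.pi * inner ℝ (σ • ξ) y)
          - inner ℝ e y * inner ℝ ν y * Real.cos (2 * Real.pi * inner ℝ ((2 * σ) • ξ) y)) :=
      fun y => by simp only [cosKer]; rw [two_mul_ang_smul, ang_smul]; ring
    simp only [h3]
    rw [integral_const_mul, integral_sub (integrable_inner_mul_inner_mul_cos_gm _ _ _)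
      (integrable_inner_mul_inner_mul_cos_gm _ _ _), integral_inner_mul_inner_mul_cos_gm,
      integral_inner_mul_inner_mul_cos_gm]
    simp only [inner_smul_right, norm_smul]
    rw [Real.norm_of_nonneg hσ'.le, Real.norm_of_nonneg (by positivity : 0 ≤ 2 * σ),
      show σ ^ (1 - α) = σ ^ (-1 - α) * σ ^ 2 by
        rw [← Real.rpow_natCast σ 2, ← Real.rpow_add hσ']; congr 1; push_cast; ring]
    unfold gdiff
    rw [mul_comm ‖ξ‖ σ, ← mul_assoc 2 σ ‖ξ‖]
    field_simp
    ring
  rw [setIntegral_congr_fun measurableSet_Ioi key, integral_add (hG.const_mul _) (hM.const_mul _),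
    integral_const_mul, integral_const_mul, integral_gdiff h0 hξ'.le]
  have h4 : ‖ξ‖ ^ α = ‖ξ‖ ^ (α - 2) * ‖ξ‖ ^ 2 := by
    rw [← Real.rpow_natCast ‖ξ‖ 2, ← Real.rpow_add hξ']; congr 1; push_cast; ring
  have h5 := hM2
  rw [mul_comm (2 * Real.pi), ← eq_div_iff (by positivity)] at h5
  rw [h5, h4]
  field_simp

/-- The density of the representation of `|ξ|^β` by characters. -/
def chrKer (β : ℝ) (ξ : E n) (p : ℝ × E n) : ℂ :=
  ((p.1 ^ (-1 - β) : ℝ) : ℂ) * (chr (p.1 • p.2) ξ - chr ((2 : ℝ) • p.1 • p.2) ξ)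

theorem measurable_chrKer (β : ℝ) :
    Measurable fun q : (ℝ × E n) × E n => chrKer β q.2 q.1 := by
  unfold chrKer; fun_prop

theorem norm_chrKer_le (β : ℝ) (ξ : E n) {σ : ℝ} (hσ : 0 < σ) (y : E n) :
    ‖chrKer β ξ (σ, y)‖ ≤ (2 * (2 * Real.pi * (1 + ‖ξ‖))) *
      (σ ^ (-1 - β) * min 1 (σ ^ 1) * (1 + ‖y‖) ^ 1) := by
  have hr := Real.rpow_pos_of_pos hσ (-1 - β)
  simp only [chrKer]
  rw [norm_mul, Complex.norm_real, Real.norm_of_nonneg hr.le, pow_one, pow_one]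
  calc _ ≤ σ ^ (-1 - β) * (2 * (2 * Real.pi * (1 + ‖ξ‖) * (1 + ‖y‖)) * min 1 σ) := by
        gcongr; exact norm_chr_sub_chr_le_min hσ ξ y
    _ = _ := by ring

theorem integrable_chrKer {β : ℝ} (h0 : 0 < β) (h1 : β < 1) (ξ : E n) :
    Integrable (chrKer β ξ) (pm n) :=
  integrable_pm_of_le (k := 1) h0 (by exact_mod_cast h1)
    ((measurable_chrKer β).comp (by fun_prop : Measurable fun p : ℝ × E n => (p, ξ))).aestronglyMeasurable
    fun σ hσ y => norm_chrKer_le β ξ hσ y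

/-- `|ξ|^β` as a superposition of characters. -/
theorem integral_chrKer {β : ℝ} (h0 : 0 < β) (h1 : β < 1) (ξ : E n) :
    ∫ p, chrKer β ξ p ∂pm n = ((‖ξ‖ ^ β * subConst β : ℝ) : ℂ) := by
  rw [pm, integral_prod _ (integrable_chrKer h0 h1 ξ), ← integral_gdiff h0 (norm_nonneg ξ),
    ← integral_complex_ofReal]
  refine setIntegral_congr_fun measurableSet_Ioi fun σ hσ => ?_
  have hσ' : 0 < σ := hσ
  have hi : ∀ z : E n, Integrable (fun y =>
      Complex.exp (2 * Real.pi * Complex.I * (inner ℝ z y : ℝ))) (gm n) := fun z =>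
    integrable_of_le_moment (C := 1) (k := 0) (by fun_prop) fun y => by
      rw [show (2 * Real.pi * Complex.I * (inner ℝ z y : ℝ) : ℂ)
        = ((2 * Real.pi * inner ℝ z y : ℝ) : ℂ) * Complex.I by push_cast; ring,
        Complex.norm_exp_ofReal_mul_I]; simp
  have h3 : ∀ y, chrKer β ξ (σ, y) = ((σ ^ (-1 - β) : ℝ) : ℂ) *
      (Complex.exp (2 * Real.pi * Complex.I * (inner ℝ (σ • ξ) y : ℝ))
        - Complex.exp (2 * Real.pi * Complex.I * (inner ℝ ((2 * σ) • ξ) y : ℝ))) := fun y => by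
    simp only [chrKer, chr, inner_smul_left, inner_smul_right, conj_trivial, mul_assoc]
  simp only [h3]
  rw [integral_const_mul, integral_sub (hi _) (hi _), integral_exp_gm, integral_exp_gm,
    norm_smul, norm_smul, Real.norm_of_nonneg hσ'.le,
    Real.norm_of_nonneg (by positivity : 0 ≤ 2 * σ)]
  unfold gdiff
  rw [mul_comm ‖ξ‖ σ, ← mul_assoc 2 σ ‖ξ‖]
  push_cast; ring

/-! ### Correlations and weights -/

theorem inner_tr_eq (f v : L2C n) (z : E n) :
    inner ℂ f (tr z v) = ∫ ξ, starRingEnd ℂ ((𝓕 f : L2C n) ξ) * (chr z ξ * (𝓕 v : L2C n) ξ) := by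
  rw [← inner_fourier, fourier_tr, inner_eq_integral]
  refine integral_congr_ae ?_
  filter_upwards [(bddMeas_chr z).coeFn (𝓕 v)] with ξ h
  rw [h]

theorem integrable_inner_tr (f v : L2C n) (z : E n) :
    Integrable fun ξ => starRingEnd ℂ ((𝓕 f : L2C n) ξ) * (chr z ξ * (𝓕 v : L2C n) ξ) := by
  refine (integrable_conj_mul (𝓕 f) (mulOp (chr z) (𝓕 v))).congr ?_
  filter_upwards [(bddMeas_chr z).coeFn (𝓕 v)] with ξ h
  rw [h]

theorem ang_neg (ξ z : E n) : ang ξ (-z) = -ang ξ z := by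
  unfold ang; rw [inner_neg_right]; ring

theorem ang_two_smul (ξ z : E n) : ang ξ ((2 : ℝ) • z) = 2 * ang ξ z := by
  unfold ang; rw [inner_smul_right]; ring

theorem I_mul_sin_ang (ξ z : E n) :
    Complex.I * (Real.sin (ang ξ z) : ℂ) = (chr z ξ - chr (-z) ξ) / 2 := by
  rw [chr_eq_exp_ang, chr_eq_exp_ang, ang_neg, Complex.ofReal_sin, Complex.sin]
  push_cast
  have := Complex.I_mul_I
  linear_combination ((Complex.exp (-(ang ξ z:ℂ) * Complex.I) - Complex.exp ((ang ξ z:ℂ) * Complex.I)) / 2) * this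

/-- The pairing through the multiplier `i sin (2π ξ·z)` is the skew part of the translation by
`z`. -/
theorem integral_sin_ang (f v : L2C n) (z : E n) :
    Integrable (fun ξ => starRingEnd ℂ ((𝓕 f : L2C n) ξ) *
      (Complex.I * (Real.sin (ang ξ z) : ℂ) * (𝓕 v : L2C n) ξ)) ∧
    ∫ ξ, starRingEnd ℂ ((𝓕 f : L2C n) ξ) *
      (Complex.I * (Real.sin (ang ξ z) : ℂ) * (𝓕 v : L2C n) ξ)
      = (inner ℂ f (tr z v) - inner ℂ f (tr (-z) v)) / 2 := by
  have h : ∀ ξ, starRingEnd ℂ ((𝓕 f : L2C n) ξ) *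
      (Complex.I * (Real.sin (ang ξ z) : ℂ) * (𝓕 v : L2C n) ξ)
      = (starRingEnd ℂ ((𝓕 f : L2C n) ξ) * (chr z ξ * (𝓕 v : L2C n) ξ)
        - starRingEnd ℂ ((𝓕 f : L2C n) ξ) * (chr (-z) ξ * (𝓕 v : L2C n) ξ)) / 2 := fun ξ => by
    rw [I_mul_sin_ang]; ring
  simp_rw [h]
  refine ⟨((integrable_inner_tr f v z).sub (integrable_inner_tr f v (-z))).div_const 2, ?_⟩
  rw [integral_div, integral_sub (integrable_inner_tr f v z) (integrable_inner_tr f v (-z)),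
    inner_tr_eq, inner_tr_eq]

/-- A bounded measurable real function, seen as a multiplier. -/
def BddReal (b : E n → ℝ) (C : ℝ) : Prop := Measurable b ∧ ∀ x, |b x| ≤ C

theorem BddReal.bddMeas {b : E n → ℝ} {C : ℝ} (hb : BddReal b C) :
    BddMeas (fun x => (b x : ℂ)) C :=
  ⟨Complex.measurable_ofReal.comp hb.1, fun x => by simpa using hb.2 x⟩

theorem BddReal.nonneg {b : E n → ℝ} {C : ℝ} (hb : BddReal b C) : 0 ≤ C := hb.bddMeas.nonneg

/-- Multiplication by a real function. -/
abbrev rmul (b : E n → ℝ) : L2C n → L2C n := mulOp fun x => (b x : ℂ)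

theorem integrable_tr_mul (f v : L2C n) (z : E n) :
    Integrable fun x => starRingEnd ℂ (f x) * (tr z v) x := integrable_conj_mul f (tr z v)

/-- The correlation `∫ b(x) Re (conj v(x) v(x+z)) dx`. -/
def corr (b : E n → ℝ) (v : L2C n) (z : E n) : ℝ :=
  ∫ x, b x * (starRingEnd ℂ (v x) * (tr z v) x).re

theorem integrable_corr {b : E n → ℝ} {C : ℝ} (hb : BddReal b C) (v : L2C n) (z : E n) :
    Integrable fun x => b x * (starRingEnd ℂ (v x) * (tr z v) x).re :=
  Integrable.bdd_mul (g := fun x => (starRingEnd ℂ (v x) * (tr z v) x).re)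
    (integrable_tr_mul v v z).re (c := C) hb.1.aestronglyMeasurable
    (Eventually.of_forall fun x => by simpa using hb.2 x)

theorem abs_corr_le {b : E n → ℝ} {C : ℝ} (hb : BddReal b C) (v : L2C n) (z : E n) :
    |corr b v z| ≤ C * ‖v‖ ^ 2 := by
  unfold corr
  rw [← Real.norm_eq_abs]
  calc ‖∫ x, b x * (starRingEnd ℂ (v x) * (tr z v) x).re‖
      ≤ ∫ x, C * (‖v x‖ * ‖(tr z v) x‖) := by
        refine norm_integral_le_of_norm_le ((integrable_norm_mul_norm v (tr z v)).const_mul C)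
          (Eventually.of_forall fun x => ?_)
        rw [norm_mul]
        refine mul_le_mul (hb.2 x) ?_ (norm_nonneg _) hb.nonneg
        refine (Complex.abs_re_le_norm _).trans (by simp)
    _ ≤ C * ‖v‖ ^ 2 := by
        rw [integral_const_mul, sq]
        refine mul_le_mul_of_nonneg_left ((integral_norm_mul_norm_le v (tr z v)).trans ?_) hb.nonneg
        rw [norm_tr]

theorem re_integral {f : E n → ℂ} (hf : Integrable f) : (∫ x, f x).re = ∫ x, (f x).re := by
  rw [← Complex.reCLM_apply, ← ContinuousLinearMap.integral_comp_comm _ hf]; rfl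

/-- The skew-symmetric part of translations against a real multiplier sees only the differences
of the multiplier. -/
theorem re_inner_rmul_tr_sub {b : E n → ℝ} {C : ℝ} (hb : BddReal b C) (v : L2C n) (z : E n) :
    (inner ℂ (rmul b v) (tr z v) - inner ℂ (rmul b v) (tr (-z) v)).re
      = - corr (fun x => b (x + z) - b x) v z := by
  have hbz : BddReal (fun x => b (x + z)) C := ⟨hb.1.comp (measurable_add_const z), fun x => hb.2 _⟩
  have e1 : (inner ℂ (rmul b v) (tr z v)).re = corr b v z := by
    rw [inner_eq_integral, re_integral (integrable_conj_mul _ _)]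
    refine integral_congr_ae ?_
    filter_upwards [hb.bddMeas.coeFn v] with x hx
    rw [hx, map_mul, Complex.conj_ofReal, mul_assoc, Complex.re_ofReal_mul]
  have e2 : (inner ℂ (rmul b v) (tr (-z) v)).re = corr (fun x => b (x + z)) v z := by
    rw [inner_eq_integral, re_integral (integrable_conj_mul _ _),
      ← integral_add_right_eq_self _ z]
    refine integral_congr_ae ?_
    have q := (measurePreserving_add_right (volume : Measure (E n)) z).quasiMeasurePreserving
    filter_upwards [q.ae_eq_comp (hb.bddMeas.coeFn v), q.ae_eq_comp (coeFn_tr (-z) v),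
      coeFn_tr z v] with x h1 h2 h3
    simp only [Function.comp_apply] at h1 h2
    rw [h1, h2, h3, add_neg_cancel_right, map_mul, Complex.conj_ofReal, mul_assoc,
      Complex.re_ofReal_mul, ← Complex.conj_re (starRingEnd ℂ (v (x + z)) * v x)]
    congr 2
    rw [map_mul, Complex.conj_conj, mul_comm]
  rw [Complex.sub_re, e1, e2]
  unfold corr
  rw [← integral_sub (integrable_corr hb v z) (integrable_corr hbz v z), ← integral_neg]
  refine integral_congr_ae (Eventually.of_forall fun x => ?_)
  simp only; ring

theorem re_inner_tr_self (f : L2C n) (z : E n) :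
    Integrable (fun ξ => Real.cos (ang ξ z) * ‖(𝓕 f : L2C n) ξ‖ ^ 2) ∧
    (inner ℂ f (tr z f)).re = ∫ ξ, Real.cos (ang ξ z) * ‖(𝓕 f : L2C n) ξ‖ ^ 2 := by
  have h : ∀ ξ, (starRingEnd ℂ ((𝓕 f : L2C n) ξ) * (chr z ξ * (𝓕 f : L2C n) ξ)).re
      = Real.cos (ang ξ z) * ‖(𝓕 f : L2C n) ξ‖ ^ 2 := fun ξ => by
    rw [show starRingEnd ℂ ((𝓕 f : L2C n) ξ) * (chr z ξ * (𝓕 f : L2C n) ξ)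
      = ((‖(𝓕 f : L2C n) ξ‖ ^ 2 : ℝ) : ℂ) * chr z ξ by
        rw [← Complex.normSq_eq_norm_sq, ← Complex.mul_conj]; ring,
      Complex.re_ofReal_mul, chr_eq_exp_ang, Complex.exp_ofReal_mul_I_re, mul_comm]
  refine ⟨(integrable_inner_tr f f z).re.congr (Eventually.of_forall h), ?_⟩
  rw [inner_tr_eq, re_integral (integrable_inner_tr f f z)]
  exact integral_congr_ae (Eventually.of_forall h)

theorem norm_tr_sub_sq (f : L2C n) (z : E n) :
    Integrable (fun ξ => (1 - Real.cos (ang ξ z)) * ‖(𝓕 f : L2C n) ξ‖ ^ 2) ∧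
    ‖tr z f - f‖ ^ 2 = 2 * ∫ ξ, (1 - Real.cos (ang ξ z)) * ‖(𝓕 f : L2C n) ξ‖ ^ 2 := by
  obtain ⟨h1, h2⟩ := re_inner_tr_self f z
  have h3 := integrable_norm_sq (𝓕 f)
  have h4 : ∀ ξ, (1 - Real.cos (ang ξ z)) * ‖(𝓕 f : L2C n) ξ‖ ^ 2
      = ‖(𝓕 f : L2C n) ξ‖ ^ 2 - Real.cos (ang ξ z) * ‖(𝓕 f : L2C n) ξ‖ ^ 2 := fun ξ => by ring
  simp_rw [h4]
  refine ⟨h3.sub h1, ?_⟩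
  rw [integral_sub h3 h1, ← h2, ← norm_sq_eq_integral, norm_fourier, norm_sub_sq (𝕜 := ℂ), norm_tr,
    ← inner_conj_symm, RCLike.conj_re]
  simp only [RCLike.re_eq_complex_re]; ring

/-- Fubini for the pairing of two `L²` functions with a superposition of multipliers. -/
theorem integral_superposition {k : ℝ × E n → E n → ℂ} {B : ℝ × E n → ℝ} {G : E n → ℝ}
    (hk : Measurable fun q : (ℝ × E n) × E n => k q.1 q.2) (hB : Integrable B (pm n))
    (hle : ∀ᵐ p ∂pm n, ∀ ξ, ‖k p ξ‖ ≤ B p * G ξ) {g f : L2C n}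
    (hf : MemLp (fun ξ => (G ξ : ℂ) * f ξ) 2 volume) :
    Integrable (fun p => ∫ ξ, starRingEnd ℂ (g ξ) * (k p ξ * f ξ)) (pm n) ∧
    ∫ ξ, starRingEnd ℂ (g ξ) * ((∫ p, k p ξ ∂pm n) * f ξ)
      = ∫ p, (∫ ξ, starRingEnd ℂ (g ξ) * (k p ξ * f ξ)) ∂pm n := by
  have hprod : Integrable (fun q : (ℝ × E n) × E n =>
      starRingEnd ℂ (g q.2) * (k q.1 q.2 * f q.2)) ((pm n).prod volume) := by
    have hgf : Integrable (fun ξ => ‖g ξ‖ * ‖(hf.toLp _) ξ‖) := integrable_norm_mul_norm g (hf.toLp _)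
    have hmg : AEStronglyMeasurable (fun q : (ℝ × E n) × E n => g q.2) ((pm n).prod volume) :=
      (Lp.aestronglyMeasurable g).comp_snd
    have hmf : AEStronglyMeasurable (fun q : (ℝ × E n) × E n => f q.2) ((pm n).prod volume) :=
      (Lp.aestronglyMeasurable f).comp_snd
    refine (hB.norm.mul_prod hgf).mono'
      ((Complex.continuous_conj.comp_aestronglyMeasurable hmg).mul
        (hk.aestronglyMeasurable.mul hmf)) ?_
    filter_upwards [Measure.quasiMeasurePreserving_fst.ae hle,
      Measure.quasiMeasurePreserving_snd.ae hf.coeFn_toLp] with q h1 h2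
    rw [h2, norm_mul, norm_mul, norm_mul, RCLike.norm_conj]
    calc ‖g q.2‖ * (‖k q.1 q.2‖ * ‖f q.2‖)
        ≤ ‖g q.2‖ * ((B q.1 * G q.2) * ‖f q.2‖) := by gcongr; exact h1 _
      _ ≤ ‖g q.2‖ * ((|B q.1| * |G q.2|) * ‖f q.2‖) := by
          have := le_abs_self (B q.1 * G q.2)
          rw [abs_mul] at this
          gcongr
      _ = ‖B q.1‖ * (‖g q.2‖ * (‖(G q.2 : ℂ)‖ * ‖f q.2‖)) := by
          rw [Complex.norm_real, Real.norm_eq_abs, Real.norm_eq_abs]; ring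
  refine ⟨hprod.integral_prod_left, ?_⟩
  rw [integral_integral_swap (f := fun p ξ => starRingEnd ℂ (g ξ) * (k p ξ * f ξ)) hprod]
  refine integral_congr_ae (Eventually.of_forall fun ξ => ?_)
  simp only
  rw [integral_const_mul, integral_mul_const]

/-- A weight `φ` varying in the direction `ν` only, with `∂φ = h² ν` up to a remainder of third
order, and all the bounds needed, with a common constant. -/
structure WeightData (ν : E n) (φ h : E n → ℝ) (C : ℝ) : Prop where
  bdd : BddReal φ C
  lip : ∀ x z, |φ (x + z) - φ x| ≤ C * ‖z‖
  bdd_h : BddReal h C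
  lip_h : ∀ x z, |h (x + z) - h x| ≤ C * ‖z‖
  rem : ∀ x z, |φ (x + z) - φ x - inner ℝ ν z * (h x * h (x + z))| ≤ C * ‖z‖ ^ 3
  rem' : ∀ x z, |φ (x + z) - φ x - inner ℝ ν z * (h x * h (x + z))| ≤ C * (1 + ‖z‖)

/-- The third-order remainder. -/
def remainder (ν : E n) (φ h : E n → ℝ) (z x : E n) : ℝ :=
  φ (x + z) - φ x - inner ℝ ν z * (h x * h (x + z))

theorem WeightData.bddReal_remainder {ν : E n} {φ h : E n → ℝ} {C : ℝ} (H : WeightData ν φ h C)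
    {σ : ℝ} (hσ : 0 < σ) (y : E n) :
    BddReal (remainder ν φ h (σ • y)) (2 * C * (σ * min 1 (σ ^ 2)) * (1 + ‖y‖) ^ 3) := by
  have hC := H.bdd.nonneg
  refine ⟨?_, fun x => ?_⟩
  · unfold remainder
    have h1 := H.bdd.1; have h2 := H.bdd_h.1
    fun_prop
  · have e1 := H.rem x (σ • y)
    have e2 := H.rem' x (σ • y)
    rw [norm_smul, Real.norm_of_nonneg hσ.le] at e1 e2
    unfold remainder
    have hy := norm_nonneg y
    have hy1 : ‖y‖ ^ 3 ≤ (1 + ‖y‖) ^ 3 := by gcongr; linarith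
    have hy2 : 1 + ‖y‖ ≤ (1 + ‖y‖) ^ 3 := le_self_pow₀ (by linarith) (by norm_num)
    rcases le_total 1 σ with h | h
    · rw [min_eq_left (one_le_pow₀ h)]
      refine e2.trans ?_
      calc C * (1 + σ * ‖y‖) ≤ C * (2 * σ * (1 + ‖y‖)) := by
            gcongr; nlinarith
        _ ≤ C * (2 * σ * (1 + ‖y‖) ^ 3) := by gcongr
        _ = _ := by ring
    · rw [min_eq_right (pow_le_one₀ hσ.le h)]
      refine e1.trans ?_
      calc C * (σ * ‖y‖) ^ 3 = C * (σ ^ 3 * ‖y‖ ^ 3) := by ring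
        _ ≤ 2 * (C * (σ ^ 3 * (1 + ‖y‖) ^ 3)) := by
          have : C * (σ ^ 3 * ‖y‖ ^ 3) ≤ C * (σ ^ 3 * (1 + ‖y‖) ^ 3) := by gcongr
          have h0 : 0 ≤ C * (σ ^ 3 * ‖y‖ ^ 3) := by positivity
          linarith
        _ = _ := by ring

/-- Against the difference `φ(· + z) - φ`, the correlation of `v` is `ν·z` times that of `h v`, up to
the remainder. -/
theorem WeightData.corr_eq {ν : E n} {φ h : E n → ℝ} {C : ℝ} (H : WeightData ν φ h C)
    (v : L2C n) {z : E n} {D : ℝ} (hr : BddReal (remainder ν φ h z) D) :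
    corr (fun x => φ (x + z) - φ x) v z
      = inner ℝ ν z * (inner ℂ (rmul h v) (tr z (rmul h v))).re
        + corr (remainder ν φ h z) v z := by
  have e0 := integrable_conj_mul (rmul h v) (tr z (rmul h v))
  rw [inner_eq_integral, re_integral e0, ← integral_const_mul]
  unfold corr
  have e0' : Integrable fun x => (starRingEnd ℂ (rmul h v x) * (tr z (rmul h v)) x).re := e0.re
  rw [← integral_add (e0'.const_mul _) (integrable_corr hr v z)]
  refine integral_congr_ae ?_
  have q := (measurePreserving_add_right (volume : Measure (E n)) z).quasiMeasurePreserving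
  filter_upwards [H.bdd_h.bddMeas.coeFn v, q.ae_eq_comp (H.bdd_h.bddMeas.coeFn v),
    coeFn_tr z (rmul h v), coeFn_tr z v] with x h1 h2 h3 h4
  simp only [Function.comp_apply] at h2
  rw [h3, h2, h1, h4, map_mul, Complex.conj_ofReal,
    show (h x : ℂ) * starRingEnd ℂ (v x) * ((h (x + z) : ℂ) * v (x + z))
      = ((h x * h (x + z) : ℝ) : ℂ) * (starRingEnd ℂ (v x) * v (x + z)) by push_cast; ring,
    Complex.re_ofReal_mul]
  unfold remainder; ring

/-- `‖w(· + z) - w‖` for `w = h v`. -/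
theorem WeightData.norm_tr_sub_le {ν : E n} {φ h : E n → ℝ} {C : ℝ} (H : WeightData ν φ h C)
    (v : L2C n) (z : E n) :
    ‖tr z (rmul h v) - rmul h v‖ ≤ C * ‖tr z v - v‖ + C * ‖z‖ * ‖v‖ := by
  have b1 : BddReal (fun x => h (x + z)) C :=
    ⟨H.bdd_h.1.comp (measurable_add_const z), fun x => H.bdd_h.2 _⟩
  have b2 : BddReal (fun x => h (x + z) - h x) (C * ‖z‖) :=
    ⟨(H.bdd_h.1.comp (measurable_add_const z)).sub H.bdd_h.1, fun x => H.lip_h x z⟩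
  have e : tr z (rmul h v) - rmul h v = rmul (fun x => h (x + z)) (tr z v - v)
      + rmul (fun x => h (x + z) - h x) v := by
    refine Lp.ext ?_
    have q := (measurePreserving_add_right (volume : Measure (E n)) z).quasiMeasurePreserving
    filter_upwards [H.bdd_h.bddMeas.coeFn v, q.ae_eq_comp (H.bdd_h.bddMeas.coeFn v),
      coeFn_tr z (rmul h v), coeFn_tr z v, b1.bddMeas.coeFn (tr z v - v), b2.bddMeas.coeFn v,
      Lp.coeFn_sub (tr z (rmul h v)) (rmul h v), Lp.coeFn_sub (tr z v) v,
      Lp.coeFn_add (rmul (fun x => h (x + z)) (tr z v - v)) (rmul (fun x => h (x + z) - h x) v)]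
      with x h1 h2 h3 h4 h5 h6 h7 h8 h9
    simp only [Function.comp_apply] at h2
    rw [h7, h9, Pi.sub_apply, Pi.add_apply, h3, h2, h1, h5, h6, h8, Pi.sub_apply, h4]
    push_cast; ring
  rw [e]
  exact (norm_add_le _ _).trans (add_le_add (b1.bddMeas.norm_le _) (b2.bddMeas.norm_le _))

theorem norm_tr_sub_le_two (v : L2C n) (z : E n) : ‖tr z v - v‖ ≤ 2 * ‖v‖ :=
  (norm_sub_le _ _).trans (by rw [norm_tr]; linarith)

/-- Translations of a function in `H¹`. -/
theorem norm_tr_sub_le {v : L2C n}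
    (hv : MemLp (fun ξ => ((1 + ‖ξ‖ : ℝ) : ℂ) * (𝓕 v : L2C n) ξ) 2 volume) (z : E n) :
    ‖tr z v - v‖ ≤ 2 * Real.pi * ‖z‖ * ‖hv.toLp _‖ := by
  have e : ‖tr z v - v‖ = ‖mulOp (chr z) (𝓕 v) - 𝓕 v‖ := by
    rw [← norm_fourier (tr z v - v), sub_eq_add_neg, FourierTransform.fourier_add,
      FourierTransform.fourier_neg, fourier_tr, ← sub_eq_add_neg]
  rw [e]
  refine Lp.norm_le_mul_norm_of_ae_le_mul ?_
  filter_upwards [Lp.coeFn_sub (mulOp (chr z) (𝓕 v)) (𝓕 v), (bddMeas_chr z).coeFn (𝓕 v),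
    hv.coeFn_toLp] with ξ h1 h2 h3
  rw [h1, Pi.sub_apply, h2, h3, ← sub_one_mul, norm_mul, norm_mul, ← mul_assoc]
  refine mul_le_mul_of_nonneg_right ?_ (norm_nonneg _)
  rw [chr_eq_exp_ang, mul_comm _ Complex.I]
  refine Real.norm_exp_I_mul_ofReal_sub_one_le.trans ?_
  have hpi := Real.pi_pos
  rw [Complex.norm_real, Real.norm_of_nonneg (by positivity : 0 ≤ 1 + ‖ξ‖), Real.norm_eq_abs, ang,
    abs_mul, abs_of_pos (by positivity : 0 < 2 * Real.pi)]
  have h1 := abs_real_inner_le_norm ξ z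
  calc 2 * Real.pi * |inner ℝ ξ z| ≤ 2 * Real.pi * (‖ξ‖ * ‖z‖) := by gcongr
    _ ≤ 2 * Real.pi * ((1 + ‖ξ‖) * ‖z‖) := by gcongr; linarith
    _ = _ := by ring

/-! ### The commutator of a weight with the dispersion -/

/-- Absolute convergence of the quadratic form of the commutator, evaluated at `w = h v`. -/
theorem integrable_cosKer_mul {ν : E n} {φ h : E n → ℝ} {C : ℝ} (H : WeightData ν φ h C)
    {α : ℝ} (h0 : 0 < α) (h2 : α < 2) (e : E n) {v : L2C n}
    (hv : MemLp (fun ξ => ((1 + ‖ξ‖ : ℝ) : ℂ) * (𝓕 v : L2C n) ξ) 2 volume) :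
    Integrable (fun q : (ℝ × E n) × E n =>
      cosKer α e ν q.2 q.1 * ‖(𝓕 (rmul h v) : L2C n) q.2‖ ^ 2) ((pm n).prod volume) := by
  have hC := H.bdd.nonneg
  set W : L2C n := 𝓕 (rmul h v) with hW
  have hWm : AEStronglyMeasurable (fun q : (ℝ × E n) × E n => ‖W q.2‖ ^ 2)
      ((pm n).prod volume) := ((Lp.aestronglyMeasurable W).comp_snd).norm.pow 2
  -- the majorant, for which Tonelli's theorem applies
  set f : (ℝ × E n) × E n → ℝ := fun q => q.1.1 ^ (-1 - α) * (1 + ‖q.1.2‖) ^ 2 *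
    ((1 - Real.cos (ang q.2 (q.1.1 • q.1.2))) * ‖W q.2‖ ^ 2) with hf
  have hfm : AEStronglyMeasurable f ((pm n).prod volume) := by
    refine AEStronglyMeasurable.mul (Measurable.aestronglyMeasurable (by fun_prop)) ?_
    exact (Measurable.aestronglyMeasurable (by fun_prop)).mul hWm
  set L := ‖hv.toLp _‖
  have hfi : Integrable f ((pm n).prod volume) := by
    rw [integrable_prod_iff hfm]
    refine ⟨Eventually.of_forall fun p => ((norm_tr_sub_sq (rmul h v) (p.1 • p.2)).1).const_mul
      (p.1 ^ (-1 - α) * (1 + ‖p.2‖) ^ 2), ?_⟩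
    refine integrable_pm_of_le (k := 2) (l := 4)
      (C := (C * (2 * Real.pi * L + 2 * ‖v‖)) ^ 2) h0 (by exact_mod_cast h2)
      hfm.norm.integral_prod_right' fun σ hσ y => ?_
    have hr := Real.rpow_pos_of_pos hσ (-1 - α)
    have hy := norm_nonneg y
    have hpi := Real.pi_pos
    have e1 : ∫ ξ, ‖f ((σ, y), ξ)‖ = σ ^ (-1 - α) * (1 + ‖y‖) ^ 2 *
        ∫ ξ, (1 - Real.cos (ang ξ (σ • y))) * ‖W ξ‖ ^ 2 := by
      rw [← integral_const_mul]
      refine integral_congr_ae (Eventually.of_forall fun ξ => ?_)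
      simp only [hf]
      rw [Real.norm_of_nonneg]
      have := one_sub_cos_nonneg (ang ξ (σ • y))
      positivity
    have e2 := (norm_tr_sub_sq (rmul h v) (σ • y)).2
    have e3 : ∫ ξ, (1 - Real.cos (ang ξ (σ • y))) * ‖W ξ‖ ^ 2
        ≤ ‖tr (σ • y) (rmul h v) - rmul h v‖ ^ 2 := by
      have := sq_nonneg ‖tr (σ • y) (rmul h v) - rmul h v‖
      rw [hW]; linarith
    have e4 : 0 ≤ ∫ ξ, (1 - Real.cos (ang ξ (σ • y))) * ‖W ξ‖ ^ 2 :=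
      integral_nonneg fun ξ => mul_nonneg (one_sub_cos_nonneg _) (sq_nonneg _)
    have hL : 0 ≤ L := norm_nonneg _
    have hv0 := norm_nonneg v
    have e5 : ‖tr (σ • y) (rmul h v) - rmul h v‖
        ≤ C * (2 * Real.pi * L + 2 * ‖v‖) * (1 + ‖y‖) * min 1 σ := by
      rcases le_total 1 σ with hσ1 | hσ1
      · rw [min_eq_left hσ1]
        have := norm_tr_sub_le_two (rmul h v) (σ • y)
        have h6 := H.bdd_h.bddMeas.norm_le v
        calc _ ≤ 2 * (C * ‖v‖) := by linarith
          _ ≤ C * (2 * Real.pi * L + 2 * ‖v‖) * 1 * 1 := by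
            have : 0 ≤ C * (2 * Real.pi * L) := by positivity
            linarith
          _ ≤ _ := by gcongr; linarith
      · rw [min_eq_right hσ1]
        have h6 := H.norm_tr_sub_le v (σ • y)
        have h7 := norm_tr_sub_le hv (σ • y)
        rw [norm_smul, Real.norm_of_nonneg hσ.le] at h6 h7
        calc _ ≤ C * (2 * Real.pi * (σ * ‖y‖) * L) + C * (σ * ‖y‖) * ‖v‖ := by
              refine h6.trans ?_; gcongr
          _ = C * (2 * Real.pi * L + ‖v‖) * ‖y‖ * σ := by ring
          _ ≤ _ := by gcongr <;> linarith
    have e6 : (min 1 σ) ^ 2 = min 1 (σ ^ 2) := by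
      rcases le_total 1 σ with h | h
      · rw [min_eq_left h, min_eq_left (one_le_pow₀ h)]; norm_num
      · rw [min_eq_right h, min_eq_right (pow_le_one₀ hσ.le h)]
    rw [e1, Real.norm_of_nonneg (by positivity)]
    calc _ ≤ σ ^ (-1 - α) * (1 + ‖y‖) ^ 2 *
          (C * (2 * Real.pi * L + 2 * ‖v‖) * (1 + ‖y‖) * min 1 σ) ^ 2 := by
          gcongr
          exact e3.trans (pow_le_pow_left₀ (norm_nonneg _) e5 2)
      _ = _ := by rw [mul_pow, e6]; ring
  refine (hfi.const_mul (3 * ‖e‖ * ‖ν‖)).mono'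
    ((Measurable.aestronglyMeasurable (measurable_cosKer α e ν)).mul hWm) ?_
  filter_upwards [Measure.quasiMeasurePreserving_fst.ae ae_pm_pos] with q hq
  have := cosKer_le_one_sub_cos α e ν q.2 hq q.1.2
  rw [norm_mul, Real.norm_eq_abs, Real.norm_of_nonneg (sq_nonneg ‖W q.2‖), hf]
  refine (mul_le_mul_of_nonneg_right this (sq_nonneg _)).trans (le_of_eq ?_)
  ring

/-- The commutator of a weight with `∂₁(-Δ)^{α/2}` gains `α/2` derivatives: the quadratic form of
the operator with symbol `i ξ₁|ξ|^α`, localised by `φ`, is bounded above by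
`-c ‖|D|^{α/2}(h v)‖² + K ‖v‖²`. -/
theorem commutator_estimate (ν e : E n) {α : ℝ} (h0 : 0 < α) (h2 : α < 2) {c₀ : ℝ} (hc₀ : 0 < c₀)
    (hell : ∀ ξ : E n, c₀ * ‖ξ‖ ^ 2 ≤ inner ℝ e ν * ‖ξ‖ ^ 2 + α * (inner ℝ e ξ * inner ℝ ν ξ))
    (C : ℝ) :
    ∃ K : ℝ, ∀ φ h : E n → ℝ, WeightData ν φ h C → ∀ v : L2C n,
      MemLp (fun ξ => (((1 + ‖ξ‖) ^ 3 : ℝ) : ℂ) * (𝓕 v : L2C n) ξ) 2 volume →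
      Integrable (fun ξ => ‖ξ‖ ^ α * ‖(𝓕 (rmul h v) : L2C n) ξ‖ ^ 2) ∧
      (∫ ξ, starRingEnd ℂ ((𝓕 (rmul φ v) : L2C n) ξ) *
        (Complex.I * ((inner ℝ e ξ * ‖ξ‖ ^ α : ℝ) : ℂ) * (𝓕 v : L2C n) ξ)).re
        ≤ -(c₀ / (4 * Real.pi)) * (∫ ξ, ‖ξ‖ ^ α * ‖(𝓕 (rmul h v) : L2C n) ξ‖ ^ 2)
          + K * ‖v‖ ^ 2 := by
  have hpi := Real.pi_pos
  have hS := subConst_pos h0 h2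
  set b : ℝ × E n → ℝ := fun p => p.1 ^ (-1 - α) * min 1 (p.1 ^ 2) * (1 + ‖p.2‖) ^ 4 with hb
  have hbi : Integrable b (pm n) :=
    (integrableOn_weight (k := 2) h0 (by exact_mod_cast h2)).mul_prod (integrable_moment 4)
  -- `5 = 1 + 4`: half the bound `2 C` of the remainder at `z`, and a quarter of its bound at `2 z`,
  -- which is `8` times larger
  refine ⟨5 * C * ‖e‖ * (∫ p, b p ∂pm n) / subConst α, fun φ h H v hv => ?_⟩
  have hC := H.bdd.nonneg
  have hv1 : MemLp (fun ξ => ((1 + ‖ξ‖ : ℝ) : ℂ) * (𝓕 v : L2C n) ξ) 2 volume := by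
    refine hv.mono ((Measurable.aestronglyMeasurable (by fun_prop)).mul
      (Lp.aestronglyMeasurable _)) (Eventually.of_forall fun ξ => ?_)
    rw [norm_mul, norm_mul]
    refine mul_le_mul_of_nonneg_right ?_ (norm_nonneg _)
    rw [Complex.norm_real, Complex.norm_real, Real.norm_of_nonneg (by positivity : 0 ≤ 1 + ‖ξ‖),
      Real.norm_of_nonneg (by positivity)]
    exact le_self_pow₀ (by linarith [norm_nonneg ξ]) (by norm_num)
  set W : L2C n := 𝓕 (rmul h v) with hW
  have hprod := integrable_cosKer_mul H h0 h2 e hv1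
  rw [← hW] at hprod
  -- the right-hand side: the symbol of the quadratic form
  have hMi := hprod.integral_prod_right
  have hsw := integral_integral_swap (f := fun p ξ => cosKer α e ν ξ p * ‖W ξ‖ ^ 2) hprod
  simp only [integral_mul_const] at hMi hsw
  have hsymb : ∀ ξ, (2 * Real.pi)⁻¹ * subConst α * c₀ * (‖ξ‖ ^ α * ‖W ξ‖ ^ 2)
      ≤ (∫ p, cosKer α e ν ξ p ∂pm n) * ‖W ξ‖ ^ 2 := fun ξ => by
    rw [← mul_assoc]
    refine mul_le_mul_of_nonneg_right ?_ (sq_nonneg _)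
    rcases eq_or_ne ξ 0 with rfl | hξ
    · simp [Real.zero_rpow h0.ne', cosKer, ang]
    · rw [integral_cosKer h0 h2 e ν hξ]
      have hξ' : 0 < ‖ξ‖ := norm_pos_iff.2 hξ
      have h4 : ‖ξ‖ ^ α = ‖ξ‖ ^ (α - 2) * ‖ξ‖ ^ 2 := by
        rw [← Real.rpow_natCast ‖ξ‖ 2, ← Real.rpow_add hξ']; congr 1; push_cast; ring
      have h5 := Real.rpow_pos_of_pos hξ' (α - 2)
      calc _ = (2 * Real.pi)⁻¹ * subConst α * ‖ξ‖ ^ (α - 2) * (c₀ * ‖ξ‖ ^ 2) := by rw [h4]; ring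
        _ ≤ _ := by gcongr; exact hell ξ
  have hWi : Integrable (fun ξ => ‖ξ‖ ^ α * ‖W ξ‖ ^ 2) := by
    have hA : 0 < (2 * Real.pi)⁻¹ * subConst α * c₀ := by positivity
    refine (hMi.const_mul ((2 * Real.pi)⁻¹ * subConst α * c₀)⁻¹).mono'
      ((Measurable.aestronglyMeasurable (by fun_prop)).mul
        ((Lp.aestronglyMeasurable W).norm.pow 2)) (Eventually.of_forall fun ξ => ?_)
    rw [Real.norm_of_nonneg (by positivity)]
    have := hsymb ξ
    rwa [← le_inv_mul_iff₀ hA] at this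
  refine ⟨hWi, ?_⟩
  -- the left-hand side: superposition of translations
  set g : L2C n := 𝓕 (rmul φ v) with hg
  have hsup := integral_superposition (k := fun p ξ => Complex.I * (sinKer α e ξ p : ℂ))
    (B := fun p => 2 * ‖e‖ * (2 * Real.pi) ^ 3 * b p) (G := fun ξ => (1 + ‖ξ‖) ^ 3)
    (measurable_const.mul (Complex.measurable_ofReal.comp (measurable_sinKer α e)))
    (hbi.const_mul _) (by
      filter_upwards [ae_pm_pos] with p hp ξ
      rw [norm_mul, Complex.norm_I, one_mul, Complex.norm_real, Real.norm_eq_abs]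
      refine (sinKer_le α e ξ hp p.2).trans (le_of_eq ?_)
      rw [hb]; ring) (g := g) (f := 𝓕 v) hv
  obtain ⟨hFi, hFe⟩ := hsup
  set F : ℝ × E n → ℂ := fun p => ∫ ξ, starRingEnd ℂ (g ξ) *
    (Complex.I * (sinKer α e ξ p : ℂ) * (𝓕 v : L2C n) ξ) with hF
  -- For a single parameter, the weight enters through its differences only. Replacing
  -- `φ(x + z) - φ(x)` by `(ν·z) h(x) h(x + z)` turns the pairing into a form in `h v`; the
  -- third-order remainder compensates the singularity `σ ^ (-2 - α)` of the density.
  have hFre : ∀ p : ℝ × E n, 0 < p.1 → |(F p).re + 2⁻¹ * ∫ ξ, cosKer α e ν ξ p * ‖W ξ‖ ^ 2|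
      ≤ 5 * C * ‖e‖ * ‖v‖ ^ 2 * b p := by
    rintro ⟨σ, y⟩ hσ
    simp only at hσ
    set z := σ • y with hz
    have hr := Real.rpow_pos_of_pos hσ (-1 - α)
    set a : ℝ := σ ^ (-1 - α) * σ⁻¹ * inner ℝ e y with ha
    obtain ⟨i1, j1⟩ := integral_sin_ang (rmul φ v) v z
    obtain ⟨i2, j2⟩ := integral_sin_ang (rmul φ v) v ((2:ℝ) • z)
    have eF : F (σ, y) = (a : ℂ) * ((inner ℂ (rmul φ v) (tr z v) - inner ℂ (rmul φ v) (tr (-z) v)) / 2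
        - (inner ℂ (rmul φ v) (tr ((2:ℝ) • z) v)
          - inner ℂ (rmul φ v) (tr (-((2:ℝ) • z)) v)) / 2 / 2) := by
      rw [← j1, ← j2, ← integral_div, ← integral_sub i1 (i2.div_const 2), ← integral_const_mul]
      refine integral_congr_ae (Eventually.of_forall fun ξ => ?_)
      simp only [sinKer, ang_two_smul]
      rw [← hz, ← ha]; push_cast; ring
    have r1 := H.bddReal_remainder hσ y
    have r2 := H.bddReal_remainder hσ ((2:ℝ) • y)
    rw [← hz] at r1
    rw [smul_comm, ← hz] at r2
    have c1 := H.corr_eq v r1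
    have c2 := H.corr_eq v r2
    have eM : ∫ ξ, cosKer α e ν ξ (σ, y) * ‖W ξ‖ ^ 2
        = a * inner ℝ ν z * ((inner ℂ (rmul h v) (tr z (rmul h v))).re
          - (inner ℂ (rmul h v) (tr ((2:ℝ) • z) (rmul h v))).re) := by
      rw [(re_inner_tr_self (rmul h v) z).2, (re_inner_tr_self (rmul h v) ((2:ℝ) • z)).2,
        ← integral_sub (re_inner_tr_self (rmul h v) z).1 (re_inner_tr_self (rmul h v) ((2:ℝ) • z)).1,
        ← integral_const_mul]
      refine integral_congr_ae (Eventually.of_forall fun ξ => ?_)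
      simp only [cosKer, ang_two_smul]
      rw [← hz, ← hW, ha, hz, inner_smul_right]
      field_simp
    have eT : (F (σ, y)).re + 2⁻¹ * ∫ ξ, cosKer α e ν ξ (σ, y) * ‖W ξ‖ ^ 2
        = a * (-(corr (remainder ν φ h z) v z) / 2
          + corr (remainder ν φ h ((2:ℝ) • z)) v ((2:ℝ) • z) / 4) := by
      rw [eM, eF, Complex.re_ofReal_mul, Complex.sub_re]
      have d : ∀ w : ℂ, (w / 2).re = w.re / 2 := fun w => by
        rw [show w / 2 = w / ((2:ℝ):ℂ) by push_cast; rfl, Complex.div_ofReal_re]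
      rw [d, d, d, re_inner_rmul_tr_sub H.bdd, re_inner_rmul_tr_sub H.bdd, c1, c2,
        show inner ℝ ν ((2:ℝ) • z) = 2 * inner ℝ ν z from inner_smul_right _ _ _]
      ring
    rw [eT, abs_mul]
    have b1 := abs_corr_le r1 v z
    have b2 := abs_corr_le r2 v ((2:ℝ) • z)
    set m := σ * min 1 (σ ^ 2) with hm
    have hm0 : 0 ≤ m := by positivity
    have hy := norm_nonneg y
    have b3 : (1 + ‖(2:ℝ) • y‖) ^ 3 ≤ 8 * (1 + ‖y‖) ^ 3 := by
      rw [norm_smul, Real.norm_of_nonneg zero_le_two]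
      calc (1 + 2 * ‖y‖) ^ 3 ≤ (2 * (1 + ‖y‖)) ^ 3 := by gcongr; linarith
        _ = _ := by ring
    have b4 : |corr (remainder ν φ h ((2:ℝ) • z)) v ((2:ℝ) • z)|
        ≤ 2 * C * m * (8 * (1 + ‖y‖) ^ 3) * ‖v‖ ^ 2 := b2.trans (by gcongr)
    have b5 : |-(corr (remainder ν φ h z) v z) / 2
          + corr (remainder ν φ h ((2:ℝ) • z)) v ((2:ℝ) • z) / 4|
        ≤ 5 * C * m * (1 + ‖y‖) ^ 3 * ‖v‖ ^ 2 := by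
      refine (abs_add_le _ _).trans ?_
      rw [abs_div, abs_div, abs_neg, abs_two, abs_of_pos (by norm_num : (0:ℝ) < 4)]
      linarith
    have b6 : |a| ≤ σ ^ (-1 - α) * σ⁻¹ * (‖e‖ * (1 + ‖y‖)) := by
      rw [ha, abs_mul, abs_mul, abs_of_pos hr, abs_of_pos (inv_pos.2 hσ)]
      gcongr
      exact (abs_real_inner_le_norm e y).trans (by gcongr; linarith)
    calc _ ≤ σ ^ (-1 - α) * σ⁻¹ * (‖e‖ * (1 + ‖y‖)) * (5 * C * m * (1 + ‖y‖) ^ 3 * ‖v‖ ^ 2) := by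
          gcongr
      _ = (σ⁻¹ * σ) * (5 * C * ‖e‖ * ‖v‖ ^ 2 * b (σ, y)) := by rw [hm, hb]; ring
      _ = _ := by rw [inv_mul_cancel₀ hσ.ne', one_mul]
  have hFi' : Integrable (fun p => (F p).re) (pm n) := hFi.re
  have hMp := hprod.integral_prod_left
  have e1 : (∫ p, F p ∂pm n).re + 2⁻¹ * ∫ p, (∫ ξ, cosKer α e ν ξ p * ‖W ξ‖ ^ 2) ∂pm n
      ≤ 5 * C * ‖e‖ * ‖v‖ ^ 2 * ∫ p, b p ∂pm n := by
    have : (∫ p, F p ∂pm n).re = ∫ p, (F p).re ∂pm n := by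
      rw [← Complex.reCLM_apply, ← ContinuousLinearMap.integral_comp_comm _ hFi]; rfl
    rw [this, ← integral_const_mul, ← integral_const_mul, ← integral_add hFi' (hMp.const_mul _)]
    refine integral_mono_ae (hFi'.add (hMp.const_mul _)) (hbi.const_mul _) ?_
    filter_upwards [ae_pm_pos] with p hp using (le_abs_self _).trans (hFre p hp)
  rw [hsw, ← hFe] at e1
  have e2 : ∫ ξ, starRingEnd ℂ (g ξ) * ((∫ p, Complex.I * (sinKer α e ξ p : ℂ) ∂pm n) *
      (𝓕 v : L2C n) ξ) = (subConst α : ℂ) * ∫ ξ, starRingEnd ℂ (g ξ) *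
        (Complex.I * ((inner ℝ e ξ * ‖ξ‖ ^ α : ℝ) : ℂ) * (𝓕 v : L2C n) ξ) := by
    rw [← integral_const_mul]
    refine integral_congr_ae (Eventually.of_forall fun ξ => ?_)
    simp only
    rw [integral_const_mul, integral_complex_ofReal, integral_sinKer h0 h2]
    push_cast; ring
  rw [e2, Complex.re_ofReal_mul] at e1
  have e3 : (2 * Real.pi)⁻¹ * subConst α * c₀ * ∫ ξ, ‖ξ‖ ^ α * ‖W ξ‖ ^ 2
      ≤ ∫ ξ, (∫ p, cosKer α e ν ξ p ∂pm n) * ‖W ξ‖ ^ 2 := by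
    rw [← integral_const_mul]
    exact integral_mono (hWi.const_mul _) hMi hsymb
  set Q := (∫ ξ, starRingEnd ℂ (g ξ) *
        (Complex.I * ((inner ℝ e ξ * ‖ξ‖ ^ α : ℝ) : ℂ) * (𝓕 v : L2C n) ξ)).re
  set Y := ∫ ξ, ‖ξ‖ ^ α * ‖W ξ‖ ^ 2
  have e4 : subConst α * (Q + c₀ / (4 * Real.pi) * Y) ≤ 5 * C * ‖e‖ * ‖v‖ ^ 2 * ∫ p, b p ∂pm n := by
    refine le_trans ?_ e1
    have : subConst α * (c₀ / (4 * Real.pi) * Y) = 2⁻¹ * ((2 * Real.pi)⁻¹ * subConst α * c₀ * Y) := by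
      field_simp; ring
    rw [mul_add, this]
    linarith
  rw [mul_comm, ← le_div_iff₀ hS] at e4
  calc Q = (Q + c₀ / (4 * Real.pi) * Y) + -(c₀ / (4 * Real.pi)) * Y := by ring
    _ ≤ _ := by
      have : 5 * C * ‖e‖ * ‖v‖ ^ 2 * (∫ p, b p ∂pm n) / subConst α
        = 5 * C * ‖e‖ * (∫ p, b p ∂pm n) / subConst α * ‖v‖ ^ 2 := by ring
      linarith

/-! ### Weights and the square root of their derivative -/

/-- A nonnegative function with second derivative bounded by `c` has a square root with Lipschitz
constant `√c`. -/
theorem abs_sqrt_sub_sqrt_le {f f' f'' : ℝ → ℝ} {c : ℝ} (hc : 0 < c)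
    (h1 : ∀ x, HasDerivAt f (f' x) x) (h2 : ∀ x, HasDerivAt f' (f'' x) x) (hf : ∀ x, 0 ≤ f x)
    (hb : ∀ x, |f'' x| ≤ c) (a b : ℝ) :
    |Real.sqrt (f b) - Real.sqrt (f a)| ≤ Real.sqrt c * |b - a| := by
  have hlip : ∀ x y, |f' y - f' x| ≤ c * |y - x| := fun x y =>
    Convex.norm_image_sub_le_of_norm_hasDerivWithin_le (s := univ) (f := f')
      (fun z _ => (h2 z).hasDerivWithinAt) (fun z _ => hb z) convex_univ trivial trivial
  have taylor : ∀ x y, f y ≤ f x + f' x * (y - x) + c * (y - x) ^ 2 := fun x y => by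
    have h := Convex.norm_image_sub_le_of_norm_hasDerivWithin_le (s := segment ℝ x y)
      (f := fun z => f z - f' x * z) (f' := fun z => f' z - f' x * 1) (C := c * |y - x|)
      (fun z _ => ((h1 z).sub ((hasDerivAt_id z).const_mul (f' x))).hasDerivWithinAt)
      (fun z hz => by
        rw [mul_one]
        refine (hlip x z).trans (mul_le_mul_of_nonneg_left ?_ hc.le)
        have := norm_sub_le_of_mem_segment hz
        rwa [Real.norm_eq_abs, Real.norm_eq_abs] at this) (convex_segment x y)
      (left_mem_segment ℝ x y) (right_mem_segment ℝ x y)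
    rw [Real.norm_eq_abs, Real.norm_eq_abs, mul_assoc, abs_mul_abs_self] at h
    have := (abs_le.1 h).2
    nlinarith
  -- the Taylor bound is nonnegative at its minimum, so its discriminant is nonpositive
  have disc : ∀ x, |f' x| ≤ 2 * (Real.sqrt c * Real.sqrt (f x)) := fun x => by
    have h := (hf _).trans (taylor x (x - f' x / (2 * c)))
    have e : f x + f' x * (x - f' x / (2 * c) - x) + c * (x - f' x / (2 * c) - x) ^ 2
        = f x - f' x ^ 2 / (4 * c) := by field_simp; ring
    rw [e] at h
    have h3 : f' x ^ 2 ≤ 4 * (c * f x) := by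
      rw [sub_nonneg, div_le_iff₀ (by positivity)] at h; linarith
    rw [← Real.sqrt_mul hc.le, show (2:ℝ) = Real.sqrt 4 by
      rw [show (4:ℝ) = 2 ^ 2 by norm_num]; simp, ← Real.sqrt_mul (by norm_num)]
    exact Real.abs_le_sqrt h3
  have key : ∀ x y, Real.sqrt (f y) ≤ Real.sqrt (f x) + Real.sqrt c * |y - x| := fun x y => by
    refine Real.sqrt_le_iff.2 ⟨by positivity, (taylor x y).trans ?_⟩
    have e1 := Real.sq_sqrt (hf x)
    have e2 := Real.sq_sqrt hc.le
    have e3 : f' x * (y - x) ≤ 2 * (Real.sqrt c * Real.sqrt (f x)) * |y - x| :=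
      (le_abs_self _).trans (by rw [abs_mul]; gcongr; exact disc x)
    have e4 : |y - x| ^ 2 = (y - x) ^ 2 := sq_abs _
    calc _ ≤ f x + 2 * (Real.sqrt c * Real.sqrt (f x)) * |y - x| + c * (y - x) ^ 2 := by gcongr
      _ = Real.sqrt (f x) ^ 2 + 2 * (Real.sqrt c * Real.sqrt (f x)) * |y - x|
          + Real.sqrt c ^ 2 * |y - x| ^ 2 := by rw [e1, e2, e4]
      _ = _ := by ring
  refine abs_le.2 ⟨?_, ?_⟩
  · have := key b a; rw [abs_sub_comm] at this; linarith
  · have := key a b; linarith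

/-- The error of the trapezoidal rule. -/
theorem abs_trapezoid_le {F f f' f'' : ℝ → ℝ} {c : ℝ}
    (h0 : ∀ x, HasDerivAt F (f x) x) (h1 : ∀ x, HasDerivAt f (f' x) x)
    (h2 : ∀ x, HasDerivAt f' (f'' x) x) (hb : ∀ x, |f'' x| ≤ c) (a b : ℝ) :
    |F b - F a - (b - a) * ((f a + f b) / 2)| ≤ c * |b - a| ^ 3 := by
  have hc : 0 ≤ c := (abs_nonneg _).trans (hb 0)
  have hlip : ∀ x y, |f' y - f' x| ≤ c * |y - x| := fun x y =>
    Convex.norm_image_sub_le_of_norm_hasDerivWithin_le (s := univ) (f := f')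
      (fun z _ => (h2 z).hasDerivWithinAt) (fun z _ => hb z) convex_univ trivial trivial
  have taylor : ∀ x y, |f y - f x - f' y * (y - x)| ≤ c * |y - x| ^ 2 := fun x y => by
    have h := Convex.norm_image_sub_le_of_norm_hasDerivWithin_le (s := segment ℝ y x)
      (f := fun z => f z - f' y * z) (f' := fun z => f' z - f' y * 1) (C := c * |x - y|)
      (fun z _ => ((h1 z).sub ((hasDerivAt_id z).const_mul (f' y))).hasDerivWithinAt)
      (fun z hz => by
        rw [mul_one]
        refine (hlip y z).trans (mul_le_mul_of_nonneg_left ?_ hc)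
        have := norm_sub_le_of_mem_segment hz
        rwa [Real.norm_eq_abs, Real.norm_eq_abs] at this) (convex_segment y x)
      (left_mem_segment ℝ y x) (right_mem_segment ℝ y x)
    rw [Real.norm_eq_abs, Real.norm_eq_abs, mul_assoc, ← sq, abs_sub_comm x y] at h
    rw [← abs_neg]
    convert h using 2; ring
  -- the derivative of the error is half the first-order Taylor remainder of `f`
  have hder : ∀ z, HasDerivAt (fun z => F z - F a - (z - a) * ((f a + f z) / 2))
      ((f z - f a - f' z * (z - a)) / 2) z := fun z => by
    have e1 := ((h0 z).sub_const (F a)).sub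
      (((hasDerivAt_id z).sub_const a).mul (((h1 z).const_add (f a)).div_const 2))
    refine e1.congr_deriv ?_
    simp only [id]; ring
  have h := Convex.norm_image_sub_le_of_norm_hasDerivWithin_le (s := segment ℝ a b)
      (C := c * |b - a| ^ 2) (fun z _ => (hder z).hasDerivWithinAt)
      (fun z hz => by
        rw [norm_div, Real.norm_eq_abs, Real.norm_eq_abs, abs_two]
        have h3 := taylor a z
        have h4 := norm_sub_le_of_mem_segment hz
        rw [Real.norm_eq_abs, Real.norm_eq_abs] at h4
        have h5 : c * |z - a| ^ 2 ≤ c * |b - a| ^ 2 := by gcongr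
        have h6 : 0 ≤ c * |b - a| ^ 2 := by positivity
        linarith) (convex_segment a b)
      (left_mem_segment ℝ a b) (right_mem_segment ℝ a b)
  simp only [sub_self, zero_mul, sub_zero] at h
  rw [Real.norm_eq_abs, Real.norm_eq_abs] at h
  refine h.trans (le_of_eq ?_); ring

/-- The square root of the derivative of the profile, and its properties. -/
theorem exists_weightData [NeZero n] {ν : E n} {c : ℝ} {φ : E n → ℝ} (h : AdmissibleWeight ν c φ) :
    ∃ k : E n → ℝ, WeightData ν φ k (2 * (1 + c) * (1 + ‖ν‖) ^ 3) ∧ (∀ x, 0 ≤ k x) ∧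
      Continuous k ∧ (∀ x, 0 < k x → ContDiffAt ℝ ∞ k x) ∧
      ∀ x, partialOne φ x = ν 0 * k x ^ 2 := by
  obtain ⟨ϕ, δ, hs, -, hφ, h1, hb, hpos, -, -, -⟩ := h
  have hd : ∀ j : ℕ, ∀ x, HasDerivAt (iteratedDeriv j ϕ) (iteratedDeriv (j + 1) ϕ x) x := fun j x => by
    rw [iteratedDeriv_succ]
    exact ((hs.differentiable_iteratedDeriv j (by exact_mod_cast WithTop.coe_lt_top _)) x).hasDerivAt
  have d0 : ∀ x, HasDerivAt ϕ (deriv ϕ x) x := fun x => by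
    simpa [iteratedDeriv_zero, iteratedDeriv_one] using hd 0 x
  have d1 : ∀ x, HasDerivAt (deriv ϕ) (iteratedDeriv 2 ϕ x) x := fun x => by
    simpa [iteratedDeriv_one] using hd 1 x
  -- `ϕ' = 1` on `[0, 1]`
  have hc1 : 1 ≤ c := by
    have e1 := h1 0 ⟨le_rfl, zero_le_one⟩
    have e2 := hb 1 (by norm_num) 0
    rw [iteratedDeriv_one, e1] at e2
    simpa using e2
  have hc : 0 < c := by linarith
  have hb1 : ∀ x, |deriv ϕ x| ≤ c := fun x => by simpa [iteratedDeriv_one] using hb 1 (by norm_num) x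
  have hb0 : ∀ x, |ϕ x| ≤ c := fun x => by simpa [iteratedDeriv_zero] using hb 0 (by norm_num) x
  have hL := abs_sqrt_sub_sqrt_le hc d1 (hd 2) hpos (hb 3 (by norm_num))
  have hT := abs_trapezoid_le d0 d1 (hd 2) (hb 3 (by norm_num))
  have hsc : Real.sqrt c ≤ c := Real.sqrt_le_iff.2 ⟨hc.le, by nlinarith⟩
  set g : ℝ → ℝ := fun y => Real.sqrt (deriv ϕ y) with hg
  have hg0 : ∀ y, 0 ≤ g y := fun y => Real.sqrt_nonneg _
  have hgsq : ∀ y, g y ^ 2 = deriv ϕ y := fun y => Real.sq_sqrt (hpos y)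
  have hgc : ∀ y, g y ≤ c := fun y =>
    (Real.sqrt_le_sqrt ((le_abs_self _).trans (hb1 y))).trans hsc
  have hder : ContDiff ℝ ∞ (deriv ϕ) := ((contDiff_infty_iff_deriv (𝕜 := ℝ)).1 hs).2
  have hgcont : Continuous g := hder.continuous.sqrt
  have hlin : ∀ x z : E n, inner ℝ ν (x + z) + δ - (inner ℝ ν x + δ) = inner ℝ ν z := fun x z => by
    rw [inner_add_right]; ring
  have hN : ∀ z : E n, |inner ℝ ν z| ≤ ‖ν‖ * ‖z‖ := fun z => abs_real_inner_le_norm ν z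
  have hν := norm_nonneg ν
  set A := (1 + ‖ν‖) ^ 3 with hA
  have hA1 : 1 ≤ A := one_le_pow₀ (by linarith)
  have hA2 : ‖ν‖ ≤ A := by
    have : 1 + ‖ν‖ ≤ A := le_self_pow₀ (by linarith) (by norm_num)
    linarith
  have hA3 : ‖ν‖ ^ 3 ≤ A := by rw [hA]; gcongr; linarith
  have hcA : c * ‖ν‖ ≤ 2 * (1 + c) * A := by nlinarith
  have hkcont : Continuous fun x : E n => g (inner ℝ ν x + δ) := hgcont.comp (by fun_prop)
  have hgl : ∀ a b, |g b - g a| ≤ c * |b - a| := fun a b =>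
    (hL a b).trans (mul_le_mul_of_nonneg_right hsc (abs_nonneg _))
  have hφl : ∀ a b, |ϕ b - ϕ a| ≤ c * |b - a| := fun x y =>
    Convex.norm_image_sub_le_of_norm_hasDerivWithin_le (s := univ) (f := ϕ)
      (fun z _ => (d0 z).hasDerivWithinAt) (fun z _ => hb1 z) convex_univ trivial trivial
  refine ⟨fun x => g (inner ℝ ν x + δ), ⟨⟨?_, fun x => ?_⟩, fun x z => ?_, ⟨hkcont.measurable, fun x => ?_⟩,
    fun x z => ?_, fun x z => ?_, fun x z => ?_⟩, fun x => hg0 _, hkcont, fun x hx => ?_, fun x => ?_⟩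
  · have : φ = fun x => ϕ (inner ℝ ν x + δ) := funext hφ
    rw [this]
    exact (hs.continuous.comp (by fun_prop)).measurable
  · rw [hφ]; exact (hb0 _).trans (by nlinarith)
  · rw [hφ, hφ]
    refine (hφl _ _).trans ?_
    rw [hlin]
    calc c * |inner ℝ ν z| ≤ c * (‖ν‖ * ‖z‖) := by gcongr; exact hN z
      _ = c * ‖ν‖ * ‖z‖ := by ring
      _ ≤ _ := by gcongr
  · rw [abs_of_nonneg (hg0 _)]; exact (hgc _).trans (by nlinarith)
  · refine (hgl _ _).trans ?_
    rw [hlin]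
    calc c * |inner ℝ ν z| ≤ c * (‖ν‖ * ‖z‖) := by gcongr; exact hN z
      _ = c * ‖ν‖ * ‖z‖ := by ring
      _ ≤ _ := by gcongr
  · rw [hφ, hφ]
    set a := inner ℝ ν x + δ
    set b := inner ℝ ν (x + z) + δ
    have hab : inner ℝ ν z = b - a := (hlin x z).symm
    have hd3 : |b - a| ^ 3 ≤ A * ‖z‖ ^ 3 := by
      calc |b - a| ^ 3 ≤ (‖ν‖ * ‖z‖) ^ 3 := by gcongr; rw [← hab]; exact hN z
        _ = ‖ν‖ ^ 3 * ‖z‖ ^ 3 := by ring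
        _ ≤ _ := by gcongr
    have e1 := hT a b
    have e2 : |(b - a) * ((g b - g a) ^ 2 / 2)| ≤ c * |b - a| ^ 3 := by
      rw [abs_mul, abs_of_nonneg (by positivity : 0 ≤ (g b - g a) ^ 2 / 2)]
      have : (g b - g a) ^ 2 ≤ c * |b - a| ^ 2 := by
        rw [← sq_abs]
        calc |g b - g a| ^ 2 ≤ (Real.sqrt c * |b - a|) ^ 2 := by gcongr; exact hL a b
          _ = _ := by rw [mul_pow, Real.sq_sqrt hc.le]
      calc |b - a| * ((g b - g a) ^ 2 / 2) ≤ |b - a| * (c * |b - a| ^ 2) := by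
            gcongr; nlinarith [sq_nonneg (g b - g a)]
        _ = _ := by ring
    -- the trapezoidal rule uses the arithmetic mean of `ϕ'(a) = g(a)²` and `ϕ'(b) = g(b)²`; their
    -- geometric mean `g(a) g(b)` differs from it by `(g(b) - g(a))² / 2`
    have e3 : ϕ b - ϕ a - inner ℝ ν z * (g a * g b)
        = (ϕ b - ϕ a - (b - a) * ((deriv ϕ a + deriv ϕ b) / 2))
          + (b - a) * ((g b - g a) ^ 2 / 2) := by
      rw [hab, ← hgsq a, ← hgsq b]; ring
    rw [e3]
    refine (abs_add_le _ _).trans ?_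
    calc _ ≤ 2 * (c * |b - a| ^ 3) := by linarith
      _ ≤ 2 * (c * (A * ‖z‖ ^ 3)) := by gcongr
      _ ≤ 2 * ((1 + c) * (A * ‖z‖ ^ 3)) := by gcongr; linarith
      _ = _ := by ring
  · rw [hφ, hφ]
    set a := inner ℝ ν x + δ
    set b := inner ℝ ν (x + z) + δ
    have e1 : |ϕ b - ϕ a| ≤ 2 * c := (abs_sub _ _).trans (by linarith [hb0 a, hb0 b])
    have e2 : g a * g b ≤ c := by
      have h3 : ∀ y, g y ≤ Real.sqrt c := fun y => Real.sqrt_le_sqrt ((le_abs_self _).trans (hb1 y))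
      calc g a * g b ≤ Real.sqrt c * Real.sqrt c := mul_le_mul (h3 _) (h3 _) (hg0 _) (by positivity)
        _ = c := Real.mul_self_sqrt hc.le
    refine (abs_sub _ _).trans ?_
    rw [abs_mul, abs_of_nonneg (mul_nonneg (hg0 a) (hg0 b))]
    have hz := norm_nonneg z
    calc |ϕ b - ϕ a| + |inner ℝ ν z| * (g a * g b) ≤ 2 * c + (‖ν‖ * ‖z‖) * c := by
          gcongr; exact hN z
      _ ≤ 2 * c * A + (A * ‖z‖) * c :=
          add_le_add (le_mul_of_one_le_right (by positivity) hA1) (by gcongr)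
      _ ≤ _ := by nlinarith [mul_nonneg (by linarith : 0 ≤ A) hz, mul_nonneg hc.le (mul_nonneg (by linarith : 0 ≤ A) hz)]
  · have : deriv ϕ (inner ℝ ν x + δ) ≠ 0 := fun h0 => by
      simp only [hg, h0, Real.sqrt_zero, lt_irrefl] at hx
    exact ContDiffAt.sqrt (hder.contDiffAt.comp x
      (((innerSL ℝ ν).contDiff.add contDiff_const).contDiffAt (x := x))) this
  · have hf : HasFDerivAt φ (deriv ϕ (inner ℝ ν x + δ) • innerSL ℝ ν) x := by
      have : φ = fun x => ϕ (inner ℝ ν x + δ) := funext hφ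
      rw [this]
      exact (d0 _).comp_hasFDerivAt x (((innerSL ℝ ν).hasFDerivAt).add_const δ)
    unfold partialOne
    rw [hf.fderiv, hgsq]
    simp [basisVec, EuclideanSpace.inner_single_right, mul_comm]

/-! ### Ellipticity in the admissible directions -/

theorem one_le_bracket (ξ : E n) : 1 ≤ bracket ξ := by
  unfold bracket
  exact Real.one_le_sqrt.2 (by nlinarith [sq_nonneg (2 * Real.pi * ‖ξ‖)])

theorem bracket_pos (ξ : E n) : 0 < bracket ξ := zero_lt_one.trans_le (one_le_bracket ξ)

theorem sq_bracket (ξ : E n) : bracket ξ ^ 2 = 1 + (2 * Real.pi * ‖ξ‖) ^ 2 := by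
  unfold bracket; exact Real.sq_sqrt (by positivity)

@[fun_prop]
theorem measurable_bracket : Measurable (bracket : E n → ℝ) := by
  unfold bracket; fun_prop

theorem two_pi_norm_le_bracket (ξ : E n) : 2 * Real.pi * ‖ξ‖ ≤ bracket ξ := by
  unfold bracket
  exact Real.le_sqrt_of_sq_le (by linarith)

/-- The complexification of a real `L²` function. -/
def toC (f : L2 n) : L2C n := Complex.ofRealCLM.compLp f

theorem coeFn_toC (f : L2 n) : toC f =ᵐ[volume] fun x => (f x : ℂ) := by
  have := Complex.ofRealCLM.coeFn_compLp f
  filter_upwards [this] with x hx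
  exact hx

theorem fourierL2_eq (f : L2 n) : fourierL2 f = 𝓕 (toC f) := rfl

theorem norm_toC (f : L2 n) : ‖toC f‖ = ‖f‖ := by
  refine le_antisymm (Lp.norm_le_norm_of_ae_le ?_) (Lp.norm_le_norm_of_ae_le ?_) <;>
  · filter_upwards [coeFn_toC f] with x hx
    rw [hx, Complex.norm_real]

theorem norm_fourierL2 (f : L2 n) : ‖fourierL2 f‖ = ‖f‖ := by
  rw [fourierL2_eq, norm_fourier, norm_toC]

theorem toC_sub (f g : L2 n) : toC (f - g) = toC f - toC g :=
  map_sub (Complex.ofRealCLM.compLpL 2 (volume : Measure (E n))) f g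

theorem fourierL2_sub (f g : L2 n) : fourierL2 (f - g) = fourierL2 f - fourierL2 g := by
  rw [fourierL2_eq, toC_sub, sub_eq_add_neg, FourierTransform.fourier_add,
    FourierTransform.fourier_neg, ← sub_eq_add_neg]; rfl

/-- The indicator of a symmetric set of finite measure is the Fourier transform of a real `L²`
function. -/
theorem exists_fourierL2_eq_indicator {A : Set (E n)} (hA : MeasurableSet A)
    (hfin : volume A ≠ ⊤) (hsymm : ∀ ξ, -ξ ∈ A ↔ ξ ∈ A) :
    ∃ f : L2 n, fourierL2 f =ᵐ[volume] A.indicator fun _ => (1 : ℂ) := by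
  set k : E n → ℂ := A.indicator fun _ => (1 : ℂ) with hk
  have h1 : Integrable k := (integrable_indicator_iff hA).2 (integrableOn_const hfin)
  have h2 : MemLp k 2 volume := memLp_indicator_const 2 hA 1 (Or.inr hfin)
  set F : L2C n := h2.toLp k
  have hreal : ∀ x, ((𝓕⁻ k x).re : ℂ) = 𝓕⁻ k x := fun x => by
    rw [← Complex.conj_eq_iff_re, Real.fourierInv_eq, ← integral_conj,
      ← integral_neg_eq_self]
    refine integral_congr_ae (Eventually.of_forall fun v => ?_)
    have hkv : k (-v) = k v := by
      by_cases hv : v ∈ A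
      · rw [hk, Set.indicator_of_mem hv, Set.indicator_of_mem ((hsymm v).2 hv)]
      · rw [hk, Set.indicator_of_notMem hv, Set.indicator_of_notMem (mt (hsymm v).1 hv)]
    have hkc : starRingEnd ℂ (k v) = k v := by
      by_cases hv : v ∈ A
      · rw [hk, Set.indicator_of_mem hv, map_one]
      · rw [hk, Set.indicator_of_notMem hv, map_zero]
    simp only [hkv, Circle.smul_def, smul_eq_mul, map_mul, hkc, inner_neg_left]
    rw [AddChar.map_neg_eq_inv, Circle.coe_inv_eq_conj, Complex.conj_conj]
  have hG : (𝓕⁻ F : L2C n) =ᵐ[volume] 𝓕⁻ k := fourierInv_toLp_ae h1 h2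
  refine ⟨Complex.reCLM.compLp (𝓕⁻ F : L2C n), ?_⟩
  have e : toC (Complex.reCLM.compLp (𝓕⁻ F : L2C n)) = 𝓕⁻ F := by
    refine Lp.ext ?_
    filter_upwards [coeFn_toC (Complex.reCLM.compLp (𝓕⁻ F : L2C n)),
      Complex.reCLM.coeFn_compLp (𝓕⁻ F : L2C n), hG] with x e1 e2 e3
    rw [e1, e2, e3]; exact hreal x
  rw [fourierL2_eq, e, FourierTransform.fourier_fourierInv_eq]
  exact h2.coeFn_toLp

/-- A lower bound for the constant of `J^{-1}∂_{x_j}`, from frequencies concentrated near the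
`j`-th axis. (The constant equals `1`.) -/
theorem le_derivBesselConst [NeZero n] (hn : 2 ≤ n) : 5 / 6 ≤ derivBesselConst n := by
  have hpi := Real.pi_gt_three
  obtain ⟨j, hj⟩ : ∃ j : Fin n, j ≠ 0 := by
    have : Nontrivial (Fin n) := Fin.nontrivial_iff_two_le.2 hn
    exact exists_ne 0
  set m : Fin n → E n → ℂ := fun j ξ => 2 * Real.pi * Complex.I * (ξ j : ℂ) * ((bracket ξ)⁻¹ : ℝ)
  have hmn : ∀ j ξ, ‖m j ξ‖ = 2 * Real.pi * |ξ j| / bracket ξ := fun j ξ => by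
    simp only [m, norm_mul, Complex.norm_real, Complex.norm_I, Real.norm_eq_abs, Complex.norm_ofNat,
      abs_of_pos Real.pi_pos, abs_of_pos (inv_pos.2 (bracket_pos ξ))]
    rw [mul_one, div_eq_mul_inv]
  set e : E n := basisVec j
  -- on the unit balls around `± 10 e_j`, the symbol `2π|ξ_j| / ⟨2πξ⟩` is at least `5 / 6`
  set A : Set (E n) := Metric.closedBall ((10:ℝ) • e) 1 ∪ Metric.closedBall (-((10:ℝ) • e)) 1 with hA
  have hAm : MeasurableSet A := measurableSet_closedBall.union measurableSet_closedBall
  have hAfin : volume A ≠ ⊤ :=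
    ((measure_union_le _ _).trans_lt (ENNReal.add_lt_top.2
      ⟨measure_closedBall_lt_top, measure_closedBall_lt_top⟩)).ne
  have hsymm : ∀ ξ, -ξ ∈ A ↔ ξ ∈ A := fun ξ => by
    simp only [hA, mem_union, mem_closedBall_iff_norm]
    rw [show -ξ - (10:ℝ) • e = -(ξ - -((10:ℝ) • e)) by abel, norm_neg,
      show -ξ - -((10:ℝ) • e) = -(ξ - (10:ℝ) • e) by abel, norm_neg, or_comm]
  obtain ⟨f, hf⟩ := exists_fourierL2_eq_indicator hAm hAfin hsymm
  have hApos : 0 < volume A :=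
    (Metric.measure_closedBall_pos volume ((10:ℝ) • e) one_pos).trans_le
      (measure_mono subset_union_left)
  have hf0 : f ≠ 0 := by
    rintro rfl
    have e1 : fourierL2 (0 : L2 n) = 0 := by
      rw [← norm_eq_zero, norm_fourierL2, norm_zero]
    rw [e1] at hf
    have e2 : ∀ᵐ ξ ∂(volume : Measure (E n)), ξ ∉ A := by
      filter_upwards [hf, Lp.coeFn_zero ℂ 2 (volume : Measure (E n))] with ξ h1 h2 hξ
      rw [h2, Set.indicator_of_mem hξ] at h1
      exact zero_ne_one h1
    exact hApos.ne' (by simpa [ae_iff] using e2)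
  have hen : ∀ g : L2 n, ‖g‖ₑ = eLpNorm (fourierL2 g) 2 volume := fun g => by
    rw [← Lp.enorm_def, ← ofReal_norm, ← ofReal_norm, norm_fourierL2]
  set S : ℝ≥0∞ := ⨆ (j : Fin n) (_ : j ≠ 0) (f : L2 n) (_ : f ≠ 0),
    multiplierNorm (m j) f / ‖f‖ₑ with hS
  -- finiteness of the supremum, without which its real value would be `0`
  have hle : S ≤ 1 := by
    refine iSup_le fun j => iSup_le fun _ => iSup_le fun g => iSup_le fun _ => ?_
    refine ENNReal.div_le_of_le_mul ?_
    rw [one_mul, hen]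
    refine eLpNorm_mono fun ξ => ?_
    rw [norm_mul, hmn]
    refine mul_le_of_le_one_left (norm_nonneg _) ?_
    rw [div_le_one (bracket_pos ξ)]
    refine le_trans ?_ (two_pi_norm_le_bracket ξ)
    gcongr
    exact PiLp.norm_apply_le ξ j
  have hge : ENNReal.ofReal (5 / 6) ≤ S := by
    refine le_trans ?_ (le_iSup_of_le j (le_iSup_of_le hj (le_iSup_of_le f (le_iSup_of_le hf0 le_rfl))))
    rw [ENNReal.le_div_iff_mul_le (Or.inl (by simpa using hf0)) (Or.inl enorm_ne_top), hen]
    have key : eLpNorm (fourierL2 f) 2 volume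
        ≤ ENNReal.ofReal (6 / 5) * eLpNorm (fun ξ => m j ξ * fourierL2 f ξ) 2 volume := by
      refine eLpNorm_le_mul_eLpNorm_of_ae_le_mul ?_ 2
      filter_upwards [hf] with ξ hξ
      rw [norm_mul, hmn, hξ]
      by_cases hmem : ξ ∈ A
      · rw [Set.indicator_of_mem hmem, norm_one, mul_one, ← div_le_iff₀' (by norm_num),
          le_div_iff₀ (bracket_pos ξ)]
        have hco : 9 ≤ |ξ j| ∧ ‖ξ‖ ^ 2 ≤ ξ j ^ 2 + 1 := by
          have gen : ∀ t : ℝ, |t| = 10 → ‖ξ - t • e‖ ≤ 1 → 9 ≤ |ξ j| ∧ ‖ξ‖ ^ 2 ≤ ξ j ^ 2 + 1 := by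
            intro t ht h
            have e1 := PiLp.norm_apply_le (ξ - t • e) j
            have e2 : (ξ - t • e) j = ξ j - t := by simp [e, basisVec]
            rw [e2, Real.norm_eq_abs] at e1
            have e3 : inner ℝ ξ e = ξ j := by
              simp [e, basisVec, EuclideanSpace.inner_single_right]
            have e4 : ‖e‖ = 1 := by simp [e, basisVec]
            have e5 := norm_sub_sq_real ξ (t • e)
            rw [inner_smul_right, e3, norm_smul, e4, Real.norm_eq_abs, mul_one, sq_abs] at e5
            have e6 : ‖ξ - t • e‖ ^ 2 ≤ 1 := pow_le_one₀ (norm_nonneg _) h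
            refine ⟨?_, by nlinarith [sq_nonneg (ξ j - t)]⟩
            have e7 := abs_sub_abs_le_abs_sub t (ξ j)
            rw [abs_sub_comm] at e7
            linarith
          rcases hmem with h | h
          · exact gen 10 (by norm_num) (mem_closedBall_iff_norm.1 h)
          · refine gen (-10) (by norm_num) ?_
            rw [neg_smul]; exact mem_closedBall_iff_norm.1 h
        refine abs_le_of_sq_le_sq' ?_ (by positivity) |>.2
        rw [mul_pow, sq_bracket, mul_pow, mul_pow, mul_pow, sq_abs]
        have h81 : 81 ≤ ξ j ^ 2 := by rw [← sq_abs]; nlinarith [hco.1]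
        have hp2 : 9 ≤ Real.pi ^ 2 := by nlinarith
        have h5 : Real.pi ^ 2 * ‖ξ‖ ^ 2 ≤ Real.pi ^ 2 * (ξ j ^ 2 + 1) := by
          gcongr; exact hco.2
        have h6 : Real.pi ^ 2 * 81 ≤ Real.pi ^ 2 * ξ j ^ 2 := by gcongr
        norm_num
        nlinarith
      · rw [Set.indicator_of_notMem hmem, norm_zero]; simp
    calc ENNReal.ofReal (5 / 6) * eLpNorm (fourierL2 f) 2 volume
        ≤ ENNReal.ofReal (5 / 6) * (ENNReal.ofReal (6 / 5) *
          eLpNorm (fun ξ => m j ξ * fourierL2 f ξ) 2 volume) := by gcongr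
      _ = multiplierNorm (m j) f := by
          rw [← mul_assoc, ← ENNReal.ofReal_mul (by norm_num)]
          norm_num
          rfl
  have : derivBesselConst n = S.toReal := rfl
  rw [this, ← ENNReal.ofReal_le_iff_le_toReal (ne_top_of_le_ne_top ENNReal.one_ne_top hle)]
  exact hge

/-- In the admissible directions the symbol of the commutator is elliptic. -/
theorem exists_elliptic [NeZero n] (hn : 2 ≤ n) {α : ℝ} (h0 : 0 < α) (h2 : α < 2) {ν : E n}
    (hν : AdmissibleDirection α ν) :
    0 < ν 0 ∧ ∃ c₀ : ℝ, 0 < c₀ ∧ ∀ ξ : E n, c₀ * ‖ξ‖ ^ 2 ≤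
      inner ℝ (basisVec 0) ν * ‖ξ‖ ^ 2 + α * (inner ℝ (basisVec 0) ξ * inner ℝ ν ξ) := by
  set N := transverseNorm ν with hN
  have hN0 : 0 ≤ N := Real.sqrt_nonneg _
  -- The discriminant condition for the quadratic form `A x² + B |y|² + α x (ν̄·y)` below, with
  -- `A = (1 + α) ν₁` and `B = ν₁`. The bound on `|ν̄|` with the constant replaced by `5 / 6` gives
  -- `α |ν̄|² < (144 / 25) ν₁²`, and `144 α / 25 < 4 (1 + α)` for `α < 2`.
  have hmain : 0 < ν 0 ∧ α ^ 2 * N ^ 2 < 4 * (ν 0 * (1 + α)) * ν 0 := by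
    rcases hν with ⟨hp, hz⟩ | ⟨hp, -, ε, -, -, -, hlt⟩
    · refine ⟨hp, ?_⟩
      have : N = 0 := by
        rw [hN, transverseNorm, Finset.sum_eq_zero, Real.sqrt_zero]
        intro j hj
        rw [hz j (Finset.mem_filter.1 hj).2]; norm_num
      rw [this]; norm_num; positivity
    · refine ⟨hp, ?_⟩
      have h3 := hlt.trans_le (min_le_left _ _)
      have hB := le_derivBesselConst hn
      set D := derivBesselConst n
      have hn1 : (1 : ℝ) ≤ n - 1 := by
        have : (2 : ℝ) ≤ n := by exact_mod_cast hn
        linarith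
      have h4 : Real.sqrt α ≤ Real.sqrt (α * (n - 1)) :=
        Real.sqrt_le_sqrt (by nlinarith)
      have h5 : 0 < Real.sqrt α := Real.sqrt_pos.2 h0
      rw [lt_div_iff₀ (by positivity)] at h3
      have h6 : N * (5 / 6 * Real.sqrt α) < 2 * ν 0 := lt_of_le_of_lt (by gcongr) h3
      have h7 : (N * (5 / 6 * Real.sqrt α)) ^ 2 < (2 * ν 0) ^ 2 := by gcongr
      rw [mul_pow, mul_pow, Real.sq_sqrt h0.le] at h7
      nlinarith [mul_pos h0 (sq_pos_of_pos hp), mul_nonneg h0.le (sq_nonneg N), sq_nonneg N,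
        mul_lt_mul_of_pos_left h7 h0]
  obtain ⟨hp, hlt⟩ := hmain
  refine ⟨hp, ?_⟩
  set A := ν 0 * (1 + α) with hA
  set B := ν 0 with hB
  have hA0 : 0 < A := by positivity
  -- chosen so that the form remains nonnegative after subtraction of `c₀ |ξ|²`:
  -- `4 (A - c₀) (B - c₀) = α² |ν̄|² + 4 c₀²`
  set c₀ := (4 * A * B - α ^ 2 * N ^ 2) / (4 * (A + B)) with hc₀
  have hpos : 0 < c₀ := div_pos (by linarith) (by positivity)
  have hc4 : 4 * c₀ * (A + B) = 4 * A * B - α ^ 2 * N ^ 2 := by rw [hc₀]; field_simp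
  have hcA : c₀ < A := by
    by_contra hcon
    have := not_lt.1 hcon
    nlinarith [mul_nonneg (sq_nonneg α) (sq_nonneg N), mul_pos hA0 hA0, mul_le_mul_of_nonneg_right this (by positivity : 0 ≤ A + B)]
  refine ⟨c₀, hpos, fun ξ => ?_⟩
  have e1 : inner ℝ (basisVec 0) ν = B := by
    simp [basisVec, EuclideanSpace.inner_single_left, hB]
  have e2 : inner ℝ (basisVec 0) ξ = ξ 0 := by
    simp [basisVec, EuclideanSpace.inner_single_left]
  set T := Finset.univ.filter (fun j : Fin n => j ≠ 0) with hT
  have e3 : inner ℝ ν ξ = B * ξ 0 + ∑ j ∈ T, ν j * ξ j := by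
    rw [PiLp.inner_apply, ← Finset.add_sum_erase _ _ (Finset.mem_univ (0 : Fin n))]
    have : Finset.univ.erase (0 : Fin n) = T := by ext j; simp [hT]
    rw [this]
    simp [mul_comm, hB]
  have e4 : ‖ξ‖ ^ 2 = ξ 0 ^ 2 + ∑ j ∈ T, ξ j ^ 2 := by
    rw [EuclideanSpace.norm_sq_eq, ← Finset.add_sum_erase _ _ (Finset.mem_univ (0 : Fin n))]
    have : Finset.univ.erase (0 : Fin n) = T := by ext j; simp [hT]
    rw [this]; simp
  set S := ∑ j ∈ T, ν j * ξ j
  set R2 := ∑ j ∈ T, ξ j ^ 2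
  have hR2 : 0 ≤ R2 := Finset.sum_nonneg fun j _ => sq_nonneg _
  have hCS : S ^ 2 ≤ N ^ 2 * R2 := by
    rw [hN, transverseNorm, Real.sq_sqrt (Finset.sum_nonneg fun j _ => sq_nonneg _)]
    exact Finset.sum_mul_sq_le_sq_mul_sq _ _ _
  rw [e1, e2, e3, e4]
  set x := ξ 0
  have hquad : 0 ≤ 4 * (A - c₀) * ((A - c₀) * x ^ 2 + (B - c₀) * R2 + α * x * S) := by
    have h5 : α ^ 2 * S ^ 2 ≤ α ^ 2 * (N ^ 2 * R2) := by gcongr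
    have h6 : 0 ≤ (2 * (A - c₀) * x + α * S) ^ 2 := sq_nonneg _
    have h7 : 0 ≤ 4 * c₀ ^ 2 * R2 := by positivity
    have h8 : 4 * (A - c₀) * (B - c₀) = α ^ 2 * N ^ 2 + 4 * c₀ ^ 2 := by linarith
    have h9 : 4 * (A - c₀) * (B - c₀) * R2 = (α ^ 2 * N ^ 2 + 4 * c₀ ^ 2) * R2 := by rw [h8]
    nlinarith
  have h10 := nonneg_of_mul_nonneg_right hquad (by linarith : 0 < 4 * (A - c₀))
  have h11 : A * x ^ 2 = B * x ^ 2 + α * B * x ^ 2 := by rw [hA]; ring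
  nlinarith

/-! ### First-order terms with a Lipschitz coefficient -/

theorem ang_smul_right (ξ : E n) (t : ℝ) (e : E n) : ang ξ (t • e) = t * ang ξ e := by
  unfold ang; rw [inner_smul_right]; ring

theorem ang_add_left (ξ η e : E n) : ang (ξ + η) e = ang ξ e + ang η e := by
  unfold ang; rw [inner_add_left]; ring

theorem abs_ang_le_bracket (ξ : E n) {e : E n} (he : ‖e‖ ≤ 1) : |ang ξ e| ≤ bracket ξ := by
  refine le_trans ?_ (two_pi_norm_le_bracket ξ)
  unfold ang
  rw [abs_mul, abs_of_pos (by positivity : 0 < 2 * Real.pi)]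
  have := (abs_real_inner_le_norm ξ e).trans (mul_le_of_le_one_right (norm_nonneg _) he)
  gcongr

/-- `Re ⟨b v, ∂_e v⟩` is bounded without derivatives of `v`, for a Lipschitz real function `b`
(the limit of the same fact for symmetric difference quotients). -/
theorem abs_re_inner_rmul_deriv_le {b : E n → ℝ} {C L : ℝ} (hb : BddReal b C)
    (hL : ∀ x z, |b (x + z) - b x| ≤ L * ‖z‖) (e : E n) (v : L2C n)
    (hv : MemLp (fun ξ => (ang ξ e : ℂ) * (𝓕 v : L2C n) ξ) 2 volume) :
    |(∫ ξ, starRingEnd ℂ ((𝓕 (rmul b v) : L2C n) ξ) *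
      (Complex.I * (ang ξ e : ℂ) * (𝓕 v : L2C n) ξ)).re| ≤ L / 2 * ‖e‖ * ‖v‖ ^ 2 := by
  set G : L2C n := 𝓕 (rmul b v) with hG
  -- the steps of the difference quotients
  set t : ℕ → ℝ := fun k => 1 / ((k : ℝ) + 1) with ht
  have htpos : ∀ k, 0 < t k := fun k => by positivity
  have ht0 : Tendsto t atTop (𝓝[≠] 0) := by
    refine tendsto_nhdsWithin_iff.2 ⟨tendsto_one_div_add_atTop_nhds_zero_nat, ?_⟩
    exact Eventually.of_forall fun k => (htpos k).ne'
  set F : ℕ → E n → ℂ := fun k ξ => starRingEnd ℂ (G ξ) *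
    (Complex.I * (Real.sin (ang ξ (t k • e)) : ℂ) * (𝓕 v : L2C n) ξ) * ((t k)⁻¹ : ℝ) with hF
  have hdom : Integrable (fun ξ => ‖G ξ‖ * ‖(hv.toLp _) ξ‖) := integrable_norm_mul_norm G (hv.toLp _)
  have hlim : Tendsto (fun k => ∫ ξ, F k ξ) atTop (𝓝 (∫ ξ, starRingEnd ℂ (G ξ) *
      (Complex.I * (ang ξ e : ℂ) * (𝓕 v : L2C n) ξ))) := by
    refine tendsto_integral_of_dominated_convergence (fun ξ => ‖G ξ‖ * ‖(hv.toLp _) ξ‖) ?_ hdom ?_ ?_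
    · exact fun k => ((integral_sin_ang (rmul b v) v (t k • e)).1.mul_const _).aestronglyMeasurable
    · intro k
      filter_upwards [hv.coeFn_toLp] with ξ hξ
      rw [hξ]
      simp only [hF, norm_mul, RCLike.norm_conj, Complex.norm_I, one_mul, Complex.norm_real,
        Real.norm_eq_abs, abs_of_pos (inv_pos.2 (htpos k))]
      have h1 : |Real.sin (ang ξ (t k • e))| ≤ t k * |ang ξ e| := by
        refine (Real.abs_sin_le_abs).trans (le_of_eq ?_)
        rw [ang_smul_right, abs_mul, abs_of_pos (htpos k)]
      calc ‖G ξ‖ * (|Real.sin (ang ξ (t k • e))| * ‖(𝓕 v : L2C n) ξ‖) * (t k)⁻¹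
          ≤ ‖G ξ‖ * ((t k * |ang ξ e|) * ‖(𝓕 v : L2C n) ξ‖) * (t k)⁻¹ := by
            have := (htpos k).le
            gcongr
        _ = _ := by field_simp [(htpos k).ne']
    · refine Eventually.of_forall fun ξ => ?_
      have h1 : Tendsto (fun s : ℝ => Real.sin (s * ang ξ e) * s⁻¹) (𝓝[≠] 0) (𝓝 (ang ξ e)) := by
        have h2 : HasDerivAt (fun s : ℝ => Real.sin (s * ang ξ e)) (ang ξ e) 0 := by
          have := ((hasDerivAt_id (0 : ℝ)).mul_const (ang ξ e)).sin
          simpa using this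
        refine (hasDerivAt_iff_tendsto_slope.1 h2).congr fun s => ?_
        simp [slope, mul_comm]
      have h3 := (Complex.continuous_ofReal.tendsto _).comp (h1.comp ht0)
      have h4 := ((h3.const_mul Complex.I).mul_const ((𝓕 v : L2C n) ξ)).const_mul
        (starRingEnd ℂ (G ξ))
      refine h4.congr fun k => ?_
      simp only [hF, Function.comp_apply, ang_smul_right]
      push_cast; ring
  have hlim2 := (Complex.continuous_re.tendsto _).comp hlim
  refine le_of_tendsto hlim2.abs (Eventually.of_forall fun k => ?_)
  simp only [Function.comp_apply, hF]
  rw [integral_mul_const, (integral_sin_ang (rmul b v) v (t k • e)).2, Complex.re_mul_ofReal,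
    show ((inner ℂ (rmul b v) (tr (t k • e) v) - inner ℂ (rmul b v) (tr (-(t k • e)) v)) / 2).re
      = (inner ℂ (rmul b v) (tr (t k • e) v) - inner ℂ (rmul b v) (tr (-(t k • e)) v)).re / 2 by
      simp, re_inner_rmul_tr_sub hb]
  have h5 : BddReal (fun x => b (x + t k • e) - b x) (L * ‖t k • e‖) :=
    ⟨(hb.1.comp (measurable_add_const _)).sub hb.1, fun x => hL _ _⟩
  have h6 := abs_corr_le h5 v (t k • e)
  rw [abs_mul, abs_div, abs_neg, abs_of_pos (inv_pos.2 (htpos k)), abs_two]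
  rw [norm_smul, Real.norm_eq_abs, abs_of_pos (htpos k)] at h6
  calc |corr (fun x => b (x + t k • e) - b x) v (t k • e)| / 2 * (t k)⁻¹
      ≤ (L * (t k * ‖e‖) * ‖v‖ ^ 2) / 2 * (t k)⁻¹ := by
        have := (htpos k).le
        gcongr
    _ = L / 2 * ‖e‖ * ‖v‖ ^ 2 := by field_simp [(htpos k).ne']

/-! ### Products and convolutions -/

theorem measurePreserving_prod_sub : MeasurePreserving (fun q : E n × E n => (q.1, q.1 - q.2))
    ((volume : Measure (E n)).prod volume) ((volume : Measure (E n)).prod volume) := by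
  have h1 := measurePreserving_prod_add (volume : Measure (E n)) (volume : Measure (E n))
  have h2 : MeasurePreserving (fun q : E n × E n => (q.1, -q.2))
      ((volume : Measure (E n)).prod volume) ((volume : Measure (E n)).prod volume) :=
    (MeasurePreserving.id _).prod (Measure.measurePreserving_neg volume)
  have h3 := h1.comp h2
  have h4 : (fun q : E n × E n => (q.1, q.1 - q.2))
      = (fun z : E n × E n => (z.1, z.1 + z.2)) ∘ fun q => (q.1, -q.2) := by
    funext q; simp [sub_eq_add_neg]
  rw [h4]; exact h3

theorem quasiMeasurePreserving_prod_sub :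
    Measure.QuasiMeasurePreserving (fun q : E n × E n => q.1 - q.2)
      ((volume : Measure (E n)).prod volume) volume :=
  Measure.quasiMeasurePreserving_snd.comp measurePreserving_prod_sub.quasiMeasurePreserving

theorem fourierInv_eq_integral_chr (p : E n → ℂ) (x : E n) :
    𝓕⁻ p x = ∫ ζ, chr ζ x * p ζ := by
  rw [Real.fourierInv_eq]
  refine integral_congr_ae (Eventually.of_forall fun ζ => ?_)
  simp only [Circle.smul_def, smul_eq_mul, chr_eq_fourierChar]
  rw [real_inner_comm]

theorem integrable_chr_mul {p : E n → ℂ} (hp : Integrable p) (x : E n) :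
    Integrable fun ζ => chr ζ x * p ζ := by
  refine hp.bdd_mul (c := 1) ?_ (Eventually.of_forall fun ζ => (norm_chr ζ x).le)
  exact (continuous_chr.comp (by fun_prop : Continuous fun ζ : E n => (ζ, x))).aestronglyMeasurable

theorem bddMeas_fourierInv {p : E n → ℂ} (hp : Integrable p) : BddMeas (𝓕⁻ p) (∫ ζ, ‖p ζ‖) := by
  refine ⟨Continuous.measurable ?_, fun x => ?_⟩
  · simp_rw [funext (fourierInv_eq_integral_chr p)]
    refine continuous_of_dominated (bound := fun ζ => ‖p ζ‖)
      (fun x => (integrable_chr_mul hp x).aestronglyMeasurable)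
      (fun x => Eventually.of_forall fun ζ => by rw [norm_mul, norm_chr, one_mul]) hp.norm
      (Eventually.of_forall fun ζ => ?_)
    exact (continuous_chr.comp (by fun_prop : Continuous fun x : E n => (ζ, x))).mul continuous_const
  · rw [fourierInv_eq_integral_chr]
    refine (norm_integral_le_integral_norm _).trans (le_of_eq ?_)
    simp_rw [norm_mul, norm_chr, one_mul]

theorem norm_chr_sub_le (ζ x y : E n) : ‖chr ζ x - chr ζ y‖ ≤ 2 * Real.pi * ‖ζ‖ * ‖x - y‖ := by
  have h1 : chr ζ x - chr ζ y = chr ζ y * (Complex.exp (Complex.I * (ang (x - y) ζ : ℝ)) - 1) := by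
    rw [chr_eq_exp_ang, chr_eq_exp_ang, mul_sub, mul_one, ← Complex.exp_add]
    congr 2
    unfold ang; rw [inner_sub_left]; push_cast; ring
  rw [h1, norm_mul, norm_chr, one_mul]
  refine (Real.norm_exp_I_mul_ofReal_sub_one_le).trans ?_
  rw [Real.norm_eq_abs, ang, abs_mul, abs_of_pos (by positivity : 0 < 2 * Real.pi),
    mul_assoc (2 * Real.pi), mul_comm ‖ζ‖]
  have := abs_real_inner_le_norm (x - y) ζ
  gcongr

theorem norm_fourierInv_sub_le {p : E n → ℂ} (hp : Integrable p)
    (hp' : Integrable fun ζ => bracket ζ * ‖p ζ‖) (x y : E n) :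
    ‖𝓕⁻ p x - 𝓕⁻ p y‖ ≤ (∫ ζ, bracket ζ * ‖p ζ‖) * ‖x - y‖ := by
  rw [fourierInv_eq_integral_chr, fourierInv_eq_integral_chr,
    ← integral_sub (integrable_chr_mul hp x) (integrable_chr_mul hp y), ← integral_mul_const]
  refine norm_integral_le_of_norm_le (hp'.mul_const _) (Eventually.of_forall fun ζ => ?_)
  rw [← sub_mul, norm_mul]
  have h1 := norm_chr_sub_le ζ x y
  have h2 := two_pi_norm_le_bracket ζ
  calc ‖chr ζ x - chr ζ y‖ * ‖p ζ‖ ≤ (bracket ζ * ‖x - y‖) * ‖p ζ‖ := by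
        gcongr
        exact h1.trans (by gcongr)
    _ = _ := by ring

/-- Young's inequality for the trilinear form `∫∫ G(ξ) p(ζ) F(ξ - ζ)`. -/
theorem integral_young (G F : L2C n) {p : E n → ℂ} (hp : Integrable p) :
    Integrable (fun q : E n × E n => ‖G q.1‖ * (‖p q.2‖ * ‖F (q.1 - q.2)‖))
      ((volume : Measure (E n)).prod volume) ∧
    ∫ q : E n × E n, ‖G q.1‖ * (‖p q.2‖ * ‖F (q.1 - q.2)‖) ∂((volume : Measure (E n)).prod volume)
      ≤ (∫ ζ, ‖p ζ‖) * (‖G‖ * ‖F‖) := by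
  have hm : AEStronglyMeasurable (fun q : E n × E n => ‖G q.1‖ * (‖p q.2‖ * ‖F (q.1 - q.2)‖))
      ((volume : Measure (E n)).prod volume) :=
    (Lp.aestronglyMeasurable G).comp_fst.norm.mul (hp.aestronglyMeasurable.comp_snd.norm.mul
      ((Lp.aestronglyMeasurable F).comp_quasiMeasurePreserving
        quasiMeasurePreserving_prod_sub).norm)
  have hcongr : ∀ ζ : E n, (fun ξ => ‖G ξ‖ * (‖p ζ‖ * ‖F (ξ - ζ)‖))
      =ᵐ[volume] fun ξ => ‖p ζ‖ * (‖G ξ‖ * ‖(tr (-ζ) F) ξ‖) := fun ζ => by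
    filter_upwards [coeFn_tr (-ζ) F] with ξ h
    rw [h, ← sub_eq_add_neg]; ring
  have hle : ∀ ζ : E n, ∫ ξ, ‖G ξ‖ * (‖p ζ‖ * ‖F (ξ - ζ)‖) ≤ ‖p ζ‖ * (‖G‖ * ‖F‖) := fun ζ => by
    rw [integral_congr_ae (hcongr ζ), integral_const_mul]
    have := integral_norm_mul_norm_le G (tr (-ζ) F)
    rw [norm_tr] at this
    gcongr
  have hint : Integrable (fun q : E n × E n => ‖G q.1‖ * (‖p q.2‖ * ‖F (q.1 - q.2)‖))
      ((volume : Measure (E n)).prod volume) := by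
    rw [integrable_prod_iff' hm]
    refine ⟨Eventually.of_forall fun ζ =>
      ((integrable_norm_mul_norm G (tr (-ζ) F)).const_mul ‖p ζ‖).congr (hcongr ζ).symm, ?_⟩
    refine (hp.norm.mul_const (‖G‖ * ‖F‖)).mono' hm.norm.prod_swap.integral_prod_right' ?_
    refine Eventually.of_forall fun ζ => ?_
    rw [Real.norm_of_nonneg (integral_nonneg fun _ => norm_nonneg _)]
    refine le_trans (le_of_eq ?_) (hle ζ)
    refine integral_congr_ae (Eventually.of_forall fun ξ => ?_)
    simp
  refine ⟨hint, ?_⟩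
  rw [integral_prod_symm _ hint, ← integral_mul_const]
  exact integral_mono hint.integral_prod_right (hp.norm.mul_const _) hle

theorem integrable_young (G F : L2C n) {p : E n → ℂ} (hp : Integrable p) :
    Integrable (fun q : E n × E n => starRingEnd ℂ (G q.1) * (p q.2 * F (q.1 - q.2)))
      ((volume : Measure (E n)).prod volume) := by
  refine (integral_young G F hp).1.mono' ?_ (Eventually.of_forall fun q => by simp)
  exact (Complex.continuous_conj.comp_aestronglyMeasurable
    (Lp.aestronglyMeasurable G).comp_fst).mul (hp.aestronglyMeasurable.comp_snd.mul
      ((Lp.aestronglyMeasurable F).comp_quasiMeasurePreserving quasiMeasurePreserving_prod_sub))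

/-- The Fourier transform of the product of `𝓕⁻ p`, `p ∈ L¹`, with an `L²` function is a
convolution. -/
theorem inner_fourier_mulOp_fourierInv (G F : L2C n) {p : E n → ℂ} (hp : Integrable p) :
    inner ℂ G (𝓕 (mulOp (𝓕⁻ p) (𝓕⁻ F)) : L2C n)
      = ∫ q : E n × E n, starRingEnd ℂ (G q.1) * (p q.2 * F (q.1 - q.2))
        ∂((volume : Measure (E n)).prod volume) := by
  set g : L2C n := 𝓕⁻ G with hg
  set f : L2C n := 𝓕⁻ F with hf
  have hGg : G = 𝓕 g := by rw [hg, FourierTransform.fourier_fourierInv_eq]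
  have hFf : F = 𝓕 f := by rw [hf, FourierTransform.fourier_fourierInv_eq]
  have hprod : Integrable (fun q : E n × E n => p q.1 * (starRingEnd ℂ (g q.2) * (chr q.1 q.2 * f q.2)))
      ((volume : Measure (E n)).prod volume) := by
    refine (hp.norm.mul_prod (integrable_norm_mul_norm g f)).mono' ?_
      (Eventually.of_forall fun q => by simp [norm_chr])
    exact hp.aestronglyMeasurable.comp_fst.mul ((Complex.continuous_conj.comp_aestronglyMeasurable
      (Lp.aestronglyMeasurable g).comp_snd).mul
      (continuous_chr.aestronglyMeasurable.mul (Lp.aestronglyMeasurable f).comp_snd))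
  rw [integral_prod_symm _ (integrable_young G F hp)]
  have h1 : ∀ ζ, ∫ ξ, starRingEnd ℂ (G ξ) * (p ζ * F (ξ - ζ))
      = ∫ x, p ζ * (starRingEnd ℂ (g x) * (chr ζ x * f x)) := fun ζ => by
    rw [integral_const_mul]
    have e1 : ∫ x, starRingEnd ℂ (g x) * (chr ζ x * f x) = inner ℂ g (mulOp (chr ζ) f) := by
      rw [inner_eq_integral]
      refine integral_congr_ae ?_
      filter_upwards [(bddMeas_chr ζ).coeFn f] with x hx
      rw [hx]
    rw [e1, ← inner_fourier, fourier_modulation, ← hGg, ← hFf, inner_eq_integral,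
      ← integral_const_mul]
    refine integral_congr_ae ?_
    filter_upwards [coeFn_tr (-ζ) F] with ξ h
    rw [h, ← sub_eq_add_neg]; ring
  simp_rw [h1]
  rw [integral_integral_swap hprod, hGg, inner_fourier, inner_eq_integral]
  refine integral_congr_ae ?_
  filter_upwards [(bddMeas_fourierInv hp).coeFn f] with x hx
  rw [hx, fourierInv_eq_integral_chr, ← integral_mul_const, ← integral_const_mul]
  refine integral_congr_ae (Eventually.of_forall fun ζ => ?_)
  simp only; ring

/-! ### The transport term -/

theorem rpow_neg_bracket_le {s : ℝ} (hs : 0 ≤ s) (ξ : E n) : bracket ξ ^ (-s) ≤ 1 :=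
  Real.rpow_le_one_of_one_le_of_nonpos (one_le_bracket ξ) (by linarith)

theorem bddMeas_rpow_neg_bracket {s : ℝ} (hs : 0 ≤ s) :
    BddMeas (fun ξ : E n => ((bracket ξ ^ (-s) : ℝ) : ℂ)) 1 :=
  ⟨by fun_prop, fun ξ => by
    rw [Complex.norm_real, Real.norm_of_nonneg (Real.rpow_nonneg (bracket_pos ξ).le _)]
    exact rpow_neg_bracket_le hs ξ⟩

theorem BddMeas.inner_right {m : E n → ℂ} {C : ℝ} (hm : BddMeas m C) (f g : L2C n) :
    inner ℂ f (mulOp m g) = inner ℂ (mulOp (fun x => starRingEnd ℂ (m x)) f) g := by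
  rw [hm.conj.inner_left]
  simp only [Complex.conj_conj]

theorem BddReal.inner_rmul_left {b : E n → ℝ} {C : ℝ} (hb : BddReal b C) (f g : L2C n) :
    inner ℂ (rmul b f) g = inner ℂ f (rmul b g) := by
  rw [hb.bddMeas.inner_left]
  simp only [Complex.conj_ofReal]

theorem integral_comp_prod_sub {F : Type*} [NormedAddCommGroup F] [NormedSpace ℝ F]
    {f : E n × E n → F} (hf : AEStronglyMeasurable f ((volume : Measure (E n)).prod volume)) :
    ∫ q : E n × E n, f (q.1, q.1 - q.2) ∂((volume : Measure (E n)).prod volume)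
      = ∫ q, f q ∂((volume : Measure (E n)).prod volume) := by
  have h := integral_map (μ := (volume : Measure (E n)).prod volume)
    (φ := fun q : E n × E n => (q.1, q.1 - q.2)) (f := f) (by fun_prop)
    (by rw [measurePreserving_prod_sub.map_eq]; exact hf)
  rw [measurePreserving_prod_sub.map_eq] at h
  exact h.symm

theorem integrable_comp_prod_sub {F : Type*} [NormedAddCommGroup F]
    {f : E n × E n → F} (hf : Integrable f ((volume : Measure (E n)).prod volume)) :
    Integrable (fun q : E n × E n => f (q.1, q.1 - q.2)) ((volume : Measure (E n)).prod volume) :=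
  measurePreserving_prod_sub.integrable_comp_of_integrable hf

/-- The symbol `a` behaves like `⟨2πξ⟩^s` as far as the commutator with multiplication is
concerned, with constant `C`. -/
structure CommSymbol (s : ℝ) (a : E n → ℝ) (C : ℝ) : Prop where
  measurable : Measurable a
  le : ∀ ξ, |a ξ| ≤ C * bracket ξ ^ s
  comm : ∀ ζ η, |a (ζ + η) - a η| * ‖η‖ ≤ C * (‖ζ‖ * bracket η ^ s + bracket ζ ^ s * ‖η‖)
  bdd : ∃ B, ∀ ξ, |a ξ| * bracket ξ ≤ B

/-- The energy contribution of the transport term `u ∂_e u = ½ ∂_e(u²)`, where `V = ⟨2πξ⟩^s û`, is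
bounded by `‖⟨2πξ⟩ û‖_{L¹} ‖V‖²`: after symmetrisation, the commutator of the symbol with `u` is
bounded by Young's inequality, and what remains is a transport term with a Lipschitz
coefficient. -/
theorem abs_re_inner_transport_le {s : ℝ} (hs : 1 ≤ s) {e : E n} (he : ‖e‖ ≤ 1) {a : E n → ℝ}
    {Ca : ℝ} (ha : CommSymbol s a Ca) {φ : E n → ℝ} {C L : ℝ} (hφ : BddReal φ C)
    (hL0 : 0 ≤ L) (hL : ∀ x z, |φ (x + z) - φ x| ≤ L * ‖z‖) (V : L2C n) {U : L2C n}
    (hU : U = mulOp (fun ξ => ((bracket ξ ^ (-s) : ℝ) : ℂ)) V)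
    (h1 : Integrable fun ζ => bracket ζ * ‖U ζ‖)
    (hreal : ∀ x, (((𝓕⁻ (U : E n → ℂ)) x).re : ℂ) = (𝓕⁻ (U : E n → ℂ)) x)
    {v : L2C n} (hv : 𝓕 v = mulOp (fun ξ => (a ξ : ℂ)) U) :
    |(inner ℂ (𝓕 (rmul φ v) : L2C n) (mulOp (fun ξ => Complex.I * (ang ξ e : ℂ) / 2 * (a ξ : ℂ))
      (𝓕 (mulOp (𝓕⁻ (U : E n → ℂ)) (𝓕⁻ U)) : L2C n))).re|
      ≤ Ca ^ 2 * (3 * C + L) * (∫ ζ, bracket ζ * ‖U ζ‖) * ‖V‖ ^ 2 := by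
  obtain ⟨B, hB⟩ := ha.bdd
  set N := ∫ ζ, bracket ζ * ‖U ζ‖ with hN
  have hN0 : 0 ≤ N := integral_nonneg fun ζ => mul_nonneg (bracket_pos ζ).le (norm_nonneg _)
  have hCa : 0 ≤ Ca := by
    have := (abs_nonneg _).trans (ha.le 0)
    exact nonneg_of_mul_nonneg_left this (Real.rpow_pos_of_pos (bracket_pos 0) _)
  have hC := hφ.nonneg
  have hb0 : ∀ ξ : E n, 0 < bracket ξ := bracket_pos
  set G : L2C n := 𝓕 (rmul φ v) with hG
  set w : E n → ℝ := fun ξ => ang ξ e with hw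
  have hwm : Measurable w := by fun_prop
  have hwle : ∀ ξ, |w ξ| ≤ bracket ξ := fun ξ => abs_ang_le_bracket ξ he
  have ham := ha.measurable
  have hUae : U =ᵐ[volume] fun ξ => ((bracket ξ ^ (-s) : ℝ) : ℂ) * V ξ := by
    rw [hU]; exact (bddMeas_rpow_neg_bracket (by linarith)).coeFn V
  have hUV : ∀ᵐ ξ, V ξ = ((bracket ξ ^ s : ℝ) : ℂ) * U ξ := by
    filter_upwards [hUae] with ξ h
    rw [h, ← mul_assoc, ← Complex.ofReal_mul, ← Real.rpow_add (hb0 ξ)]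
    simp
  have hpU : Integrable (fun ζ => U ζ) := by
    refine h1.mono' (Lp.aestronglyMeasurable U) (Eventually.of_forall fun ζ => ?_)
    exact le_mul_of_one_le_left (norm_nonneg _) (one_le_bracket ζ)
  have hpw : Integrable (fun ζ => (w ζ : ℂ) * U ζ) := by
    refine h1.mono' ((Complex.measurable_ofReal.comp hwm).aestronglyMeasurable.mul
      (Lp.aestronglyMeasurable U)) (Eventually.of_forall fun ζ => ?_)
    rw [norm_mul, Complex.norm_real]
    exact mul_le_mul_of_nonneg_right (hwle ζ) (norm_nonneg _)
  have hpb : Integrable (fun ζ => (bracket ζ : ℂ) * U ζ) := by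
    refine h1.mono' ((Complex.measurable_ofReal.comp measurable_bracket).aestronglyMeasurable.mul
      (Lp.aestronglyMeasurable U)) (Eventually.of_forall fun ζ => ?_)
    rw [norm_mul, Complex.norm_real, Real.norm_of_nonneg (hb0 ζ).le]
  have hNb : ∫ ζ, ‖(bracket ζ : ℂ) * U ζ‖ = N := by
    refine integral_congr_ae (Eventually.of_forall fun ζ => ?_)
    simp only [norm_mul, Complex.norm_real, Real.norm_of_nonneg (hb0 ζ).le]
  have hNU : ∫ ζ, ‖U ζ‖ ≤ N := integral_mono hpU.norm h1
    fun ζ => le_mul_of_one_le_left (norm_nonneg _) (one_le_bracket ζ)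
  -- the bounded symbols in play
  have hB0 : 0 ≤ B := (mul_nonneg (abs_nonneg _) (hb0 0).le).trans (hB 0)
  have hbs : ∀ ξ : E n, bracket ξ * bracket ξ ^ (-s) ≤ 1 := fun ξ => by
    calc bracket ξ * bracket ξ ^ (-s) ≤ bracket ξ * bracket ξ ^ (-1 : ℝ) := by
          have := hb0 ξ
          have := Real.rpow_le_rpow_of_exponent_le (one_le_bracket ξ) (by linarith : -s ≤ -1)
          gcongr
      _ = 1 := by rw [Real.rpow_neg_one, mul_inv_cancel₀ (hb0 ξ).ne']
  have hm1 : BddMeas (fun ξ => Complex.I * (w ξ : ℂ) / 2 * (a ξ : ℂ)) B := by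
    refine ⟨by fun_prop, fun ξ => ?_⟩
    simp only [norm_mul, norm_div, Complex.norm_I, Complex.norm_real, Real.norm_eq_abs, one_mul,
      Complex.norm_ofNat]
    have h3 := hwle ξ
    have h4 := hB ξ
    nlinarith [abs_nonneg (a ξ), abs_nonneg (w ξ), mul_le_mul_of_nonneg_left h3 (abs_nonneg (a ξ)),
      mul_nonneg (abs_nonneg (a ξ)) (abs_nonneg (w ξ))]
  have hm2 : BddMeas (fun ξ => starRingEnd ℂ (Complex.I * (a ξ : ℂ))) B := by
    refine BddMeas.conj ⟨by fun_prop, fun ξ => ?_⟩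
    simp only [norm_mul, Complex.norm_I, Complex.norm_real, Real.norm_eq_abs, one_mul]
    exact (le_mul_of_one_le_right (abs_nonneg _) (one_le_bracket ξ)).trans (hB ξ)
  have hm3 : BddMeas (fun ξ => (w ξ : ℂ) * ((bracket ξ ^ (-s) : ℝ) : ℂ)) 1 := by
    refine ⟨by fun_prop, fun ξ => ?_⟩
    simp only
    rw [← Complex.ofReal_mul, Complex.norm_real, Real.norm_eq_abs, abs_mul,
      abs_of_pos (Real.rpow_pos_of_pos (hb0 ξ) _)]
    exact (mul_le_mul_of_nonneg_right (hwle ξ) (Real.rpow_pos_of_pos (hb0 ξ) _).le).trans (hbs ξ)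
  have hma : BddMeas (fun ξ => (a ξ : ℂ)) B := by
    refine ⟨by fun_prop, fun ξ => ?_⟩
    simp only [Complex.norm_real, Real.norm_eq_abs]
    exact (le_mul_of_one_le_right (abs_nonneg _) (one_le_bracket ξ)).trans (hB ξ)
  have hm4 : BddMeas (fun ξ => Complex.I * (w ξ : ℂ) * (a ξ : ℂ)) B := by
    refine ⟨by fun_prop, fun ξ => ?_⟩
    simp only [norm_mul, Complex.norm_I, Complex.norm_real, Real.norm_eq_abs, one_mul]
    rw [mul_comm]
    exact (mul_le_mul_of_nonneg_left (hwle ξ) (abs_nonneg _)).trans (hB ξ)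
  set Ga := mulOp (fun ξ => starRingEnd ℂ (Complex.I * (a ξ : ℂ))) G with hGa
  set F₁ := mulOp (fun ξ => (w ξ : ℂ) * ((bracket ξ ^ (-s) : ℝ) : ℂ)) V with hF₁
  set F₀ := mulOp (fun ξ => Complex.I * (w ξ : ℂ) * (a ξ : ℂ)) U with hF₀
  have hF₁ae : F₁ =ᵐ[volume] fun ξ => (w ξ : ℂ) * U ξ := by
    filter_upwards [hm3.coeFn V, hUae] with ξ h2 h3
    rw [h2, h3]; ring
  set f₁ : E n × E n → ℂ := fun q => starRingEnd ℂ (Ga q.1) * ((w q.2 * U q.2) * U (q.1 - q.2))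
    with hf₁
  set f₂ : E n × E n → ℂ := fun q => starRingEnd ℂ (Ga q.1) * (U q.2 * F₁ (q.1 - q.2)) with hf₂
  have hi₁ := integrable_young Ga U hpw
  have hi₂ := integrable_young Ga F₁ hpU
  have qs := quasiMeasurePreserving_prod_sub (n := n)
  have q1 : Measure.QuasiMeasurePreserving (Prod.fst : E n × E n → E n)
    ((volume : Measure (E n)).prod volume) volume := Measure.quasiMeasurePreserving_fst
  have q2 : Measure.QuasiMeasurePreserving (Prod.snd : E n × E n → E n)
    ((volume : Measure (E n)).prod volume) volume := Measure.quasiMeasurePreserving_snd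
  have h12 : ∫ q, f₁ q ∂((volume : Measure (E n)).prod volume)
      = ∫ q, f₂ q ∂((volume : Measure (E n)).prod volume) := by
    rw [← integral_comp_prod_sub hi₁.aestronglyMeasurable]
    refine integral_congr_ae ?_
    filter_upwards [qs.ae hF₁ae] with q hq
    simp only [hf₂, hq, sub_sub_cancel]; ring
  -- symmetrisation
  have hT : inner ℂ G (mulOp (fun ξ => Complex.I * (w ξ : ℂ) / 2 * (a ξ : ℂ))
      (𝓕 (mulOp (𝓕⁻ (U : E n → ℂ)) (𝓕⁻ U)) : L2C n))
      = ∫ q, f₂ q ∂((volume : Measure (E n)).prod volume) := by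
    have hsum : ∫ q, (f₁ q + f₂ q) / 2 ∂((volume : Measure (E n)).prod volume)
        = ∫ q, f₂ q ∂((volume : Measure (E n)).prod volume) := by
      rw [integral_div, integral_add hi₁ hi₂, h12]; ring
    rw [hm1.inner_right, inner_fourier_mulOp_fourierInv _ _ hpU, ← hsum]
    refine integral_congr_ae ?_
    filter_upwards [qs.ae hF₁ae, q1.ae (hm1.conj.coeFn G), q1.ae (hm2.coeFn G)] with q e1 e2 e3
    have e4 : w q.1 = w q.2 + w (q.1 - q.2) := by
      simp only [hw]; rw [← ang_add_left, add_sub_cancel]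
    simp only [hf₁, hf₂, hGa]
    rw [e1, e2, e3]
    simp only [map_mul (starRingEnd ℂ) _ (G q.1), Complex.conj_conj, e4]
    push_cast; ring
  -- the transport term with the coefficient outside the symbol
  have hT0 : |(inner ℂ G (𝓕 (mulOp (𝓕⁻ (U : E n → ℂ)) (𝓕⁻ F₀)) : L2C n)).re|
      ≤ (C + L) * N / 2 * ‖v‖ ^ 2 := by
    set b : E n → ℝ := fun x => φ x * ((𝓕⁻ (U : E n → ℂ)) x).re with hb
    have hu := bddMeas_fourierInv hpU
    have hbb : BddReal b (C * N) := by
      refine ⟨hφ.1.mul (Complex.measurable_re.comp hu.1), fun x => ?_⟩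
      rw [hb, abs_mul]
      exact mul_le_mul (hφ.2 x) ((Complex.abs_re_le_norm _).trans ((hu.2 x).trans hNU))
        (abs_nonneg _) hC
    have hbL : ∀ x z, |b (x + z) - b x| ≤ ((C + L) * N) * ‖z‖ := fun x z => by
      set y := 𝓕⁻ (U : E n → ℂ)
      have e1 : b (x + z) - b x = φ (x + z) * (y (x + z) - y x).re
          + (φ (x + z) - φ x) * (y x).re := by
        simp only [hb, Complex.sub_re]; ring
      have e2 : |(y (x + z) - y x).re| ≤ N * ‖z‖ := by
        refine (Complex.abs_re_le_norm _).trans ?_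
        have := norm_fourierInv_sub_le hpU h1 (x + z) x
        rwa [add_sub_cancel_left] at this
      have e3 : |(y x).re| ≤ N := (Complex.abs_re_le_norm _).trans ((hu.2 x).trans hNU)
      rw [e1]
      refine (abs_add_le _ _).trans ?_
      rw [abs_mul, abs_mul]
      have hLz : 0 ≤ L * ‖z‖ := (abs_nonneg _).trans (hL x z)
      calc _ ≤ C * (N * ‖z‖) + L * ‖z‖ * N :=
            add_le_add (mul_le_mul (hφ.2 _) e2 (abs_nonneg _) hC)
              (mul_le_mul (hL x z) e3 (abs_nonneg _) hLz)
        _ = _ := by ring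
    have hvF : F₀ =ᵐ[volume] fun ξ => Complex.I * (w ξ : ℂ) * (𝓕 v : L2C n) ξ := by
      rw [hv]
      filter_upwards [hm4.coeFn U, hma.coeFn U] with ξ e1 e2
      rw [e1, e2]; ring
    have hvm : MemLp (fun ξ => (ang ξ e : ℂ) * (𝓕 v : L2C n) ξ) 2 volume := by
      refine (((Lp.memLp F₀).ae_eq hvF).const_mul (-Complex.I)).ae_eq
        (Eventually.of_forall fun ξ => ?_)
      have := Complex.I_mul_I
      simp only
      linear_combination (-(w ξ : ℂ) * (𝓕 v : L2C n) ξ) * this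
    have key := abs_re_inner_rmul_deriv_le hbb hbL e v hvm
    have e5 : inner ℂ G (𝓕 (mulOp (𝓕⁻ (U : E n → ℂ)) (𝓕⁻ F₀)) : L2C n)
        = ∫ ξ, starRingEnd ℂ ((𝓕 (rmul b v) : L2C n) ξ) *
          (Complex.I * (ang ξ e : ℂ) * (𝓕 v : L2C n) ξ) := by
      have e6 : mulOp (𝓕⁻ (U : E n → ℂ)) = rmul (fun x => ((𝓕⁻ (U : E n → ℂ)) x).re) := by
        unfold rmul; congr 1; funext x; exact (hreal x).symm
      have hur : BddReal (fun x => ((𝓕⁻ (U : E n → ℂ)) x).re) N :=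
        ⟨Complex.measurable_re.comp hu.1, fun x =>
          (Complex.abs_re_le_norm _).trans ((hu.2 x).trans hNU)⟩
      have e7 : rmul b v = rmul (fun x => ((𝓕⁻ (U : E n → ℂ)) x).re) (rmul φ v) := by
        unfold rmul
        rw [hur.bddMeas.mulOp_mulOp hφ.bddMeas]
        congr 1; funext x; simp only [hb]; push_cast; ring
      rw [hG, inner_fourier, e6, ← hur.inner_rmul_left, ← e7, ← inner_fourier,
        FourierTransform.fourier_fourierInv_eq, inner_eq_integral]
      refine integral_congr_ae ?_
      filter_upwards [hvF] with ξ e8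
      rw [e8]
    rw [e5]
    refine key.trans ?_
    have : (C + L) * N / 2 * ‖e‖ ≤ (C + L) * N / 2 := mul_le_of_le_one_right (by positivity) he
    gcongr
  -- the commutator
  have hF₀ae : F₀ =ᵐ[volume] fun ξ => Complex.I * (w ξ : ℂ) * (a ξ : ℂ) * U ξ := hm4.coeFn U
  set g₁ : E n × E n → ℝ := fun q => ‖G q.1‖ * (‖(bracket q.2 : ℂ) * U q.2‖ * ‖V (q.1 - q.2)‖)
    with hg₁
  obtain ⟨hgi, hgle⟩ := integral_young G V hpb
  rw [hNb] at hgle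
  have hcomm : ‖(∫ q, f₂ q ∂((volume : Measure (E n)).prod volume))
      - inner ℂ G (𝓕 (mulOp (𝓕⁻ (U : E n → ℂ)) (𝓕⁻ F₀)) : L2C n)‖ ≤ 2 * Ca * N * (‖G‖ * ‖V‖) := by
    rw [inner_fourier_mulOp_fourierInv _ _ hpU, ← integral_sub hi₂ (integrable_young G F₀ hpU)]
    have hgi2 := integrable_comp_prod_sub hgi
    calc _ ≤ ∫ q, Ca * (g₁ q + g₁ (q.1, q.1 - q.2)) ∂((volume : Measure (E n)).prod volume) := by
          refine norm_integral_le_of_norm_le ((hgi.add hgi2).const_mul Ca) ?_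
          filter_upwards [qs.ae hF₁ae, qs.ae hF₀ae, q1.ae (hm2.coeFn G), q2.ae hUV, qs.ae hUV]
            with q e1 e2 e3 e4 e5
          simp only [hg₁, hGa, sub_sub_cancel]
          rw [e1, e2, e3, e4, e5, map_mul, Complex.conj_conj]
          set ζ := q.2
          set η := q.1 - q.2 with hη
          have hq1 : q.1 = ζ + η := by rw [hη]; abel
          rw [hq1]
          have e6 : starRingEnd ℂ (G (ζ + η)) * (U ζ * (Complex.I * (w η : ℂ) * (a η : ℂ) * U η))
              = Complex.I * (a η : ℂ) * starRingEnd ℂ (G (ζ + η)) * (U ζ * ((w η : ℂ) * U η)) := by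
            ring
          rw [e6, ← sub_mul, ← sub_mul, ← mul_sub, ← Complex.ofReal_sub]
          simp only [norm_mul, Complex.norm_I, one_mul, Complex.norm_real, Real.norm_eq_abs,
            RCLike.norm_conj, abs_of_pos (hb0 _), abs_of_pos (Real.rpow_pos_of_pos (hb0 _) _)]
          have e7 : |w η| ≤ 2 * Real.pi * ‖η‖ := by
            simp only [hw, ang]
            rw [abs_mul, abs_of_pos (by positivity : 0 < 2 * Real.pi)]
            have := (abs_real_inner_le_norm η e).trans (mul_le_of_le_one_right (norm_nonneg _) he)
            gcongr
          have e8 := ha.comm ζ η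
          have e9 := two_pi_norm_le_bracket ζ
          have e10 := two_pi_norm_le_bracket η
          have e11 := Real.rpow_nonneg (hb0 ζ).le s
          have e12 := Real.rpow_nonneg (hb0 η).le s
          calc |a (ζ + η) - a η| * ‖G (ζ + η)‖ * (‖U ζ‖ * (|w η| * ‖U η‖))
              ≤ |a (ζ + η) - a η| * ‖G (ζ + η)‖ * (‖U ζ‖ * ((2 * Real.pi * ‖η‖) * ‖U η‖)) := by
                gcongr
            _ = (|a (ζ + η) - a η| * ‖η‖) * (2 * Real.pi) * (‖G (ζ + η)‖ * ‖U ζ‖ * ‖U η‖) := by ring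
            _ ≤ (Ca * (‖ζ‖ * bracket η ^ s + bracket ζ ^ s * ‖η‖)) * (2 * Real.pi)
                * (‖G (ζ + η)‖ * ‖U ζ‖ * ‖U η‖) := by gcongr
            _ = Ca * (‖G (ζ + η)‖ * ((2 * Real.pi * ‖ζ‖) * ‖U ζ‖ * (bracket η ^ s * ‖U η‖))
                + ‖G (ζ + η)‖ * ((2 * Real.pi * ‖η‖) * ‖U η‖ * (bracket ζ ^ s * ‖U ζ‖))) := by ring
            _ ≤ _ := by gcongr
      _ = Ca * (2 * ∫ q, g₁ q ∂((volume : Measure (E n)).prod volume)) := by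
          rw [integral_const_mul, integral_add hgi hgi2,
            integral_comp_prod_sub hgi.aestronglyMeasurable]
          ring
      _ ≤ Ca * (2 * (N * (‖G‖ * ‖V‖))) := by gcongr
      _ = _ := by ring
  have hvle : ‖v‖ ≤ Ca * ‖V‖ := by
    rw [← norm_fourier, hv]
    refine Lp.norm_le_mul_norm_of_ae_le_mul ?_
    filter_upwards [hma.coeFn U, hUV] with ξ e1 e2
    rw [e1, e2, norm_mul, norm_mul, Complex.norm_real, Complex.norm_real, Real.norm_eq_abs,
      Real.norm_eq_abs, abs_of_pos (Real.rpow_pos_of_pos (hb0 ξ) _), ← mul_assoc]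
    gcongr
    exact ha.le ξ
  have hGle : ‖G‖ ≤ C * ‖v‖ := by
    rw [hG, norm_fourier]; exact hφ.bddMeas.norm_le v
  rw [hT]
  set T := ∫ q, f₂ q ∂((volume : Measure (E n)).prod volume)
  set T₀ := inner ℂ G (𝓕 (mulOp (𝓕⁻ (U : E n → ℂ)) (𝓕⁻ F₀)) : L2C n)
  have h5 : |T.re| ≤ ‖T - T₀‖ + |T₀.re| := by
    have e1 : T.re = (T - T₀).re + T₀.re := by simp
    rw [e1]
    exact (abs_add_le _ _).trans (add_le_add_left (Complex.abs_re_le_norm _) _)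
  calc |T.re| ≤ 2 * Ca * N * (‖G‖ * ‖V‖) + (C + L) * N / 2 * ‖v‖ ^ 2 :=
        h5.trans (add_le_add hcomm hT0)
    _ ≤ 2 * Ca * N * ((C * (Ca * ‖V‖)) * ‖V‖) + (C + L) * N / 2 * (Ca * ‖V‖) ^ 2 := by
        gcongr
        exact hGle.trans (by gcongr)
    _ = Ca ^ 2 * (2 * C + (C + L) / 2) * N * ‖V‖ ^ 2 := by ring
    _ ≤ _ := by
        have : 2 * C + (C + L) / 2 ≤ 3 * C + L := by linarith
        gcongr

/-! ### Truncated Bessel symbols -/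

theorem bracket_le_add (ξ η : E n) : bracket ξ ≤ bracket η + 2 * Real.pi * ‖ξ - η‖ := by
  have h0 := two_pi_norm_le_bracket η
  have h1 := sq_bracket η
  have h2 := bracket_pos η
  have h3 : 2 * Real.pi * ‖ξ‖ ≤ 2 * Real.pi * ‖η‖ + 2 * Real.pi * ‖ξ - η‖ := by
    rw [← mul_add]
    have : ‖ξ‖ ≤ ‖η‖ + ‖ξ - η‖ := by
      have := norm_add_le η (ξ - η)
      rwa [add_sub_cancel] at this
    gcongr
  have h4 : 0 ≤ 2 * Real.pi * ‖ξ - η‖ := by positivity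
  have h5 : 0 ≤ 2 * Real.pi * ‖ξ‖ := by positivity
  have h6 : 0 ≤ 2 * Real.pi * ‖η‖ := by positivity
  refine Real.sqrt_le_iff.2 ⟨by positivity, ?_⟩
  nlinarith [mul_nonneg h4 (sub_nonneg.2 h0), mul_self_le_mul_self h5 h3]

theorem abs_bracket_sub_le (ξ η : E n) : |bracket ξ - bracket η| ≤ 2 * Real.pi * ‖ξ - η‖ := by
  rw [abs_sub_le_iff]
  have h1 := bracket_le_add ξ η
  have h2 := bracket_le_add η ξ
  rw [norm_sub_rev] at h2
  exact ⟨by linarith, by linarith⟩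

theorem contDiff_bracket_rpow (s : ℝ) : ContDiff ℝ ∞ fun ξ : E n => bracket ξ ^ s := by
  have h1 : ContDiff ℝ ∞ (bracket : E n → ℝ) := by
    unfold bracket
    refine ContDiff.sqrt ?_ fun ξ => by positivity
    simp_rw [mul_pow]
    exact contDiff_const.add (contDiff_const.mul (contDiff_norm_sq ℝ))
  exact h1.rpow_const_of_ne fun ξ => (bracket_pos ξ).ne'

/-- A smooth cut-off on the line, equal to `1` on `[-1,1]` and supported in `[-2,2]`. -/
def cutoff : ContDiffBump (0 : ℝ) := ⟨1, 2, one_pos, one_lt_two⟩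

theorem cutoff_eq_one {x : ℝ} (h0 : 0 ≤ x) (h : x ≤ 1) : cutoff x = 1 :=
  cutoff.one_of_mem_closedBall (by
    rw [mem_closedBall_zero_iff, Real.norm_of_nonneg h0]; exact h)

theorem cutoff_eq_zero {x : ℝ} (h : 2 ≤ x) : cutoff x = 0 :=
  cutoff.zero_of_le_dist (by
    rw [Real.dist_0_eq_abs]; exact h.trans (le_abs_self x))

theorem exists_lipschitz_cutoff : ∃ L : ℝ, 0 ≤ L ∧ ∀ x y, |cutoff x - cutoff y| ≤ L * |x - y| := by
  obtain ⟨C, hC⟩ := ContDiff.lipschitzWith_of_hasCompactSupport cutoff.hasCompactSupport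
    (cutoff.contDiff (n := 1)) (by norm_num)
  refine ⟨C, C.2, fun x y => ?_⟩
  have := hC.dist_le_mul x y
  rwa [Real.dist_eq, Real.dist_eq] at this

/-- The symbol `⟨2πξ⟩^s`, smoothly truncated to `ε ⟨2πξ⟩ ≤ 2`. -/
def moll (s ε : ℝ) (ξ : E n) : ℝ := bracket ξ ^ s * cutoff (ε * bracket ξ)

theorem moll_nonneg (s ε : ℝ) (ξ : E n) : 0 ≤ moll s ε ξ :=
  mul_nonneg (Real.rpow_nonneg (bracket_pos ξ).le _) cutoff.nonneg

theorem moll_le (s ε : ℝ) (ξ : E n) : moll s ε ξ ≤ bracket ξ ^ s :=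
  mul_le_of_le_one_right (Real.rpow_nonneg (bracket_pos ξ).le _) cutoff.le_one

theorem contDiff_moll (s ε : ℝ) : ContDiff ℝ ∞ (moll s ε : E n → ℝ) := by
  have h1 : ContDiff ℝ ∞ (bracket : E n → ℝ) := by
    simpa using contDiff_bracket_rpow (n := n) 1
  exact (contDiff_bracket_rpow s).mul (cutoff.contDiff.comp (contDiff_const.mul h1))

@[fun_prop]
theorem measurable_moll (s ε : ℝ) : Measurable (moll s ε : E n → ℝ) :=
  (contDiff_moll s ε).continuous.measurable

theorem moll_eq_zero {s ε : ℝ} (hε : 0 < ε) {ξ : E n} (h : 2 / ε ≤ bracket ξ) : moll s ε ξ = 0 := by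
  rw [moll, cutoff_eq_zero, mul_zero]
  rwa [div_le_iff₀' hε] at h

theorem hasCompactSupport_moll (s : ℝ) {ε : ℝ} (hε : 0 < ε) :
    HasCompactSupport (moll s ε : E n → ℝ) := by
  refine HasCompactSupport.intro (isCompact_closedBall (0 : E n) (2 / ε)) fun ξ hξ => ?_
  refine moll_eq_zero hε (le_trans ?_ (two_pi_norm_le_bracket ξ))
  rw [mem_closedBall_zero_iff, not_le] at hξ
  nlinarith [Real.pi_gt_three, norm_nonneg ξ]

theorem moll_mul_rpow_le {s k ε : ℝ} (hε : 0 < ε) (h : 0 ≤ s + k) (ξ : E n) :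
    moll s ε ξ * bracket ξ ^ k ≤ (2 / ε) ^ (s + k) := by
  rcases le_total (2 / ε) (bracket ξ) with h1 | h1
  · rw [moll_eq_zero hε h1, zero_mul]; positivity
  · calc moll s ε ξ * bracket ξ ^ k ≤ bracket ξ ^ s * bracket ξ ^ k :=
          mul_le_mul_of_nonneg_right (moll_le s ε ξ) (Real.rpow_nonneg (bracket_pos ξ).le _)
      _ = bracket ξ ^ (s + k) := (Real.rpow_add (bracket_pos ξ) _ _).symm
      _ ≤ _ := Real.rpow_le_rpow (bracket_pos ξ).le h1 h

theorem rpow_sub_rpow_le {s p q : ℝ} (hs : 1 ≤ s) (hq : 0 ≤ q) (hp : 0 < p) :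
    p ^ s - q ^ s ≤ s * p ^ (s - 1) * (p - q) := by
  have h1 := one_add_mul_self_le_rpow_one_add (s := q / p - 1) (by
    have := div_nonneg hq hp.le; linarith) hs
  rw [add_sub_cancel, Real.div_rpow hq hp.le, le_div_iff₀ (Real.rpow_pos_of_pos hp s)] at h1
  have h2 : p ^ s = p ^ (s - 1) * p := by
    rw [← Real.rpow_add_one hp.ne', sub_add_cancel]
  have h3 : s * (q / p - 1) * p ^ s = s * p ^ (s - 1) * (q - p) := by
    rw [h2]; field_simp
  linarith

/-- The truncated power is as regular as the power, uniformly in `ε`: the cut-off varies only where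
`ε q ≤ 2`, and its derivative `ε` is then absorbed by a factor `q`. -/
theorem abs_moll_increment_le {s L : ℝ} (hs : 1 ≤ s) (hL0 : 0 ≤ L)
    (hL : ∀ x y, |cutoff x - cutoff y| ≤ L * |x - y|) {ε p q : ℝ} (hε : 0 < ε) (hq : 0 < q)
    (hqp : q ≤ p) : |p ^ s * cutoff (ε * p) - q ^ s * cutoff (ε * q)|
      ≤ (s + 2 * L) * p ^ (s - 1) * (p - q) := by
  have hp : 0 < p := hq.trans_le hqp
  have h1 := rpow_sub_rpow_le hs hq.le hp
  have h1' : 0 ≤ p ^ s - q ^ s := sub_nonneg.2 (Real.rpow_le_rpow hq.le hqp (by linarith))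
  have h2 : |q ^ s * (cutoff (ε * p) - cutoff (ε * q))| ≤ 2 * L * p ^ (s - 1) * (p - q) := by
    rcases le_total 2 (ε * q) with h | h
    · rw [cutoff_eq_zero h, cutoff_eq_zero (h.trans (by gcongr)), sub_zero, mul_zero, abs_zero]
      have : 0 ≤ p - q := by linarith
      positivity
    · rw [abs_mul, abs_of_pos (Real.rpow_pos_of_pos hq s)]
      have h3 := hL (ε * p) (ε * q)
      rw [← mul_sub, abs_mul, abs_of_pos hε, abs_of_nonneg (sub_nonneg.2 hqp)] at h3
      have h4 : q ^ s = q ^ (s - 1) * q := by rw [← Real.rpow_add_one hq.ne', sub_add_cancel]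
      have h5 : q ^ (s - 1) ≤ p ^ (s - 1) := Real.rpow_le_rpow hq.le hqp (by linarith)
      have h6 : 0 ≤ p - q := by linarith
      calc q ^ s * |cutoff (ε * p) - cutoff (ε * q)| ≤ q ^ s * (L * (ε * (p - q))) := by gcongr
        _ = L * q ^ (s - 1) * (ε * q) * (p - q) := by rw [h4]; ring
        _ ≤ L * p ^ (s - 1) * 2 * (p - q) := by gcongr
        _ = _ := by ring
  have h3 : p ^ s * cutoff (ε * p) - q ^ s * cutoff (ε * q)
      = (p ^ s - q ^ s) * cutoff (ε * p) + q ^ s * (cutoff (ε * p) - cutoff (ε * q)) := by ring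
  rw [h3]
  refine (abs_add_le _ _).trans ?_
  have h4 : |(p ^ s - q ^ s) * cutoff (ε * p)| ≤ s * p ^ (s - 1) * (p - q) := by
    rw [abs_mul, abs_of_nonneg h1', abs_of_nonneg (cutoff.nonneg)]
    exact (mul_le_of_le_one_right h1' cutoff.le_one).trans h1
  calc _ ≤ s * p ^ (s - 1) * (p - q) + 2 * L * p ^ (s - 1) * (p - q) := add_le_add h4 h2
    _ = _ := by ring

/-- The truncated symbols satisfy the commutator bound of `⟨2πξ⟩^s` uniformly in `ε`. -/
theorem exists_commSymbol_moll {s : ℝ} (hs : 1 ≤ s) :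
    ∃ C : ℝ, 0 ≤ C ∧ ∀ ε : ℝ, 0 < ε → CommSymbol s (moll s ε : E n → ℝ) C := by
  obtain ⟨L, hL0, hL⟩ := exists_lipschitz_cutoff
  set A := s + 2 * L with hA
  have hA0 : 0 ≤ A := by positivity
  have hpi := Real.pi_gt_three
  refine ⟨1 + A * 2 ^ (s - 1) * (2 * Real.pi), by positivity, fun ε hε =>
    ⟨measurable_moll s ε, fun ξ => ?_, fun ζ η => ?_, (2 / ε) ^ (s + 1), fun ξ => ?_⟩⟩
  · rw [abs_of_nonneg (moll_nonneg s ε ξ)]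
    refine (moll_le s ε ξ).trans (le_mul_of_one_le_left (Real.rpow_nonneg (bracket_pos ξ).le _) ?_)
    have : 0 ≤ A * 2 ^ (s - 1) * (2 * Real.pi) := by positivity
    linarith
  · set p := bracket (ζ + η)
    set q := bracket η
    have hp : 0 < p := bracket_pos _
    have hq : 0 < q := bracket_pos _
    set z := 2 * Real.pi * ‖ζ‖ with hz
    have hz0 : 0 ≤ z := by positivity
    have hpq : |p - q| ≤ z := by
      have := abs_bracket_sub_le (ζ + η) η
      rwa [add_sub_cancel_right] at this
    set M := max p q with hM
    have hMpos : 0 < M := hp.trans_le (le_max_left _ _)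
    have hg : |moll s ε (ζ + η) - moll s ε η| ≤ A * M ^ (s - 1) * z := by
      have h1 : |moll s ε (ζ + η) - moll s ε η| ≤ A * M ^ (s - 1) * |p - q| := by
        rcases le_total q p with h | h
        · rw [hM, max_eq_left h, abs_of_nonneg (sub_nonneg.2 h)]
          exact abs_moll_increment_le hs hL0 hL hε hq h
        · rw [hM, max_eq_right h, abs_sub_comm, abs_sub_comm p q, abs_of_nonneg (sub_nonneg.2 h)]
          exact abs_moll_increment_le hs hL0 hL hε hp h
      exact h1.trans (by gcongr)
    have hMle : M ≤ q + z := by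
      have := (abs_sub_le_iff.1 hpq).1
      exact max_le (by linarith) (by linarith)
    have hη : ‖η‖ ≤ q := by
      have := two_pi_norm_le_bracket η
      nlinarith [norm_nonneg η]
    have hζ : z ≤ bracket ζ := two_pi_norm_le_bracket ζ
    have hbζ := Real.rpow_nonneg (bracket_pos ζ).le s
    have hs1 : 0 ≤ s - 1 := by linarith
    have hqs : q ^ (s - 1) * q = q ^ s := by rw [← Real.rpow_add_one hq.ne', sub_add_cancel]
    -- either `η` dominates, and the increment costs one factor `|ζ|`, or `ζ` does, and takes the
    -- whole power `s`
    rcases le_total z q with h | h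
    · have h2 : M ^ (s - 1) ≤ 2 ^ (s - 1) * q ^ (s - 1) := by
        rw [← Real.mul_rpow (by norm_num) hq.le]
        exact Real.rpow_le_rpow hMpos.le (by linarith) hs1
      calc |moll s ε (ζ + η) - moll s ε η| * ‖η‖
          ≤ (A * (2 ^ (s - 1) * q ^ (s - 1)) * z) * q := by
            gcongr
            exact hg.trans (by gcongr)
        _ = A * 2 ^ (s - 1) * (2 * Real.pi) * (‖ζ‖ * (q ^ (s - 1) * q)) := by rw [hz]; ring
        _ ≤ (1 + A * 2 ^ (s - 1) * (2 * Real.pi)) * (‖ζ‖ * q ^ s + bracket ζ ^ s * ‖η‖) := by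
            rw [hqs]
            gcongr
            · linarith
            · have := mul_nonneg hbζ (norm_nonneg η); linarith
    · rcases hz0.eq_or_lt with hz1 | hz1
      · exfalso; rw [← hz1] at h; linarith
      have h2 : M ^ (s - 1) ≤ 2 ^ (s - 1) * z ^ (s - 1) := by
        rw [← Real.mul_rpow (by norm_num) hz0]
        exact Real.rpow_le_rpow hMpos.le (by linarith) hs1
      have hzs : z ^ (s - 1) * z = z ^ s := by rw [← Real.rpow_add_one hz1.ne', sub_add_cancel]
      have hzb : z ^ s ≤ bracket ζ ^ s := Real.rpow_le_rpow hz0 hζ (by linarith)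
      calc |moll s ε (ζ + η) - moll s ε η| * ‖η‖
          ≤ (A * (2 ^ (s - 1) * z ^ (s - 1)) * z) * ‖η‖ := by
            gcongr
            exact hg.trans (by gcongr)
        _ = A * 2 ^ (s - 1) * 1 * (z ^ s * ‖η‖) := by rw [← hzs]; ring
        _ ≤ (1 + A * 2 ^ (s - 1) * (2 * Real.pi)) * (‖ζ‖ * q ^ s + bracket ζ ^ s * ‖η‖) := by
            have h3 : z ^ s * ‖η‖ ≤ ‖ζ‖ * q ^ s + bracket ζ ^ s * ‖η‖ := by
              have h4 : 0 ≤ ‖ζ‖ * q ^ s := by positivity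
              have h5 : z ^ s * ‖η‖ ≤ bracket ζ ^ s * ‖η‖ := by gcongr
              linarith
            have h6 : A * 2 ^ (s - 1) * 1 ≤ 1 + A * 2 ^ (s - 1) * (2 * Real.pi) := by
              have : 0 ≤ A * 2 ^ (s - 1) := by positivity
              nlinarith
            gcongr
  · rw [abs_of_nonneg (moll_nonneg s ε ξ)]
    have := moll_mul_rpow_le (s := s) (k := 1) hε (by linarith) ξ
    rwa [Real.rpow_one] at this

/-! ### Weak differentiability of curves in a Hilbert space -/

theorem norm_sub_sub_mul_le {f f' : ℝ → ℂ} {w : ℂ} {t τ δ c : ℝ}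
    (hf : ∀ x ∈ Metric.ball t δ, HasDerivAt f (f' x) x)
    (hb : ∀ x ∈ Metric.ball t δ, ‖f' x - w‖ ≤ c) (hτ : τ ∈ Metric.ball t δ) (hδ : 0 < δ) :
    ‖f τ - f t - ((τ - t : ℝ) : ℂ) * w‖ ≤ c * ‖τ - t‖ := by
  have hderiv : ∀ x ∈ Metric.ball t δ, HasDerivWithinAt
      (fun x : ℝ => f x - (x : ℂ) * w) (f' x - w) (Metric.ball t δ) x := fun x hx => by
    have h5 : HasDerivAt (fun x : ℝ => (x : ℂ) * w) w x := by
      simpa using (Complex.ofRealCLM.hasDerivAt (x := x)).mul_const w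
    exact ((hf x hx).sub h5).hasDerivWithinAt
  have h6 := (convex_ball t δ).norm_image_sub_le_of_norm_hasDerivWithin_le hderiv hb
    (Metric.mem_ball_self hδ) hτ
  refine le_trans (le_of_eq ?_) h6
  congr 1; push_cast; ring

/-- A curve in a Hilbert space that is differentiable when tested against a dense family of
vectors, with continuous derivative, is differentiable. -/
theorem hasDerivAt_of_weak {H ι : Type*} [NormedAddCommGroup H] [InnerProductSpace ℂ H] {D : ι → H}
    (hD : DenseRange D) {A B : ℝ → H} {s : Set ℝ} (hs : IsOpen s)
    (hA : ∀ i, ∀ t ∈ s, HasDerivAt (fun τ => inner ℂ (A τ) (D i)) (inner ℂ (B t) (D i)) t)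
    (hB : ContinuousOn B s) {t : ℝ} (ht : t ∈ s) : HasDerivAt A (B t) t := by
  rw [hasDerivAt_iff_isLittleO, Asymptotics.isLittleO_iff]
  intro c hc
  have h1 : ∀ᶠ τ in 𝓝 t, ‖B τ - B t‖ ≤ c ∧ τ ∈ s := by
    have h2 := (hB.continuousAt (hs.mem_nhds ht)).tendsto
    have h3 := h2.eventually (Metric.closedBall_mem_nhds (B t) hc)
    filter_upwards [h3, hs.mem_nhds ht] with τ h4 h5
    exact ⟨mem_closedBall_iff_norm.1 h4, h5⟩
  obtain ⟨δ, hδ, hball⟩ := Metric.eventually_nhds_iff_ball.1 h1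
  filter_upwards [Metric.ball_mem_nhds t hδ] with τ hτ
  have key : ∀ θ : H, ‖(inner ℂ (A τ - A t - (τ - t) • B t) θ : ℂ)‖ ≤ c * ‖τ - t‖ * ‖θ‖ := by
    have hcl : IsClosed {θ : H | ‖(inner ℂ (A τ - A t - (τ - t) • B t) θ : ℂ)‖ ≤ c * ‖τ - t‖ * ‖θ‖} :=
      isClosed_le (by fun_prop) (by fun_prop)
    refine fun θ => hD.induction_on θ hcl fun g => ?_
    have hbound : ∀ x ∈ Metric.ball t δ,
        ‖(inner ℂ (B x) (D g) - inner ℂ (B t) (D g) : ℂ)‖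
          ≤ c * ‖D g‖ := fun x hx => by
      rw [← inner_sub_left]
      exact (norm_inner_le_norm _ _).trans (by gcongr; exact (hball x hx).1)
    have h6 := norm_sub_sub_mul_le (fun x hx => hA g x (hball x hx).2) hbound hτ hδ
    have h7 : (inner ℂ (A τ - A t - (τ - t) • B t) (D g) : ℂ)
        = inner ℂ (A τ) (D g) - inner ℂ (A t) (D g)
          - ((τ - t : ℝ) : ℂ) * inner ℂ (B t) (D g) := by
      rw [inner_sub_left, inner_sub_left,
        show ((τ - t) • B t : H) = ((τ - t : ℝ) : ℂ) • B t from (Complex.coe_smul _ _).symm,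
        inner_smul_left, Complex.conj_ofReal]
    rw [h7]
    refine h6.trans (le_of_eq ?_)
    ring
  have h8 := key (A τ - A t - (τ - t) • B t)
  rw [inner_self_eq_norm_sq_to_K] at h8
  set X := A τ - A t - (τ - t) • B t
  have h9 : ‖X‖ * ‖X‖ ≤ c * ‖τ - t‖ * ‖X‖ := by
    simpa [sq] using h8
  rcases (norm_nonneg X).eq_or_lt with h0 | h0
  · rw [← h0]; positivity
  · exact le_of_mul_le_mul_right h9 h0

/-! ### Functions in Sobolev spaces -/

/-- `⟨2πξ⟩^s 𝓕 f`, as an element of `L²`; by Plancherel its norm is the `H^s` norm of `f`. -/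
def sobolevLp (s : ℝ) (f : L2 n) : L2C n :=
  mulOp (fun ξ => ((bracket ξ ^ s : ℝ) : ℂ)) (fourierL2 f)

theorem memLp_sobolev {s : ℝ} {f : L2 n} (hf : sobolevNorm s f < ⊤) :
    MemLp (fun ξ => ((bracket ξ ^ s : ℝ) : ℂ) * fourierL2 f ξ) 2 volume :=
  ⟨Measurable.aestronglyMeasurable (by fun_prop) |>.mul (Lp.aestronglyMeasurable _), hf⟩

theorem coeFn_sobolevLp {s : ℝ} {f : L2 n} (hf : sobolevNorm s f < ⊤) :
    sobolevLp s f =ᵐ[volume] fun ξ => ((bracket ξ ^ s : ℝ) : ℂ) * fourierL2 f ξ :=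
  coeFn_mulOp_of_memLp (memLp_sobolev hf)

theorem enorm_sobolevLp {s : ℝ} {f : L2 n} (hf : sobolevNorm s f < ⊤) :
    ‖sobolevLp s f‖ₑ = sobolevNorm s f := by
  rw [Lp.enorm_def]
  exact eLpNorm_congr_ae (coeFn_sobolevLp hf)

theorem norm_sobolevLp {s : ℝ} {f : L2 n} (hf : sobolevNorm s f < ⊤) :
    ‖sobolevLp s f‖ = (sobolevNorm s f).toReal := by
  rw [← enorm_sobolevLp hf, toReal_enorm]

theorem sobolevNorm_mono {r s : ℝ} (h : r ≤ s) (f : L2 n) : sobolevNorm r f ≤ sobolevNorm s f := by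
  refine eLpNorm_mono fun ξ => ?_
  rw [norm_mul, norm_mul, Complex.norm_real, Complex.norm_real,
    Real.norm_of_nonneg (Real.rpow_nonneg (bracket_pos ξ).le _),
    Real.norm_of_nonneg (Real.rpow_nonneg (bracket_pos ξ).le _)]
  have := Real.rpow_le_rpow_of_exponent_le (one_le_bracket ξ) h
  gcongr

theorem sobolevLp_eq_mulOp {r s : ℝ} (h : r ≤ s) {f : L2 n} (hf : sobolevNorm s f < ⊤) :
    sobolevLp r f = mulOp (fun ξ => ((bracket ξ ^ (-(s - r)) : ℝ) : ℂ)) (sobolevLp s f) := by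
  refine Lp.ext ?_
  filter_upwards [coeFn_sobolevLp ((sobolevNorm_mono h f).trans_lt hf), coeFn_sobolevLp hf,
    (bddMeas_rpow_neg_bracket (sub_nonneg.2 h)).coeFn (sobolevLp s f)] with ξ h1 h2 h3
  rw [h1, h3, h2, ← mul_assoc, ← Complex.ofReal_mul, ← Real.rpow_add (bracket_pos ξ)]
  congr 4; ring

theorem sobolevLp_zero (f : L2 n) : sobolevLp 0 f = fourierL2 f := by
  have h : BddMeas (fun ξ : E n => ((bracket ξ ^ (0 : ℝ) : ℝ) : ℂ)) 1 :=
    ⟨by fun_prop, fun ξ => by simp⟩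
  refine Lp.ext ?_
  filter_upwards [h.coeFn (fourierL2 f)] with ξ h1
  rw [sobolevLp, h1]; simp

theorem fourierL2_eq_mulOp {s : ℝ} (h : 0 ≤ s) {f : L2 n} (hf : sobolevNorm s f < ⊤) :
    fourierL2 f = mulOp (fun ξ => ((bracket ξ ^ (-s) : ℝ) : ℂ)) (sobolevLp s f) := by
  rw [← sobolevLp_zero, sobolevLp_eq_mulOp h hf, sub_zero]

theorem enorm_sobolevLp_sub {s : ℝ} {f g : L2 n} (hf : sobolevNorm s f < ⊤)
    (hg : sobolevNorm s g < ⊤) :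
    ‖sobolevLp s f - sobolevLp s g‖ₑ = sobolevNorm s (f - g) := by
  rw [Lp.enorm_def]
  refine eLpNorm_congr_ae ?_
  have h0 : fourierL2 (f - g) =ᵐ[volume] fun ξ => fourierL2 f ξ - fourierL2 g ξ := by
    rw [fourierL2_sub]; exact Lp.coeFn_sub _ _
  filter_upwards [h0, coeFn_sobolevLp hf, coeFn_sobolevLp hg, Lp.coeFn_sub (sobolevLp s f)
    (sobolevLp s g)] with ξ h1 h2 h3 h4
  rw [h1, h4, Pi.sub_apply, h2, h3, mul_sub]

theorem continuousOn_sobolevLp {s T : ℝ} {u : ℝ → L2 n} (hu : ContinuousInSobolev s T u) :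
    ContinuousOn (fun t => sobolevLp s (u t)) (Ioo 0 T) := by
  intro t ht
  rw [ContinuousWithinAt, tendsto_iff_edist_tendsto_0]
  refine ((hu t ht).2.mono_left nhdsWithin_le_nhds).congr' ?_
  filter_upwards [self_mem_nhdsWithin] with τ hτ
  rw [edist_eq_enorm_sub, enorm_sobolevLp_sub (hu τ hτ).1 (hu t ht).1]

/-- `⟨2πξ⟩ 𝓕 f` is integrable for `f ∈ H^r`, `r > n/2 + 1`. -/
theorem exists_integral_bracket_le {r : ℝ} (hr : (n : ℝ) / 2 + 1 < r) :
    ∃ C : ℝ, 0 ≤ C ∧ ∀ f : L2 n, sobolevNorm r f < ⊤ →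
      Integrable (fun ζ => bracket ζ * ‖fourierL2 f ζ‖) ∧
      ∫ ζ, bracket ζ * ‖fourierL2 f ζ‖ ≤ C * ‖sobolevLp r f‖ := by
  have hm : MemLp (fun ξ : E n => ((bracket ξ ^ (1 - r) : ℝ) : ℂ)) 2 volume := by
    rw [memLp_two_iff_integrable_sq_norm (Measurable.aestronglyMeasurable (by fun_prop))]
    have h1 : Integrable (fun ξ : E n => 2 ^ (2 * (r - 1)) * (1 + ‖ξ‖) ^ (-(2 * (r - 1)))) :=
      (integrable_one_add_norm (by
        rw [finrank_euclideanSpace_fin]; linarith)).const_mul _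
    refine h1.mono' (Measurable.aestronglyMeasurable (by fun_prop))
      (Eventually.of_forall fun ξ => ?_)
    have h2 : (1 + ‖ξ‖) / 2 ≤ bracket ξ := by
      refine Real.le_sqrt_of_sq_le ?_
      nlinarith [sq_nonneg (‖ξ‖ - 1), Real.pi_gt_three, norm_nonneg ξ,
        mul_nonneg (mul_nonneg (sub_nonneg.2 Real.pi_gt_three.le) Real.pi_pos.le) (sq_nonneg ‖ξ‖),
        mul_nonneg (sub_nonneg.2 Real.pi_gt_three.le) (sq_nonneg ‖ξ‖)]
    have hb := bracket_pos ξ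
    rw [Complex.norm_real, norm_pow, norm_norm, Real.norm_of_nonneg (Real.rpow_nonneg hb.le _),
      ← Real.rpow_natCast, ← Real.rpow_mul hb.le]
    have h0 : 0 < 1 + ‖ξ‖ := by positivity
    calc bracket ξ ^ ((1 - r) * (2 : ℕ)) ≤ ((1 + ‖ξ‖) / 2) ^ ((1 - r) * (2 : ℕ)) :=
          Real.rpow_le_rpow_of_nonpos (by positivity) h2 (by
            have : (0 : ℝ) ≤ n := Nat.cast_nonneg n
            push_cast; linarith)
      _ = _ := by
          rw [Real.div_rpow h0.le (by norm_num), div_eq_mul_inv, ← Real.rpow_neg (by norm_num),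
            mul_comm]
          congr 2 <;> (push_cast; ring)
  refine ⟨‖hm.toLp _‖, norm_nonneg _, fun f hf => ?_⟩
  have h1 : (fun ζ => ‖(hm.toLp _) ζ‖ * ‖(sobolevLp r f) ζ‖)
      =ᵐ[volume] fun ζ => bracket ζ * ‖fourierL2 f ζ‖ := by
    filter_upwards [hm.coeFn_toLp, coeFn_sobolevLp hf] with ξ h2 h3
    have hb := bracket_pos ξ
    rw [h2, h3, norm_mul, Complex.norm_real, Complex.norm_real,
      Real.norm_of_nonneg (Real.rpow_nonneg hb.le _),
      Real.norm_of_nonneg (Real.rpow_nonneg hb.le _), ← mul_assoc, ← Real.rpow_add hb]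
    norm_num
  refine ⟨(integrable_norm_mul_norm _ _).congr h1, ?_⟩
  rw [← integral_congr_ae h1]
  exact integral_norm_mul_norm_le _ _

theorem continuous_fourierInv_fun {p : E n → ℂ} (hp : Integrable p) : Continuous (𝓕⁻ p) := by
  simp_rw [funext (fourierInv_eq_integral_chr p)]
  refine continuous_of_dominated (bound := fun ζ => ‖p ζ‖)
    (fun x => (integrable_chr_mul hp x).aestronglyMeasurable)
    (fun x => Eventually.of_forall fun ζ => by rw [norm_mul, norm_chr, one_mul]) hp.norm
    (Eventually.of_forall fun ζ => ?_)
  exact (continuous_chr.comp (by fun_prop : Continuous fun x : E n => (ζ, x))).mul continuous_const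

theorem integrable_of_integrable_bracket_mul {U : L2C n}
    (h : Integrable fun ζ => bracket ζ * ‖U ζ‖) : Integrable fun ζ => U ζ :=
  h.mono' (Lp.aestronglyMeasurable U) (Eventually.of_forall fun ζ =>
    le_mul_of_one_le_left (norm_nonneg _) (one_le_bracket ζ))

theorem fourierInv_fourierL2 (f : L2 n) : (𝓕⁻ (fourierL2 f) : L2C n) = toC f := by
  rw [fourierL2_eq, FourierTransform.fourierInv_fourier_eq]

theorem fourierInv_fourierL2_ae {f : L2 n} (h : Integrable fun ζ => fourierL2 f ζ) :
    𝓕⁻ (fourierL2 f : E n → ℂ) =ᵐ[volume] fun x => (f x : ℂ) := by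
  have h1 := fourierInv_toLp_ae h (Lp.memLp (fourierL2 f))
  rw [Lp.toLp_coeFn, fourierInv_fourierL2] at h1
  exact h1.symm.trans (coeFn_toC f)

/-- The Fourier inversion integral of a real function is real at every point, by continuity. -/
theorem ofReal_re_fourierInv_fourierL2 {f : L2 n} (h : Integrable fun ζ => fourierL2 f ζ) (x : E n) :
    (((𝓕⁻ (fourierL2 f : E n → ℂ)) x).re : ℂ) = (𝓕⁻ (fourierL2 f : E n → ℂ)) x := by
  have hc : Continuous (𝓕⁻ (fourierL2 f : E n → ℂ)) := continuous_fourierInv_fun h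
  have hc' : Continuous fun x => (((𝓕⁻ (fourierL2 f : E n → ℂ)) x).re : ℂ) := by fun_prop
  have h1 : (fun x => (((𝓕⁻ (fourierL2 f : E n → ℂ)) x).re : ℂ)) = 𝓕⁻ (fourierL2 f : E n → ℂ) := by
    rw [← hc'.ae_eq_iff_eq volume hc]
    filter_upwards [fourierInv_fourierL2_ae h] with x hx
    rw [hx]; simp
  exact congrFun h1 x

/-- The square of a function with integrable Fourier transform, as an element of `L²`. -/
def sqLp (f : L2 n) : L2C n := mulOp (𝓕⁻ (fourierL2 f : E n → ℂ)) (toC f)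

theorem coeFn_sqLp {f : L2 n} (h : Integrable fun ζ => fourierL2 f ζ) :
    sqLp f =ᵐ[volume] fun x => (f x : ℂ) ^ 2 := by
  filter_upwards [(bddMeas_fourierInv h).coeFn (toC f), fourierInv_fourierL2_ae h,
    coeFn_toC f] with x h1 h2 h3
  rw [sqLp, h1, h2, h3, sq]

theorem norm_sqLp_sub_le {f g : L2 n} (hf : Integrable fun ζ => fourierL2 f ζ)
    (hg : Integrable fun ζ => fourierL2 g ζ) :
    ‖sqLp f - sqLp g‖ ≤ ((∫ ζ, ‖fourierL2 f ζ‖) + ∫ ζ, ‖fourierL2 g ζ‖) * ‖toC f - toC g‖ := by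
  set A := ∫ ζ, ‖fourierL2 f ζ‖
  set B := ∫ ζ, ‖fourierL2 g ζ‖
  have hae : ∀ {f : L2 n} (hf : Integrable fun ζ => fourierL2 f ζ),
      ∀ᵐ x, ‖(f x : ℂ)‖ ≤ ∫ ζ, ‖fourierL2 f ζ‖ := fun {f} hf => by
    filter_upwards [fourierInv_fourierL2_ae hf] with x hx
    rw [← hx]; exact (bddMeas_fourierInv hf).2 x
  refine Lp.norm_le_mul_norm_of_ae_le_mul ?_
  filter_upwards [coeFn_sqLp hf, coeFn_sqLp hg, Lp.coeFn_sub (sqLp f) (sqLp g),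
    Lp.coeFn_sub (toC f) (toC g), coeFn_toC f, coeFn_toC g, hae hf, hae hg]
    with x h1 h2 h3 h4 h5 h6 h7 h8
  rw [h3, h4, Pi.sub_apply, Pi.sub_apply, h1, h2, h5, h6, sq_sub_sq, norm_mul]
  gcongr
  exact (norm_add_le _ _).trans (add_le_add h7 h8)

theorem continuousOn_fourierL2 {s T : ℝ} (hs : 0 ≤ s) {u : ℝ → L2 n}
    (hu : ContinuousInSobolev s T u) : ContinuousOn (fun t => fourierL2 (u t)) (Ioo 0 T) :=
  ((bddMeas_rpow_neg_bracket hs).continuous.comp_continuousOn (continuousOn_sobolevLp hu)).congr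
    fun t ht => fourierL2_eq_mulOp hs (hu t ht).1

theorem continuousOn_toC {s T : ℝ} (hs : 0 ≤ s) {u : ℝ → L2 n}
    (hu : ContinuousInSobolev s T u) : ContinuousOn (fun t => toC (u t)) (Ioo 0 T) :=
  (continuous_fourierInv.comp_continuousOn (continuousOn_fourierL2 hs hu)).congr
    fun t _ => (fourierInv_fourierL2 (u t)).symm

theorem continuousOn_sqLp {s T : ℝ} (hs : (n : ℝ) / 2 + 1 < s) {u : ℝ → L2 n}
    (hu : ContinuousInSobolev s T u) : ContinuousOn (fun t => sqLp (u t)) (Ioo 0 T) := by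
  obtain ⟨C, hC0, hC⟩ := exists_integral_bracket_le hs
  have hs0 : 0 ≤ s := by
    have : (0 : ℝ) ≤ n := Nat.cast_nonneg n
    linarith
  have hint : ∀ t ∈ Ioo 0 T, Integrable (fun ζ => fourierL2 (u t) ζ) ∧
      ∫ ζ, ‖fourierL2 (u t) ζ‖ ≤ C * ‖sobolevLp s (u t)‖ := fun t ht => by
    obtain ⟨h1, h2⟩ := hC (u t) (hu t ht).1
    have h3 := integrable_of_integrable_bracket_mul h1
    exact ⟨h3, (integral_mono h3.norm h1 fun ζ =>
      le_mul_of_one_le_left (norm_nonneg _) (one_le_bracket ζ)).trans h2⟩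
  intro t ht
  rw [ContinuousWithinAt, tendsto_iff_norm_sub_tendsto_zero]
  have hV := (continuousOn_sobolevLp hu) t ht
  have hc := (continuousOn_toC hs0 hu) t ht
  have hlim : Tendsto (fun τ => (C * ‖sobolevLp s (u τ)‖ + C * ‖sobolevLp s (u t)‖)
      * ‖toC (u τ) - toC (u t)‖) (𝓝[Ioo 0 T] t) (𝓝 0) := by
    have := ((hV.norm.tendsto.const_mul C).add_const (C * ‖sobolevLp s (u t)‖)).mul
      (tendsto_iff_norm_sub_tendsto_zero.1 hc.tendsto)
    simpa using this
  refine squeeze_zero' (Eventually.of_forall fun τ => norm_nonneg _) ?_ hlim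
  filter_upwards [self_mem_nhdsWithin] with τ hτ
  refine (norm_sqLp_sub_le (hint τ hτ).1 (hint t ht).1).trans ?_
  have h1 := (hint τ hτ).2
  have h2 := (hint t ht).2
  gcongr

/-! ### Pairings with Schwartz functions -/

/-- A function of polynomial growth times a Schwartz function is in `L¹ ∩ L²`. -/
theorem integrable_and_memLp_mul_schwartz {m : E n → ℂ} (hm : Measurable m) {D : ℝ} {N : ℕ}
    (hD : ∀ ξ, ‖m ξ‖ ≤ D * (1 + ‖ξ‖ ^ N)) (g : 𝓢(E n, ℂ)) :
    Integrable (fun ξ => m ξ * g ξ) ∧ MemLp (fun ξ => m ξ * g ξ) 2 volume := by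
  have hD0 : 0 ≤ D := by
    have := (norm_nonneg _).trans (hD 0)
    exact nonneg_of_mul_nonneg_left this (by positivity)
  have hmeas : AEStronglyMeasurable (fun ξ => m ξ * g ξ) volume :=
    hm.aestronglyMeasurable.mul g.continuous.aestronglyMeasurable
  have h1 : Integrable (fun ξ => D * (‖g ξ‖ + ‖ξ‖ ^ N * ‖g ξ‖)) :=
    (g.integrable.norm.add (g.integrable_pow_mul volume N)).const_mul D
  have hle : ∀ ξ, ‖m ξ * g ξ‖ ≤ D * (‖g ξ‖ + ‖ξ‖ ^ N * ‖g ξ‖) := fun ξ => by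
    rw [norm_mul]
    refine (mul_le_mul_of_nonneg_right (hD ξ) (norm_nonneg _)).trans (le_of_eq ?_)
    ring
  have hi : Integrable (fun ξ => m ξ * g ξ) := h1.mono' hmeas (Eventually.of_forall hle)
  refine ⟨hi, ?_⟩
  obtain ⟨C0, hC0⟩ := g.decay 0 0
  obtain ⟨C1, hC1⟩ := g.decay N 0
  rw [memLp_two_iff_integrable_sq_norm hmeas]
  refine (hi.norm.mul_const (D * (C0 + C1))).mono' (hmeas.norm.pow 2)
    (Eventually.of_forall fun ξ => ?_)
  rw [Real.norm_of_nonneg (by positivity), sq]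
  refine mul_le_mul_of_nonneg_left ((hle ξ).trans ?_) (norm_nonneg _)
  have h2 := hC0.2 ξ
  have h3 := hC1.2 ξ
  rw [norm_iteratedFDeriv_zero] at h2 h3
  rw [pow_zero, one_mul] at h2
  gcongr

theorem integral_ofReal_mul_schwartz (f : L2 n) (ψ : 𝓢(E n, ℂ)) :
    ∫ x, (f x : ℂ) * ψ x = inner ℂ (toC f) (ψ.toLp 2) := by
  rw [inner_eq_integral]
  refine integral_congr_ae ?_
  filter_upwards [coeFn_toC f, ψ.coeFn_toLp 2 volume] with x h1 h2
  rw [h1, h2, Complex.conj_ofReal]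

theorem fourier_toLp_schwartz (ψ : 𝓢(E n, ℂ)) :
    (𝓕 (ψ.toLp 2 (volume : Measure (E n))) : L2C n) =ᵐ[volume] fun ξ => (𝓕 ψ : 𝓢(E n, ℂ)) ξ := by
  have h1 := fourier_toLp_ae ψ.integrable (ψ.memLp 2 volume)
  refine h1.trans (Eventually.of_forall fun ξ => ?_)
  rw [SchwartzMap.fourier_coe]

theorem rpow_two_pi_norm_le {a : ℝ} (ha : 0 ≤ a) (ξ : E n) :
    (2 * Real.pi * ‖ξ‖) ^ a ≤ (2 * Real.pi) ^ a * (1 + ‖ξ‖ ^ ⌈a⌉₊) := by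
  rw [Real.mul_rpow (by positivity) (norm_nonneg _)]
  gcongr
  rcases le_total ‖ξ‖ 1 with h | h
  · have := Real.rpow_le_one (norm_nonneg ξ) h ha
    have h2 : 0 ≤ ‖ξ‖ ^ ⌈a⌉₊ := by positivity
    linarith
  · have := Real.rpow_le_rpow_of_exponent_le h (Nat.le_ceil a)
    rw [Real.rpow_natCast] at this
    linarith

theorem fracLaplacian_memLp {a : ℝ} (ha : 0 ≤ a) (ψ : 𝓢(E n, ℂ)) :
    Integrable (fun ξ => (((2 * Real.pi * ‖ξ‖) ^ (2 * a) : ℝ) : ℂ) * (𝓕 ψ) ξ) ∧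
    MemLp (fun ξ => (((2 * Real.pi * ‖ξ‖) ^ (2 * a) : ℝ) : ℂ) * (𝓕 ψ) ξ) 2 volume :=
  integrable_and_memLp_mul_schwartz (by fun_prop) (D := (2 * Real.pi) ^ (2 * a)) (N := ⌈2 * a⌉₊)
    (fun ξ => by
      rw [Complex.norm_real, Real.norm_of_nonneg (by positivity)]
      exact rpow_two_pi_norm_le (by positivity) ξ) (𝓕 ψ)

/-- Plancherel's identity for the pairing with the fractional Laplacian. -/
theorem fracLaplacianPairing_eq {a : ℝ} (ha : 0 ≤ a) (f : L2 n) (ψ : 𝓢(E n, ℂ)) :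
    fracLaplacianPairing a f ψ = ∫ ξ, starRingEnd ℂ (fourierL2 f ξ) *
      ((((2 * Real.pi * ‖ξ‖) ^ (2 * a) : ℝ) : ℂ) * (𝓕 ψ) ξ) := by
  obtain ⟨h1, h2⟩ := fracLaplacian_memLp ha ψ
  have h3 := fourierInv_toLp_ae h1 h2
  have h4 : fracLaplacianPairing a f ψ = inner ℂ (toC f) (𝓕⁻ (h2.toLp _) : L2C n) := by
    rw [inner_eq_integral, fracLaplacianPairing]
    refine integral_congr_ae ?_
    filter_upwards [coeFn_toC f, h3] with x e1 e2
    rw [e1, e2, Complex.conj_ofReal]; rfl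
  rw [h4, ← inner_fourier, FourierTransform.fourier_fourierInv_eq, ← fourierL2_eq, inner_eq_integral]
  refine integral_congr_ae ?_
  filter_upwards [h2.coeFn_toLp] with ξ e1
  rw [e1]

theorem fourier_lineDeriv_schwartz (e : E n) (ψ : 𝓢(E n, ℂ)) (ξ : E n) :
    (𝓕 (∂_{e} ψ)) ξ = Complex.I * (ang ξ e : ℂ) * (𝓕 ψ) ξ := by
  rw [SchwartzMap.fourier_lineDerivOp_eq, smul_apply,
    SchwartzMap.smulLeftCLM_apply_apply (by fun_prop), smul_eq_mul, Complex.real_smul, ang]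
  push_cast; ring

/-- The truncated symbol times a Schwartz function is a Schwartz function. -/
theorem exists_schwartz_moll_mul (s : ℝ) {ε : ℝ} (hε : 0 < ε) (θ : 𝓢(E n, ℂ)) :
    ∃ Ψ : 𝓢(E n, ℂ), ∀ ξ, Ψ ξ = (moll s ε ξ : ℂ) * θ ξ := by
  have h1 : ContDiff ℝ ∞ fun ξ : E n => (moll s ε ξ : ℂ) * θ ξ :=
    (Complex.ofRealCLM.contDiff.comp (contDiff_moll s ε)).mul (θ.smooth ⊤)
  have h2 : HasCompactSupport fun ξ : E n => (moll s ε ξ : ℂ) * θ ξ := by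
    have := (hasCompactSupport_moll (n := n) s hε).comp_left (g := fun x : ℝ => (x : ℂ)) (by simp)
    exact this.mul_right
  exact ⟨h2.toSchwartzMap h1, fun ξ => rfl⟩

/-- The right-hand side of the equation for `a(D) u` on the Fourier side, `a` the truncated
symbol. -/
def mollRhs (α s ε : ℝ) (e : E n) (f : L2 n) : L2C n :=
  mulOp (fun ξ => Complex.I * (((2 * Real.pi * ‖ξ‖) ^ α * ang ξ e * moll s ε ξ : ℝ) : ℂ)) (fourierL2 f)
    - mulOp (fun ξ => Complex.I * (ang ξ e : ℂ) / 2 * (moll s ε ξ : ℂ)) (𝓕 (sqLp f))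

theorem bddMeas_moll {s ε : ℝ} (hs : 0 ≤ s) (hε : 0 < ε) :
    BddMeas (fun ξ : E n => (moll s ε ξ : ℂ)) ((2 / ε) ^ s) := by
  refine ⟨by fun_prop, fun ξ => ?_⟩
  rw [Complex.norm_real, Real.norm_of_nonneg (moll_nonneg s ε ξ)]
  simpa using moll_mul_rpow_le (s := s) (k := 0) hε (by simpa using hs) ξ

theorem bddMeas_dispersion {α s ε : ℝ} (hα : 0 ≤ α) (hs : 0 ≤ s) (hε : 0 < ε) {e : E n}
    (he : ‖e‖ ≤ 1) : BddMeas (fun ξ : E n =>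
      Complex.I * (((2 * Real.pi * ‖ξ‖) ^ α * ang ξ e * moll s ε ξ : ℝ) : ℂ))
      ((2 / ε) ^ (s + (α + 1))) := by
  refine ⟨by fun_prop, fun ξ => ?_⟩
  rw [norm_mul, Complex.norm_I, one_mul, Complex.norm_real, Real.norm_eq_abs, abs_mul, abs_mul,
    abs_of_nonneg (moll_nonneg s ε ξ), abs_of_nonneg (by positivity)]
  refine le_trans ?_ (moll_mul_rpow_le (s := s) (k := α + 1) hε (by positivity) ξ)
  rw [Real.rpow_add_one (bracket_pos ξ).ne', mul_comm (moll s ε ξ)]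
  have h1 := moll_nonneg s ε ξ
  have h2 := Real.rpow_le_rpow (by positivity) (two_pi_norm_le_bracket ξ) hα
  have h3 := abs_ang_le_bracket ξ he
  have h4 := bracket_pos ξ
  gcongr

theorem bddMeas_transport {s ε : ℝ} (hs : 0 ≤ s) (hε : 0 < ε) {e : E n}
    (he : ‖e‖ ≤ 1) : BddMeas (fun ξ : E n =>
      Complex.I * (ang ξ e : ℂ) / 2 * (moll s ε ξ : ℂ)) ((2 / ε) ^ (s + 1)) := by
  refine ⟨by fun_prop, fun ξ => ?_⟩
  simp only [norm_mul, norm_div, Complex.norm_I, Complex.norm_real, Real.norm_eq_abs, one_mul,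
    Complex.norm_ofNat, abs_of_nonneg (moll_nonneg s ε ξ)]
  have h := moll_mul_rpow_le (s := s) (k := 1) hε (by positivity) ξ
  rw [Real.rpow_one] at h
  have h3 := abs_ang_le_bracket ξ he
  have h1 := moll_nonneg s ε ξ
  nlinarith [mul_le_mul_of_nonneg_left h3 h1, abs_nonneg (ang ξ e), mul_nonneg (abs_nonneg (ang ξ e)) h1]

theorem norm_basisVec [NeZero n] : ‖(basisVec 0 : E n)‖ = 1 := by simp [basisVec]

/-- The equation for the truncated derivative of the solution, in the strong sense: the truncated
symbols are bounded, so testing against Schwartz functions determines the derivative in `L²`. -/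
theorem hasDerivAt_moll [NeZero n] {α T s σ ε : ℝ} (hα : 0 ≤ α) (hs : (n : ℝ) / 2 + 1 < s)
    (hσ : 0 ≤ σ) (hε : 0 < ε) {u : ℝ → L2 n} (hu : ContinuousInSobolev s T u)
    (hsol : IsSolution α T u) :
    ContinuousOn (fun t => mollRhs α σ ε (basisVec 0) (u t)) (Ioo 0 T) ∧
    ∀ t ∈ Ioo 0 T, HasDerivAt (fun τ => mulOp (fun ξ => (moll σ ε ξ : ℂ)) (fourierL2 (u τ)))
      (mollRhs α σ ε (basisVec 0) (u t)) t := by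
  have hn : (0 : ℝ) ≤ n := Nat.cast_nonneg n
  have hs0 : 0 ≤ s := by linarith
  set e : E n := basisVec 0
  have he : ‖e‖ ≤ 1 := norm_basisVec.le
  have hP := bddMeas_dispersion hα hσ hε he
  have hQ := bddMeas_transport hσ hε he
  have ha := bddMeas_moll (n := n) hσ hε
  have hcont : ContinuousOn (fun t => mollRhs α σ ε e (u t)) (Ioo 0 T) :=
    (hP.continuous.comp_continuousOn (continuousOn_fourierL2 hs0 hu)).sub
      (hQ.continuous.comp_continuousOn
        (continuous_fourier.comp_continuousOn (continuousOn_sqLp hs hu)))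
  refine ⟨hcont, fun t ht => hasDerivAt_of_weak dense_schwartz isOpen_Ioo (fun θ t ht => ?_) hcont ht⟩
  obtain ⟨Ψ, hΨ⟩ := exists_schwartz_moll_mul σ hε θ
  set ψ : 𝓢(E n, ℂ) := 𝓕⁻ Ψ with hψ
  have hFψ : (𝓕 ψ : 𝓢(E n, ℂ)) = Ψ := FourierTransform.fourier_fourierInv_eq Ψ
  have hθ := θ.coeFn_toLp 2 (volume : Measure (E n))
  have h1 : (fun τ => (inner ℂ (mulOp (fun ξ => (moll σ ε ξ : ℂ)) (fourierL2 (u τ))) (θ.toLp 2) : ℂ))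
      = fun τ => ∫ x, (u τ x : ℂ) * ψ x := by
    funext τ
    rw [integral_ofReal_mul_schwartz, ← inner_fourier (toC (u τ)), ← fourierL2_eq, inner_eq_integral,
      inner_eq_integral]
    refine integral_congr_ae ?_
    filter_upwards [ha.coeFn (fourierL2 (u τ)), hθ, fourier_toLp_schwartz ψ] with ξ e1 e2 e3
    rw [e1, e2, e3, hFψ, hΨ, map_mul, Complex.conj_ofReal]; ring
  rw [h1]
  have h2 := hsol ψ t ht
  have hU : Integrable fun ζ => fourierL2 (u t) ζ := by
    obtain ⟨C, -, hC⟩ := exists_integral_bracket_le hs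
    exact integrable_of_integrable_bracket_mul (hC (u t) (hu t ht).1).1
  have h3 : fracLaplacianPairing (α / 2) (u t) (∂_{e} ψ)
      = - inner ℂ (mulOp (fun ξ => Complex.I * (((2 * Real.pi * ‖ξ‖) ^ α * ang ξ e * moll σ ε ξ : ℝ) : ℂ))
        (fourierL2 (u t))) (θ.toLp 2) := by
    rw [fracLaplacianPairing_eq (by positivity), inner_eq_integral, ← integral_neg]
    refine integral_congr_ae ?_
    filter_upwards [hP.coeFn (fourierL2 (u t)), hθ] with ξ e1 e2
    rw [e1, e2, fourier_lineDeriv_schwartz, hFψ, hΨ, map_mul, map_mul, Complex.conj_I,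
      Complex.conj_ofReal, mul_div_cancel₀ α (two_ne_zero)]
    push_cast; ring
  have h4 : ∫ x, ((u t x : ℂ) ^ 2) * (∂_{e} ψ) x
      = - (2 * inner ℂ (mulOp (fun ξ => Complex.I * (ang ξ e : ℂ) / 2 * (moll σ ε ξ : ℂ))
        (𝓕 (sqLp (u t)))) (θ.toLp 2)) := by
    have e0 : ∫ x, ((u t x : ℂ) ^ 2) * (∂_{e} ψ) x = inner ℂ (sqLp (u t)) ((∂_{e} ψ).toLp 2) := by
      rw [inner_eq_integral]
      refine integral_congr_ae ?_
      filter_upwards [coeFn_sqLp hU, (∂_{e} ψ).coeFn_toLp 2 volume] with x e1 e2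
      rw [e1, e2, map_pow, Complex.conj_ofReal]
    rw [e0, ← inner_fourier, inner_eq_integral, inner_eq_integral, ← integral_const_mul, ← integral_neg]
    refine integral_congr_ae ?_
    filter_upwards [hQ.coeFn (𝓕 (sqLp (u t))), hθ, fourier_toLp_schwartz (∂_{e} ψ)] with ξ e1 e2 e3
    rw [e1, e2, e3, fourier_lineDeriv_schwartz, hFψ, hΨ]
    simp only [map_mul, map_div₀, Complex.conj_I, Complex.conj_ofReal, map_ofNat]
    ring
  rw [h3, h4] at h2
  refine h2.congr_deriv ?_
  rw [mollRhs, inner_sub_left]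
  ring

/-! ### The weighted energy estimate -/

/-- `J^s f`, with the symbol truncated at frequencies of size `1/ε`. -/
def mollify (s ε : ℝ) (f : L2 n) : L2C n :=
  𝓕⁻ (mulOp (fun ξ => (moll s ε ξ : ℂ)) (fourierL2 f))

theorem fourier_mollify (s ε : ℝ) (f : L2 n) :
    𝓕 (mollify s ε f) = mulOp (fun ξ => (moll s ε ξ : ℂ)) (fourierL2 f) :=
  FourierTransform.fourier_fourierInv_eq _

theorem norm_mollify_le {s ε : ℝ} (hs : 0 ≤ s) (hε : 0 < ε) {f : L2 n} (hf : sobolevNorm s f < ⊤) :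
    ‖mollify s ε f‖ ≤ ‖sobolevLp s f‖ := by
  rw [← norm_fourier, fourier_mollify]
  refine Lp.norm_le_norm_of_ae_le ?_
  filter_upwards [(bddMeas_moll hs hε).coeFn (fourierL2 f), coeFn_sobolevLp hf] with ξ h1 h2
  rw [h1, h2, norm_mul, norm_mul, Complex.norm_real, Complex.norm_real,
    Real.norm_of_nonneg (moll_nonneg s ε ξ),
    Real.norm_of_nonneg (Real.rpow_nonneg (bracket_pos ξ).le _)]
  have := moll_le s ε ξ
  gcongr

theorem memLp_mollify {s ε : ℝ} (hs : 0 ≤ s) (hε : 0 < ε) (f : L2 n) :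
    MemLp (fun ξ => (((1 + ‖ξ‖) ^ 3 : ℝ) : ℂ) * (𝓕 (mollify s ε f) : L2C n) ξ) 2 volume := by
  have h : BddMeas (fun ξ : E n => (((1 + ‖ξ‖) ^ 3 * moll s ε ξ : ℝ) : ℂ))
      (8 * (2 / ε) ^ (s + 3)) := by
    refine ⟨by fun_prop, fun ξ => ?_⟩
    rw [Complex.norm_real, norm_mul, Real.norm_of_nonneg (moll_nonneg s ε ξ),
      Real.norm_of_nonneg (by positivity)]
    have h1 : 1 + ‖ξ‖ ≤ 2 * bracket ξ := by
      have := one_le_bracket ξ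
      have := two_pi_norm_le_bracket ξ
      nlinarith [Real.pi_gt_three, norm_nonneg ξ]
    have h2 := moll_mul_rpow_le (s := s) (k := 3) hε (by positivity) ξ
    have h3 : bracket ξ ^ (3 : ℝ) = bracket ξ ^ 3 := by exact_mod_cast Real.rpow_natCast _ 3
    rw [h3] at h2
    have h4 := moll_nonneg s ε ξ
    calc (1 + ‖ξ‖) ^ 3 * moll s ε ξ ≤ (2 * bracket ξ) ^ 3 * moll s ε ξ := by gcongr
      _ = 8 * (moll s ε ξ * bracket ξ ^ 3) := by ring
      _ ≤ _ := by gcongr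
  refine (h.memLp (fourierL2 f)).ae_eq ?_
  rw [fourier_mollify]
  filter_upwards [(bddMeas_moll hs hε).coeFn (fourierL2 f)] with ξ h1
  rw [h1]; push_cast; ring

/-- The energy inequality at a fixed time, with the right-hand side of the equation in place of the
time derivative: the dispersive term gives the gain, the transport term is an error. -/
theorem exists_energy_deriv_le [NeZero n] {α s r : ℝ} (h0 : 0 < α) (h2 : α < 2)
    (hs : (n : ℝ) / 2 + 1 < s) (hr : (n : ℝ) / 2 + 1 < r) (ν : E n) {c₀ : ℝ} (hc₀ : 0 < c₀)
    (hell : ∀ ξ : E n, c₀ * ‖ξ‖ ^ 2 ≤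
      inner ℝ (basisVec 0) ν * ‖ξ‖ ^ 2 + α * (inner ℝ (basisVec 0) ξ * inner ℝ ν ξ)) (C : ℝ) :
    ∃ c₁ K : ℝ, 0 < c₁ ∧ 0 ≤ K ∧ ∀ φ h : E n → ℝ, WeightData ν φ h C → ∀ ε : ℝ, 0 < ε →
      ∀ f : L2 n, sobolevNorm s f < ⊤ → sobolevNorm r f < ⊤ →
      2 * (inner ℂ (rmul φ (mollify s ε f)) (𝓕⁻ (mollRhs α s ε (basisVec 0) f) : L2C n)).re
        ≤ -c₁ * (∫ ξ, ‖ξ‖ ^ α * ‖(𝓕 (rmul h (mollify s ε f)) : L2C n) ξ‖ ^ 2)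
          + K * (1 + ‖sobolevLp r f‖) * ‖sobolevLp s f‖ ^ 2 := by
  have hn : (0 : ℝ) ≤ n := Nat.cast_nonneg n
  have hs0 : 0 ≤ s := by linarith
  have hpi := Real.pi_pos
  set e : E n := basisVec 0
  have he : ‖e‖ ≤ 1 := norm_basisVec.le
  obtain ⟨K₁, hK₁⟩ := commutator_estimate ν e h0 h2 hc₀ hell C
  obtain ⟨Ca, hCa0, hCa⟩ := exists_commSymbol_moll (n := n) (s := s) (by linarith)
  obtain ⟨D, hD0, hD⟩ := exists_integral_bracket_le hr
  set p := (2 * Real.pi) ^ (1 + α) with hp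
  have hp0 : 0 < p := by positivity
  set K₂ := Ca ^ 2 * (3 * |C| + |C|) * D with hK₂
  have hK₂0 : 0 ≤ K₂ := by positivity
  refine ⟨2 * p * (c₀ / (4 * Real.pi)), 2 * p * |K₁| + 2 * K₂, by positivity, by positivity,
    fun φ h H ε hε f hfs hfr => ?_⟩
  have hC := H.bdd.nonneg
  set v := mollify s ε f with hv
  set N := ‖sobolevLp r f‖
  set M := ‖sobolevLp s f‖
  have hN0 : 0 ≤ N := norm_nonneg _
  have hvM : ‖v‖ ≤ M := norm_mollify_le hs0 hε hfs
  have hP := bddMeas_dispersion h0.le hs0 hε he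
  have hQ := bddMeas_transport hs0 hε he
  obtain ⟨-, hcom⟩ := hK₁ φ h H v (memLp_mollify hs0 hε f)
  obtain ⟨h1, h1le⟩ := hD f hfr
  have hU := integrable_of_integrable_bracket_mul h1
  have htr := abs_re_inner_transport_le (by linarith) he (hCa ε hε) H.bdd hC H.lip
    (sobolevLp s f) (fourierL2_eq_mulOp hs0 hfs) h1 (ofReal_re_fourierInv_fourierL2 hU)
    (fourier_mollify s ε f)
  rw [fourierInv_fourierL2] at htr
  have hdisp : (inner ℂ (𝓕 (rmul φ v) : L2C n) (mulOp (fun ξ =>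
      Complex.I * (((2 * Real.pi * ‖ξ‖) ^ α * ang ξ e * moll s ε ξ : ℝ) : ℂ)) (fourierL2 f))).re
      = p * (∫ ξ, starRingEnd ℂ ((𝓕 (rmul φ v) : L2C n) ξ) *
        (Complex.I * ((inner ℝ e ξ * ‖ξ‖ ^ α : ℝ) : ℂ) * (𝓕 v : L2C n) ξ)).re := by
    rw [← Complex.re_ofReal_mul, ← integral_const_mul, inner_eq_integral]
    congr 1
    refine integral_congr_ae ?_
    filter_upwards [hP.coeFn (fourierL2 f), (bddMeas_moll hs0 hε).coeFn (fourierL2 f)] with ξ e1 e2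
    rw [e1, hv, fourier_mollify, e2, hp, Real.rpow_add (by positivity), Real.rpow_one,
      Real.mul_rpow (by positivity) (norm_nonneg _), ang, real_inner_comm ξ e]
    push_cast; ring
  rw [← inner_fourier, FourierTransform.fourier_fourierInv_eq, mollRhs, inner_sub_right,
    Complex.sub_re, hdisp]
  have htr2 : -(Ca ^ 2 * (3 * C + C) * (∫ ζ, bracket ζ * ‖fourierL2 f ζ‖) * M ^ 2) ≤
      (inner ℂ (𝓕 (rmul φ v) : L2C n) (mulOp (fun ξ =>
        Complex.I * (ang ξ e : ℂ) / 2 * (moll s ε ξ : ℂ)) (𝓕 (sqLp f)))).re := neg_le_of_abs_le htr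
  have h3 : K₁ * ‖v‖ ^ 2 ≤ |K₁| * M ^ 2 := by
    have := le_abs_self K₁
    gcongr
  have h4 : Ca ^ 2 * (3 * C + C) * (∫ ζ, bracket ζ * ‖fourierL2 f ζ‖) * M ^ 2
      ≤ K₂ * N * M ^ 2 := by
    rw [hK₂, abs_of_nonneg hC]
    calc _ ≤ Ca ^ 2 * (3 * C + C) * (D * N) * M ^ 2 := by gcongr
      _ = _ := by ring
  have h5 : p * (∫ ξ, starRingEnd ℂ ((𝓕 (rmul φ v) : L2C n) ξ) *
        (Complex.I * ((inner ℝ e ξ * ‖ξ‖ ^ α : ℝ) : ℂ) * (𝓕 v : L2C n) ξ)).re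
      ≤ p * (-(c₀ / (4 * Real.pi)) * (∫ ξ, ‖ξ‖ ^ α * ‖(𝓕 (rmul h v) : L2C n) ξ‖ ^ 2)
          + |K₁| * M ^ 2) := by
    gcongr
    linarith
  have h6 : 0 ≤ p * |K₁| * N * M ^ 2 := by positivity
  have h7 : 0 ≤ K₂ * M ^ 2 := by positivity
  set Q := ∫ ξ, ‖ξ‖ ^ α * ‖(𝓕 (rmul h v) : L2C n) ξ‖ ^ 2
  linarith

/-- The weighted energy estimate for the truncated derivative: the time integral of
`‖|ξ|^{α/2} 𝓕(h J^s_ε u)‖²`, uniformly in `ε`. -/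
theorem exists_energy_estimate [NeZero n] {α s r : ℝ} (h0 : 0 < α) (h2 : α < 2)
    (hs : (n : ℝ) / 2 + 1 < s) (hr : (n : ℝ) / 2 + 1 < r) (hrs : r ≤ s) (ν : E n) {c₀ : ℝ}
    (hc₀ : 0 < c₀) (hell : ∀ ξ : E n, c₀ * ‖ξ‖ ^ 2 ≤
      inner ℝ (basisVec 0) ν * ‖ξ‖ ^ 2 + α * (inner ℝ (basisVec 0) ξ * inner ℝ ν ξ)) (C : ℝ) :
    ∃ K : ℝ, 0 ≤ K ∧ ∀ φ h : E n → ℝ, WeightData ν φ h C → ∀ ε : ℝ, 0 < ε →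
      ∀ (T : ℝ) (u : ℝ → L2 n), ContinuousInSobolev s T u → IsSolution α T u →
      ∀ t₁ t₂ : ℝ, 0 < t₁ → t₁ ≤ t₂ → t₂ < T → ∀ M N : ℝ,
        (∀ t ∈ Icc t₁ t₂, ‖sobolevLp s (u t)‖ ≤ M) → (∀ t ∈ Icc t₁ t₂, ‖sobolevLp r (u t)‖ ≤ N) →
        ∫⁻ t in Icc t₁ t₂, ENNReal.ofReal
          (∫ ξ, ‖ξ‖ ^ α * ‖(𝓕 (rmul h (mollify s ε (u t))) : L2C n) ξ‖ ^ 2)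
          ≤ ENNReal.ofReal (K * (1 + (t₂ - t₁) * (1 + N)) * M ^ 2) := by
  have hn : (0 : ℝ) ≤ n := Nat.cast_nonneg n
  have hs0 : 0 ≤ s := by linarith
  obtain ⟨c₁, K, hc₁, hK, H⟩ := exists_energy_deriv_le h0 h2 hs hr ν hc₀ hell C
  refine ⟨(2 * |C| + K) / c₁, by positivity, fun φ h W ε hε T u hu hsol t₁ t₂ ht₁ ht ht₂ M N hM hN => ?_⟩
  have hC := W.bdd.nonneg
  rw [abs_of_nonneg hC]
  set e : E n := basisVec 0
  obtain ⟨hcont, hder⟩ := hasDerivAt_moll h0.le hs hs0 hε hu hsol (σ := s) (ε := ε)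
  have hsub : Icc t₁ t₂ ⊆ Ioo 0 T := fun t ht' => ⟨ht₁.trans_le ht'.1, ht'.2.trans_lt ht₂⟩
  set FI : L2C n →L[ℂ] L2C n :=
    ((Lp.fourierTransformₗᵢ (E n) ℂ).symm.toContinuousLinearEquiv).toContinuousLinearMap
  have hFI : ∀ f : L2C n, FI f = 𝓕⁻ f := fun f => rfl
  set v : ℝ → L2C n := fun t => mollify s ε (u t) with hv
  set B : ℝ → L2C n := fun t => 𝓕⁻ (mollRhs α s ε e (u t)) with hB
  have hvd : ∀ t ∈ Ioo 0 T, HasDerivAt v (B t) t := fun t ht' =>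
    (FI.restrictScalars ℝ).hasFDerivAt.comp_hasDerivAt t (hder t ht')
  -- the weighted energy `⟨φ v, v⟩` and its derivative
  set Φ : L2C n →L[ℂ] L2C n := W.bdd.bddMeas.clm
  set g : ℝ → ℝ := fun t => (inner ℂ (Φ (v t)) (v t)).re with hg
  set g' : ℝ → ℝ := fun t => 2 * (inner ℂ (Φ (v t)) (B t)).re with hg'
  have hgd : ∀ t ∈ Ioo 0 T, HasDerivAt g (g' t) t := fun t ht' => by
    have e1 : HasDerivAt (fun t => Φ (v t)) (Φ (B t)) t :=
      (Φ.restrictScalars ℝ).hasFDerivAt.comp_hasDerivAt t (hvd t ht')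
    have e2 := e1.inner ℂ (hvd t ht')
    have e3 := Complex.reCLM.hasFDerivAt.comp_hasDerivAt t e2
    refine e3.congr_deriv ?_
    have e4 : inner ℂ (Φ (B t)) (v t) = starRingEnd ℂ (inner ℂ (Φ (v t)) (B t)) := by
      rw [inner_conj_symm]
      exact W.bdd.inner_rmul_left (B t) (v t)
    simp only [hg']
    rw [e4, Complex.reCLM_apply, Complex.add_re, Complex.conj_re]; ring
  have hBc : ContinuousOn B (Icc t₁ t₂) := (continuous_fourierInv.comp_continuousOn hcont).mono hsub
  have hvc : ContinuousOn v (Icc t₁ t₂) := fun t ht' =>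
    (hvd t (hsub ht')).continuousAt.continuousWithinAt
  have hg'c : ContinuousOn g' (Icc t₁ t₂) :=
    continuousOn_const.mul (Complex.continuous_re.comp_continuousOn
      (ContinuousOn.inner (𝕜 := ℂ) (Φ.continuous.comp_continuousOn hvc) hBc))
  have hfs : ∀ t ∈ Icc t₁ t₂, sobolevNorm s (u t) < ⊤ := fun t ht' => (hu t (hsub ht')).1
  have hM0 : 0 ≤ M := (norm_nonneg _).trans (hM t₁ (left_mem_Icc.2 ht))
  have hN0 : 0 ≤ N := (norm_nonneg _).trans (hN t₁ (left_mem_Icc.2 ht))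
  set Q : ℝ → ℝ := fun t => ∫ ξ, ‖ξ‖ ^ α * ‖(𝓕 (rmul h (v t)) : L2C n) ξ‖ ^ 2 with hQ
  have hQ0 : ∀ t, 0 ≤ Q t := fun t => integral_nonneg fun ξ => by positivity
  have hkey : ∀ t ∈ Icc t₁ t₂, c₁ * Q t ≤ -g' t + K * (1 + N) * M ^ 2 := fun t ht' => by
    have e1 := H φ h W ε hε (u t) (hfs t ht') ((sobolevNorm_mono hrs _).trans_lt (hfs t ht'))
    have e2 : K * (1 + ‖sobolevLp r (u t)‖) * ‖sobolevLp s (u t)‖ ^ 2 ≤ K * (1 + N) * M ^ 2 := by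
      have := hM t ht'
      have := hN t ht'
      gcongr
    have e3 : g' t ≤ -c₁ * Q t + K * (1 + ‖sobolevLp r (u t)‖) * ‖sobolevLp s (u t)‖ ^ 2 := e1
    linarith
  have hgle : ∀ t ∈ Icc t₁ t₂, |g t| ≤ C * M ^ 2 := fun t ht' => by
    have e1 : ‖v t‖ ≤ M := (norm_mollify_le hs0 hε (hfs t ht')).trans (hM t ht')
    have e2 : ‖Φ (v t)‖ ≤ C * ‖v t‖ := W.bdd.bddMeas.norm_le (v t)
    calc |g t| ≤ ‖Φ (v t)‖ * ‖v t‖ := (Complex.abs_re_le_norm _).trans (norm_inner_le_norm _ _)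
      _ ≤ (C * M) * M := by
          gcongr
          exact e2.trans (by gcongr)
      _ = _ := by ring
  have hFTC : ∫ t in t₁..t₂, g' t = g t₂ - g t₁ := by
    refine intervalIntegral.integral_eq_sub_of_hasDerivAt (fun t ht' => ?_) ?_
    · rw [uIcc_of_le ht] at ht'
      exact hgd t (hsub ht')
    · exact (by rwa [uIcc_of_le ht] : ContinuousOn g' (uIcc t₁ t₂)).intervalIntegrable
  have hGi : IntegrableOn (fun t => c₁⁻¹ * (-g' t + K * (1 + N) * M ^ 2)) (Icc t₁ t₂) :=
    (continuousOn_const.mul (hg'c.neg.add continuousOn_const)).integrableOn_Icc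
  calc ∫⁻ t in Icc t₁ t₂, ENNReal.ofReal (Q t)
      ≤ ∫⁻ t in Icc t₁ t₂, ENNReal.ofReal (c₁⁻¹ * (-g' t + K * (1 + N) * M ^ 2)) := by
        refine setLIntegral_mono' measurableSet_Icc fun t ht' => ENNReal.ofReal_le_ofReal ?_
        rw [← div_eq_inv_mul, le_div_iff₀' hc₁]
        exact hkey t ht'
    _ = ENNReal.ofReal (∫ t in Icc t₁ t₂, c₁⁻¹ * (-g' t + K * (1 + N) * M ^ 2)) := by
        rw [ofReal_integral_eq_lintegral_ofReal hGi]
        refine (ae_restrict_mem measurableSet_Icc).mono fun t ht' => ?_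
        have := hkey t ht'
        have := hQ0 t
        exact mul_nonneg (inv_pos.2 hc₁).le (by nlinarith)
    _ ≤ _ := by
        refine ENNReal.ofReal_le_ofReal ?_
        have hgi : IntegrableOn (fun t => -g' t) (Icc t₁ t₂) := hg'c.neg.integrableOn_Icc
        rw [integral_const_mul, integral_add hgi continuousOn_const.integrableOn_Icc, integral_neg,
          integral_Icc_eq_integral_Ioc, ← intervalIntegral.integral_of_le ht, hFTC]
        simp only [integral_const, smul_eq_mul, MeasurableSet.univ, measureReal_restrict_apply,
          univ_inter, Real.volume_real_Icc_of_le ht]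
        rw [← div_eq_inv_mul, div_mul_eq_mul_div, div_mul_eq_mul_div]
        gcongr
        have a1 := (abs_le.1 (hgle t₁ (left_mem_Icc.2 ht))).2
        have a2 := (abs_le.1 (hgle t₂ (right_mem_Icc.2 ht))).1
        have a3 : 0 ≤ t₂ - t₁ := by linarith
        have a4 : 0 ≤ C * ((t₂ - t₁) * (1 + N)) * M ^ 2 := by positivity
        have a5 : 0 ≤ K * M ^ 2 := by positivity
        nlinarith

/-! ### Removal of the truncation -/

theorem eLpNorm_two_sq {X F : Type*} [MeasurableSpace X] [NormedAddCommGroup F] (f : X → F)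
    (μ : Measure X) : eLpNorm f 2 μ ^ 2 = ∫⁻ x, ‖f x‖ₑ ^ 2 ∂μ := by
  have h := eLpNorm_nnreal_pow_eq_lintegral (f := f) (μ := μ) (p := 2) (by norm_num)
  norm_num at h
  exact h

/-- The symbol `|ξ|^β` restricted to the ball of radius `R`. -/
def truncPow (β : ℝ) (R : ℕ) (ξ : E n) : ℂ := if ‖ξ‖ ≤ R then ((‖ξ‖ ^ β : ℝ) : ℂ) else 0

theorem norm_truncPow_le (β : ℝ) (R : ℕ) (ξ : E n) : ‖truncPow β R ξ‖ ≤ ‖ξ‖ ^ β := by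
  unfold truncPow
  split_ifs
  · rw [Complex.norm_real, Real.norm_of_nonneg (by positivity)]
  · rw [norm_zero]; positivity

theorem bddMeas_truncPow {β : ℝ} (hβ : 0 ≤ β) (R : ℕ) :
    BddMeas (truncPow β R : E n → ℂ) ((R : ℝ) ^ β) := by
  refine ⟨Measurable.ite (measurableSet_le (by fun_prop) (by fun_prop)) (by fun_prop) (by fun_prop),
    fun ξ => ?_⟩
  unfold truncPow
  split_ifs with h
  · rw [Complex.norm_real, Real.norm_of_nonneg (by positivity)]
    exact Real.rpow_le_rpow (norm_nonneg _) h hβ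
  · rw [norm_zero]; positivity

/-- The norm of `|ξ|^β W` in `L²`, possibly infinite. -/
def fracNorm (β : ℝ) (W : L2C n) : ℝ≥0∞ :=
  eLpNorm (fun ξ => ((‖ξ‖ ^ β : ℝ) : ℂ) * W ξ) 2 volume

theorem enorm_mulOp_sq {m : E n → ℂ} {C : ℝ} (hm : BddMeas m C) (W : L2C n) :
    ‖mulOp m W‖ₑ ^ 2 = ∫⁻ ξ, ‖m ξ * W ξ‖ₑ ^ 2 := by
  rw [Lp.enorm_def, eLpNorm_congr_ae (hm.coeFn W), eLpNorm_two_sq]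

theorem monotone_truncPow {β : ℝ} (W : L2C n) (ξ : E n) :
    Monotone fun R : ℕ => ‖truncPow β R ξ * W ξ‖ₑ ^ 2 := by
  intro R S hRS
  have h : ‖truncPow β R ξ‖ₑ ≤ ‖truncPow β S ξ‖ₑ := by
    unfold truncPow
    split_ifs with h1 h2
    · exact le_rfl
    · exact absurd (h1.trans (by exact_mod_cast hRS)) h2
    · rw [enorm_zero]; exact zero_le
    · exact le_rfl
  simp only [enorm_mul]
  gcongr

theorem fracNorm_sq_eq_iSup {β : ℝ} (hβ : 0 ≤ β) (W : L2C n) :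
    fracNorm β W ^ 2 = ⨆ R : ℕ, ‖mulOp (truncPow β R) W‖ₑ ^ 2 := by
  simp_rw [enorm_mulOp_sq (bddMeas_truncPow hβ _)]
  rw [fracNorm, eLpNorm_two_sq, ← lintegral_iSup']
  · refine lintegral_congr fun ξ => le_antisymm ?_ (iSup_le fun R => ?_)
    · obtain ⟨R, hR⟩ := exists_nat_ge ‖ξ‖
      refine le_iSup_of_le R (le_of_eq ?_)
      rw [truncPow, if_pos hR]
    · have : ‖truncPow β R ξ‖ₑ ≤ ‖((‖ξ‖ ^ β : ℝ) : ℂ)‖ₑ := by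
        rw [enorm_le_iff_norm_le, Complex.norm_real, Real.norm_of_nonneg (by positivity)]
        exact norm_truncPow_le β R ξ
      simp only [enorm_mul]
      gcongr
  · exact fun R => (((bddMeas_truncPow hβ R).1.aestronglyMeasurable.mul
      (Lp.aestronglyMeasurable W)).enorm).pow_const 2
  · exact Eventually.of_forall fun ξ => monotone_truncPow W ξ

theorem monotone_enorm_truncPow {β : ℝ} (hβ : 0 ≤ β) (W : L2C n) :
    Monotone fun R : ℕ => ‖mulOp (truncPow β R) W‖ₑ ^ 2 := by
  intro R S hRS
  simp only [enorm_mulOp_sq (bddMeas_truncPow hβ _)]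
  exact lintegral_mono fun ξ => monotone_truncPow W ξ hRS

theorem enorm_truncPow_sq_le {β : ℝ} (hβ : 0 ≤ β) (R : ℕ) (W : L2C n)
    (hW : Integrable fun ξ => ‖ξ‖ ^ (2 * β) * ‖W ξ‖ ^ 2) :
    ‖mulOp (truncPow β R) W‖ₑ ^ 2 ≤ ENNReal.ofReal (∫ ξ, ‖ξ‖ ^ (2 * β) * ‖W ξ‖ ^ 2) := by
  rw [enorm_mulOp_sq (bddMeas_truncPow hβ R), ofReal_integral_eq_lintegral_ofReal hW
    (Eventually.of_forall fun ξ => by positivity)]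
  refine lintegral_mono fun ξ => ?_
  rw [← ofReal_norm, ← ENNReal.ofReal_pow (norm_nonneg _)]
  refine ENNReal.ofReal_le_ofReal ?_
  rw [norm_mul, mul_pow]
  gcongr
  calc ‖truncPow β R ξ‖ ^ 2 ≤ (‖ξ‖ ^ β) ^ 2 := by
        gcongr; exact norm_truncPow_le β R ξ
    _ = ‖ξ‖ ^ (2 * β) := by
        rw [← Real.rpow_natCast, ← Real.rpow_mul (norm_nonneg _), mul_comm]; norm_num

/-- `J^s f`. -/
def besselLp (s : ℝ) (f : L2 n) : L2C n := 𝓕⁻ (sobolevLp s f)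

theorem tendsto_mollify {s : ℝ} (hs : 0 ≤ s) {f : L2 n} (hf : sobolevNorm s f < ⊤) :
    Tendsto (fun k : ℕ => mollify s (1 / ((k : ℝ) + 1)) f) atTop (𝓝 (besselLp s f)) := by
  refine (continuous_fourierInv.tendsto _).comp ?_
  rw [tendsto_iff_norm_sub_tendsto_zero]
  set V := sobolevLp s f
  set t : ℕ → ℝ := fun k => 1 / ((k : ℝ) + 1) with ht
  have htpos : ∀ k, 0 < t k := fun k => by positivity
  have hsq : Tendsto (fun k => ‖mulOp (fun ξ => (moll s (t k) ξ : ℂ)) (fourierL2 f) - V‖ ^ 2)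
      atTop (𝓝 0) := by
    have hcongr : ∀ k, ‖mulOp (fun ξ => (moll s (t k) ξ : ℂ)) (fourierL2 f) - V‖ ^ 2
        = ∫ ξ, (1 - cutoff (t k * bracket ξ)) ^ 2 * ‖V ξ‖ ^ 2 := fun k => by
      rw [norm_sq_eq_integral]
      refine integral_congr_ae ?_
      filter_upwards [Lp.coeFn_sub (mulOp (fun ξ => (moll s (t k) ξ : ℂ)) (fourierL2 f)) V,
        (bddMeas_moll hs (htpos k)).coeFn (fourierL2 f), coeFn_sobolevLp hf] with ξ e1 e2 e3
      rw [e1, Pi.sub_apply, e2, e3, moll, ← sub_mul, ← Complex.ofReal_sub, norm_mul,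
        norm_mul, mul_pow, mul_pow, Complex.norm_real, Complex.norm_real, Real.norm_eq_abs,
        Real.norm_eq_abs, sq_abs, sq_abs]
      ring
    simp_rw [hcongr]
    suffices h : Tendsto (fun k => ∫ ξ, (1 - cutoff (t k * bracket ξ)) ^ 2 * ‖V ξ‖ ^ 2) atTop
        (𝓝 (∫ ξ : E n, (0 : ℝ))) by simpa using h
    have hcm : ∀ k, Measurable fun ξ : E n => (cutoff (t k * bracket ξ) : ℝ) := fun k =>
      cutoff.continuous.measurable.comp (by fun_prop)
    refine tendsto_integral_of_dominated_convergence (fun ξ => ‖V ξ‖ ^ 2)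
      (fun k => (Measurable.aestronglyMeasurable (by have := hcm k; fun_prop)).mul
        (integrable_norm_sq V).aestronglyMeasurable) (integrable_norm_sq V) (fun k => ?_) ?_
    · refine Eventually.of_forall fun ξ => ?_
      rw [Real.norm_of_nonneg (by positivity)]
      refine mul_le_of_le_one_left (by positivity) ?_
      have h1 : (cutoff (t k * bracket ξ) : ℝ) ≤ 1 := cutoff.le_one
      have h2 : (0 : ℝ) ≤ cutoff (t k * bracket ξ) := cutoff.nonneg
      nlinarith
    · refine Eventually.of_forall fun ξ => ?_
      refine tendsto_const_nhds.congr' ?_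
      have h1 : Tendsto (fun k => t k * bracket ξ) atTop (𝓝 0) := by
        simpa [ht] using tendsto_one_div_add_atTop_nhds_zero_nat.mul_const (bracket ξ)
      filter_upwards [h1.eventually_le_const one_pos] with k hk
      rw [cutoff_eq_one (mul_nonneg (htpos k).le (bracket_pos ξ).le) hk]; simp
  have := hsq.sqrt
  simp only [Real.sqrt_sq (norm_nonneg _), Real.sqrt_zero] at this
  exact this

theorem continuousOn_besselLp {s T : ℝ} {u : ℝ → L2 n} (hu : ContinuousInSobolev s T u) :
    ContinuousOn (fun t => besselLp s (u t)) (Ioo 0 T) :=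
  continuous_fourierInv.comp_continuousOn (continuousOn_sobolevLp hu)

theorem continuousOn_mollify {s T σ ε : ℝ} (hs : 0 ≤ s) (hσ : 0 ≤ σ) (hε : 0 < ε) {u : ℝ → L2 n}
    (hu : ContinuousInSobolev s T u) : ContinuousOn (fun t => mollify σ ε (u t)) (Ioo 0 T) :=
  continuous_fourierInv.comp_continuousOn
    ((bddMeas_moll hσ hε).continuous.comp_continuousOn (continuousOn_fourierL2 hs hu))

/-- The gain of `α/2` derivatives on a compact time interval, in the weighted space. -/
theorem exists_smoothing [NeZero n] {α s r : ℝ} (h0 : 0 < α) (h2 : α < 2)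
    (hs : (n : ℝ) / 2 + 1 < s) (hr : (n : ℝ) / 2 + 1 < r) (hrs : r ≤ s) (ν : E n) {c₀ : ℝ}
    (hc₀ : 0 < c₀) (hell : ∀ ξ : E n, c₀ * ‖ξ‖ ^ 2 ≤
      inner ℝ (basisVec 0) ν * ‖ξ‖ ^ 2 + α * (inner ℝ (basisVec 0) ξ * inner ℝ ν ξ)) (C : ℝ) :
    ∃ K : ℝ, 0 ≤ K ∧ ∀ φ h : E n → ℝ, WeightData ν φ h C →
      ∀ (T : ℝ) (u : ℝ → L2 n), ContinuousInSobolev s T u → IsSolution α T u →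
      ∀ t₁ t₂ : ℝ, 0 < t₁ → t₁ ≤ t₂ → t₂ < T → ∀ M N : ℝ,
        (∀ t ∈ Icc t₁ t₂, ‖sobolevLp s (u t)‖ ≤ M) → (∀ t ∈ Icc t₁ t₂, ‖sobolevLp r (u t)‖ ≤ N) →
        ∫⁻ t in Icc t₁ t₂, fracNorm (α / 2) (𝓕 (rmul h (besselLp s (u t)))) ^ 2
          ≤ ENNReal.ofReal (K * (1 + (t₂ - t₁) * (1 + N)) * M ^ 2) := by
  obtain ⟨K, hK0, hK⟩ := exists_energy_estimate h0 h2 hs hr hrs ν hc₀ hell C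
  obtain ⟨K₁, hK₁⟩ := commutator_estimate ν (basisVec 0) h0 h2 hc₀ hell C
  refine ⟨K, hK0, fun φ h W T u hu hsol t₁ t₂ ht₁ ht ht₂ M N hM hN => ?_⟩
  have hn : (0 : ℝ) ≤ n := Nat.cast_nonneg n
  have hs0 : 0 ≤ s := by linarith
  have hβ : 0 ≤ α / 2 := by positivity
  have hsub : Icc t₁ t₂ ⊆ Ioo 0 T := fun t ht' => ⟨ht₁.trans_le ht'.1, ht'.2.trans_lt ht₂⟩
  set ε : ℕ → ℝ := fun k => 1 / ((k : ℝ) + 1) with hεd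
  have hε : ∀ k, 0 < ε k := fun k => by positivity
  have hop : ∀ R : ℕ, Continuous fun w : L2C n => ‖mulOp (truncPow (α / 2) R) (𝓕 (rmul h w))‖ₑ ^ 2 :=
    fun R => (ENNReal.continuous_pow 2).comp (continuous_enorm.comp
      ((bddMeas_truncPow hβ R).continuous.comp
        (continuous_fourier.comp W.bdd_h.bddMeas.continuous)))
  have hmeas : ∀ (R : ℕ) {w : ℝ → L2C n}, ContinuousOn w (Ioo 0 T) →
      AEMeasurable (fun t => ‖mulOp (truncPow (α / 2) R) (𝓕 (rmul h (w t)))‖ₑ ^ 2)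
        (volume.restrict (Icc t₁ t₂)) := fun R w hw =>
    (((hop R).comp_continuousOn hw).mono hsub).aemeasurable measurableSet_Icc
  -- Fatou's lemma removes the truncation `ε`, and monotone convergence the truncation `R`, which
  -- makes the integrand continuous in time
  have hR : ∀ R : ℕ, ∫⁻ t in Icc t₁ t₂,
      ‖mulOp (truncPow (α / 2) R) (𝓕 (rmul h (besselLp s (u t))))‖ₑ ^ 2
      ≤ ENNReal.ofReal (K * (1 + (t₂ - t₁) * (1 + N)) * M ^ 2) := fun R => by
    calc _ ≤ ∫⁻ t in Icc t₁ t₂, liminf (fun k =>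
          ‖mulOp (truncPow (α / 2) R) (𝓕 (rmul h (mollify s (ε k) (u t))))‖ₑ ^ 2) atTop := by
          refine setLIntegral_mono' measurableSet_Icc fun t ht' => le_of_eq ?_
          have := ((hop R).tendsto _).comp (tendsto_mollify hs0 (hu t (hsub ht')).1)
          exact this.liminf_eq.symm
      _ ≤ liminf (fun k => ∫⁻ t in Icc t₁ t₂,
          ‖mulOp (truncPow (α / 2) R) (𝓕 (rmul h (mollify s (ε k) (u t))))‖ₑ ^ 2) atTop :=
          lintegral_liminf_le' fun k => hmeas R (continuousOn_mollify hs0 hs0 (hε k) hu)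
      _ ≤ _ := by
          refine liminf_le_of_frequently_le' (Frequently.of_forall fun k => ?_)
          refine le_trans ?_ (hK φ h W (ε k) (hε k) T u hu hsol t₁ t₂ ht₁ ht ht₂ M N hM hN)
          refine lintegral_mono fun t => ?_
          have h3 := (hK₁ φ h W _ (memLp_mollify hs0 (hε k) (u t))).1
          have h4 : 2 * (α / 2) = α := by ring
          have := enorm_truncPow_sq_le hβ R (𝓕 (rmul h (mollify s (ε k) (u t)))) (by rw [h4]; exact h3)
          rwa [h4] at this
  simp_rw [fracNorm_sq_eq_iSup hβ]
  rw [lintegral_iSup' (fun R => hmeas R (continuousOn_besselLp hu))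
    (Eventually.of_forall fun t => monotone_enorm_truncPow hβ _)]
  exact iSup_le hR

/-! ### The commutator with `|D|^β` -/

/-- The commutator of the translation by `z` with multiplication by `h`. -/
def trComm {h : E n → ℝ} {C : ℝ} (hb : BddReal h C) (z : E n) : L2C n →L[ℂ] L2C n :=
  (tr z).comp hb.bddMeas.clm - hb.bddMeas.clm.comp (tr z)

theorem trComm_apply {h : E n → ℝ} {C : ℝ} (hb : BddReal h C) (z : E n) (χ : L2C n) :
    trComm hb z χ = tr z (rmul h χ) - rmul h (tr z χ) := rfl

theorem norm_trComm_le {h : E n → ℝ} {C : ℝ} (hb : BddReal h C)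
    (hL : ∀ x z, |h (x + z) - h x| ≤ C * ‖z‖) (z : E n) (χ : L2C n) :
    ‖trComm hb z χ‖ ≤ 2 * C * min 1 ‖z‖ * ‖χ‖ := by
  have hC := hb.nonneg
  rw [trComm_apply, ← norm_tr z χ]
  refine Lp.norm_le_mul_norm_of_ae_le_mul ?_
  have q := (measurePreserving_add_right (volume : Measure (E n)) z).quasiMeasurePreserving
  filter_upwards [Lp.coeFn_sub (tr z (rmul h χ)) (rmul h (tr z χ)), coeFn_tr z (rmul h χ),
    q.ae_eq_comp (hb.bddMeas.coeFn χ), hb.bddMeas.coeFn (tr z χ), coeFn_tr z χ] with x h1 h2 h3 h4 h5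
  simp only [Function.comp_apply] at h3
  rw [h1, Pi.sub_apply, h2, h3, h4, h5, ← sub_mul, ← Complex.ofReal_sub, norm_mul,
    Complex.norm_real, Real.norm_eq_abs]
  gcongr
  have e1 := hL x z
  have e2 : |h (x + z) - h x| ≤ 2 * C := by
    have a1 := abs_le.1 (hb.2 (x + z))
    have a2 := abs_le.1 (hb.2 x)
    exact abs_le.2 ⟨by linarith, by linarith⟩
  rcases le_total 1 ‖z‖ with hz | hz
  · rw [min_eq_left hz]; linarith
  · rw [min_eq_right hz]
    nlinarith [mul_nonneg hC (norm_nonneg z)]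

theorem continuous_trComm {h : E n → ℝ} {C : ℝ} (hb : BddReal h C) (χ : L2C n) :
    Continuous fun z => trComm hb z χ := by
  simp only [trComm_apply]
  exact (continuous_tr _).sub (hb.bddMeas.continuous.comp (continuous_tr χ))

/-- The integrand in the representation of `[|D|^β, h]` by translations; it is integrable because
`h` is Lipschitz and `β < 1`. -/
def commKer {h : E n → ℝ} {C : ℝ} (hb : BddReal h C) (β : ℝ) (p : ℝ × E n) : L2C n →L[ℂ] L2C n :=
  ((p.1 ^ (-1 - β) : ℝ) : ℂ) • (trComm hb (p.1 • p.2) - trComm hb ((2 : ℝ) • p.1 • p.2))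

theorem norm_commKer_le {h : E n → ℝ} {C : ℝ} (hb : BddReal h C)
    (hL : ∀ x z, |h (x + z) - h x| ≤ C * ‖z‖) (β : ℝ) (χ : L2C n) {σ : ℝ} (hσ : 0 < σ) (y : E n) :
    ‖commKer hb β (σ, y) χ‖
      ≤ (6 * C * ‖χ‖) * (σ ^ (-1 - β) * min 1 (σ ^ 1) * (1 + ‖y‖) ^ 1) := by
  have hC := hb.nonneg
  have hr := Real.rpow_pos_of_pos hσ (-1 - β)
  have key : ∀ k : ℝ, 1 ≤ k → min 1 (k * (σ * ‖y‖)) ≤ k * (min 1 (σ ^ 1) * (1 + ‖y‖) ^ 1) :=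
    fun k hk => by
      rw [pow_one, pow_one]
      have hy := norm_nonneg y
      rcases le_total 1 σ with h1 | h1
      · rw [min_eq_left h1]
        refine (min_le_left _ _).trans ?_
        nlinarith
      · rw [min_eq_right h1]
        refine (min_le_right _ _).trans ?_
        have : 0 ≤ k * σ := by positivity
        nlinarith
  have e1 := norm_trComm_le hb hL (σ • y) χ
  have e2 := norm_trComm_le hb hL ((2 : ℝ) • σ • y) χ
  rw [norm_smul, Real.norm_of_nonneg hσ.le] at e1
  rw [norm_smul, norm_smul, Real.norm_of_nonneg hσ.le, Real.norm_ofNat] at e2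
  have k1 := key 1 le_rfl
  have k2 := key 2 one_le_two
  rw [one_mul, one_mul] at k1
  set m := min 1 (σ ^ 1) * (1 + ‖y‖) ^ 1 with hm
  have e3 : ‖commKer hb β (σ, y) χ‖
      = σ ^ (-1 - β) * ‖trComm hb (σ • y) χ - trComm hb ((2 : ℝ) • σ • y) χ‖ := by
    rw [commKer, smul_apply, norm_smul, sub_apply,
      Complex.norm_real, Real.norm_of_nonneg hr.le]
  rw [e3]
  calc σ ^ (-1 - β) * ‖trComm hb (σ • y) χ - trComm hb ((2 : ℝ) • σ • y) χ‖
      ≤ σ ^ (-1 - β) * (2 * C * m * ‖χ‖ + 2 * C * (2 * m) * ‖χ‖) := by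
        gcongr
        refine (norm_sub_le _ _).trans (add_le_add (e1.trans ?_) (e2.trans ?_)) <;> gcongr
    _ = (6 * C * ‖χ‖) * (σ ^ (-1 - β) * m) := by ring
    _ = _ := by rw [hm]; ring

theorem integrable_commKer {h : E n → ℝ} {C : ℝ} (hb : BddReal h C)
    (hL : ∀ x z, |h (x + z) - h x| ≤ C * ‖z‖) {β : ℝ} (h0 : 0 < β) (h1 : β < 1) (χ : L2C n) :
    Integrable (fun p => commKer hb β p χ) (pm n) := by
  refine integrable_pm_of_le (k := 1) (l := 1) h0 (by exact_mod_cast h1) ?_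
    fun σ hσ y => norm_commKer_le hb hL β χ hσ y
  have hc : Continuous fun p : ℝ × E n =>
      trComm hb (p.1 • p.2) χ - trComm hb ((2 : ℝ) • p.1 • p.2) χ :=
    ((continuous_trComm hb χ).comp (by fun_prop)).sub ((continuous_trComm hb χ).comp (by fun_prop))
  have hm : Measurable fun p : ℝ × E n => ((p.1 ^ (-1 - β) : ℝ) : ℂ) := by fun_prop
  exact hm.aestronglyMeasurable.smul hc.aestronglyMeasurable

/-- The total mass of the majorant of the commutator integrand. -/
def commConst (n : ℕ) (β : ℝ) : ℝ :=
  6 * ∫ p : ℝ × E n, p.1 ^ (-1 - β) * min 1 (p.1 ^ 1) * (1 + ‖p.2‖) ^ 1 ∂pm n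

theorem norm_integral_commKer_le {h : E n → ℝ} {C : ℝ} (hb : BddReal h C)
    (hL : ∀ x z, |h (x + z) - h x| ≤ C * ‖z‖) {β : ℝ} (h0 : 0 < β) (h1 : β < 1) (χ : L2C n) :
    ‖∫ p, commKer hb β p χ ∂pm n‖ ≤ commConst n β * C * ‖χ‖ := by
  have hi : Integrable (fun p : ℝ × E n =>
      p.1 ^ (-1 - β) * min 1 (p.1 ^ 1) * (1 + ‖p.2‖) ^ 1) (pm n) :=
    (integrableOn_weight (k := 1) h0 (by exact_mod_cast h1)).mul_prod (integrable_moment 1)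
  calc _ ≤ ∫ p : ℝ × E n, (6 * C * ‖χ‖) *
        (p.1 ^ (-1 - β) * min 1 (p.1 ^ 1) * (1 + ‖p.2‖) ^ 1) ∂pm n := by
        refine norm_integral_le_of_norm_le (hi.const_mul _) ?_
        filter_upwards [ae_pm_pos] with p hp
        exact norm_commKer_le hb hL β χ hp p.2
    _ = _ := by rw [integral_const_mul, commConst]; ring

/-- The operator `[|D|^β, h]`, up to the factor `subConst β`. -/
def commOp {h : E n → ℝ} {C : ℝ} (hb : BddReal h C)
    (hL : ∀ x z, |h (x + z) - h x| ≤ C * ‖z‖) {β : ℝ} (h0 : 0 < β) (h1 : β < 1) :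
    L2C n →L[ℂ] L2C n :=
  LinearMap.mkContinuous
    { toFun := fun χ => ∫ p, commKer hb β p χ ∂pm n
      map_add' := fun χ χ' => by
        simp only [map_add]
        exact integral_add (integrable_commKer hb hL h0 h1 χ) (integrable_commKer hb hL h0 h1 χ')
      map_smul' := fun c χ => by
        simp only [map_smul, RingHom.id_apply]
        exact integral_smul c _ } (commConst n β * C)
    (norm_integral_commKer_le hb hL h0 h1)

/-- `|ξ|^β` as a superposition of translations. -/
theorem integral_conj_mul_rpow_mul {β : ℝ} (h0 : 0 < β) (h1 : β < 1) (g f : L2C n)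
    (hf : MemLp (fun ξ => ((1 + ‖ξ‖ : ℝ) : ℂ) * (𝓕 f : L2C n) ξ) 2 volume) :
    Integrable (fun p : ℝ × E n => ((p.1 ^ (-1 - β) : ℝ) : ℂ) *
      (inner ℂ g (tr (p.1 • p.2) f) - inner ℂ g (tr ((2 : ℝ) • p.1 • p.2) f))) (pm n) ∧
    (subConst β : ℂ) * ∫ ξ, starRingEnd ℂ ((𝓕 g : L2C n) ξ) *
      (((‖ξ‖ ^ β : ℝ) : ℂ) * (𝓕 f : L2C n) ξ)
      = ∫ p : ℝ × E n, ((p.1 ^ (-1 - β) : ℝ) : ℂ) *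
        (inner ℂ g (tr (p.1 • p.2) f) - inner ℂ g (tr ((2 : ℝ) • p.1 • p.2) f)) ∂pm n := by
  have hB : Integrable (fun p : ℝ × E n =>
      (4 * Real.pi) * (p.1 ^ (-1 - β) * min 1 (p.1 ^ 1) * (1 + ‖p.2‖) ^ 1)) (pm n) :=
    ((integrableOn_weight (k := 1) h0 (by exact_mod_cast h1)).mul_prod
      (integrable_moment 1)).const_mul _
  obtain ⟨hi, he⟩ := integral_superposition (k := fun p ξ => chrKer β ξ p) (g := 𝓕 g) (f := 𝓕 f)
    (G := fun ξ => 1 + ‖ξ‖) (measurable_chrKer β) hB (by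
      filter_upwards [ae_pm_pos] with p hp ξ
      refine (norm_chrKer_le β ξ hp p.2).trans (le_of_eq ?_)
      ring) hf
  have hin : ∀ p : ℝ × E n, ∫ ξ, starRingEnd ℂ ((𝓕 g : L2C n) ξ) * (chrKer β ξ p * (𝓕 f : L2C n) ξ)
      = ((p.1 ^ (-1 - β) : ℝ) : ℂ) *
        (inner ℂ g (tr (p.1 • p.2) f) - inner ℂ g (tr ((2 : ℝ) • p.1 • p.2) f)) := fun p => by
    rw [inner_tr_eq, inner_tr_eq, ← integral_sub (integrable_inner_tr g f _)
      (integrable_inner_tr g f _), ← integral_const_mul]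
    refine integral_congr_ae (Eventually.of_forall fun ξ => ?_)
    simp only [chrKer]; ring
  simp_rw [hin] at hi he
  refine ⟨hi, ?_⟩
  rw [← he, ← integral_const_mul]
  refine integral_congr_ae (Eventually.of_forall fun ξ => ?_)
  simp only [integral_chrKer h0 h1]
  push_cast; ring

/-- Moving `h` from the right to the left of `|D|^β`. -/
theorem integral_rpow_rmul_eq {h : E n → ℝ} {C : ℝ} (hb : BddReal h C)
    (hL : ∀ x z, |h (x + z) - h x| ≤ C * ‖z‖) {β : ℝ} (h0 : 0 < β) (h1 : β < 1) (v χ : L2C n)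
    (hχ : MemLp (fun ξ => ((1 + ‖ξ‖ : ℝ) : ℂ) * (𝓕 χ : L2C n) ξ) 2 volume)
    (hψ : MemLp (fun ξ => ((1 + ‖ξ‖ : ℝ) : ℂ) * (𝓕 (rmul h χ) : L2C n) ξ) 2 volume) :
    (subConst β : ℂ) * (∫ ξ, starRingEnd ℂ ((𝓕 v : L2C n) ξ) *
        (((‖ξ‖ ^ β : ℝ) : ℂ) * (𝓕 (rmul h χ) : L2C n) ξ))
      = (subConst β : ℂ) * (∫ ξ, starRingEnd ℂ ((𝓕 (rmul h v) : L2C n) ξ) *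
        (((‖ξ‖ ^ β : ℝ) : ℂ) * (𝓕 χ : L2C n) ξ)) + inner ℂ v (commOp hb hL h0 h1 χ) := by
  obtain ⟨i1, e1⟩ := integral_conj_mul_rpow_mul h0 h1 v (rmul h χ) hψ
  obtain ⟨i2, e2⟩ := integral_conj_mul_rpow_mul h0 h1 (rmul h v) χ hχ
  have e3 : inner ℂ v (commOp hb hL h0 h1 χ) = ∫ p, inner ℂ v (commKer hb β p χ) ∂pm n :=
    (integral_inner (integrable_commKer hb hL h0 h1 χ) v).symm
  rw [e1, e2, e3, ← sub_eq_iff_eq_add', ← integral_sub i1 i2]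
  refine integral_congr_ae (Eventually.of_forall fun p => ?_)
  simp only
  rw [commKer, smul_apply, inner_smul_right, sub_apply,
    inner_sub_right, trComm_apply, trComm_apply, inner_sub_right, inner_sub_right,
    hb.inner_rmul_left, hb.inner_rmul_left]
  ring

/-! ### Measurable representatives -/

/-- A measurable curve in `L²` has a jointly measurable representative: approximate it by curves
with values in a countable dense set, fast enough for pointwise convergence. -/
theorem exists_measurable_representative {F : ℝ → L2C n} (hF : StronglyMeasurable F) :
    ∃ G : ℝ → E n → ℂ, Measurable (Function.uncurry G) ∧ ∀ t, G t =ᵐ[volume] F t := by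
  classical
  have : Fact ((2 : ℝ≥0∞) ≠ ⊤) := ⟨ENNReal.ofNat_ne_top⟩
  let d := TopologicalSpace.denseSeq (L2C n)
  have hd : ∀ (k : ℕ) (t : ℝ), ∃ i, dist (F t) (d i) < (1 / 2) ^ k := fun k t =>
    (TopologicalSpace.denseRange_denseSeq (L2C n)).exists_dist_lt (F t) (by positivity)
  let N : ℕ → ℝ → ℕ := fun k t => Nat.find (hd k t)
  have hN : ∀ k, Measurable (N k) := fun k => measurable_find (hd k) fun i =>
    measurableSet_lt (hF.dist stronglyMeasurable_const).measurable measurable_const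
  let g : ℕ → ℝ × E n → ℂ := fun k p => d (N k p.1) p.2
  have hg : ∀ k, Measurable (g k) := by
    intro k
    have h1 : Measurable fun q : ℕ × E n => d q.1 q.2 :=
      measurable_from_prod_countable_right fun i => (Lp.stronglyMeasurable (d i)).measurable
    exact h1.comp (((hN k).comp measurable_fst).prodMk measurable_snd)
  refine ⟨fun t x => limUnder atTop fun k => g k (t, x), ?_, fun t => ?_⟩
  · exact (StronglyMeasurable.limUnder (l := atTop) fun k => (hg k).stronglyMeasurable).measurable
  have h2 : ∫⁻ x, ∑' k, ‖g k (t, x) - F t x‖ₑ ^ 2 ≠ ⊤ := by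
    rw [lintegral_tsum fun k => ?_]
    · have h3 : ∀ k, ∫⁻ x, ‖g k (t, x) - F t x‖ₑ ^ 2 ≤ ENNReal.ofReal ((1 / 4) ^ k) := by
        intro k
        have e1 : ∫⁻ x, ‖g k (t, x) - F t x‖ₑ ^ 2 = ‖d (N k t) - F t‖ₑ ^ 2 := by
          rw [Lp.enorm_def, eLpNorm_two_sq]
          refine lintegral_congr_ae ?_
          filter_upwards [Lp.coeFn_sub (d (N k t)) (F t)] with x hx
          rw [hx]; rfl
        rw [e1, ← ofReal_norm, ← ENNReal.ofReal_pow (norm_nonneg _)]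
        refine ENNReal.ofReal_le_ofReal ?_
        have e2 := (Nat.find_spec (hd k t)).le
        rw [dist_comm, dist_eq_norm] at e2
        calc _ ≤ ((1 / 2 : ℝ) ^ k) ^ 2 := by gcongr
          _ = _ := by rw [← pow_mul, mul_comm, pow_mul]; norm_num
      refine ne_top_of_le_ne_top ?_ (ENNReal.tsum_le_tsum h3)
      exact (summable_geometric_of_lt_one (by norm_num) (by norm_num)).tsum_ofReal_ne_top
    · exact ((((Lp.stronglyMeasurable (d (N k t))).measurable.sub
        (Lp.stronglyMeasurable (F t)).measurable).enorm).pow_const 2).aemeasurable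
  have h4 : AEMeasurable (fun x => ∑' k, ‖g k (t, x) - F t x‖ₑ ^ 2) volume :=
    (Measurable.tsum fun k => (((Lp.stronglyMeasurable (d (N k t))).measurable.sub
        (Lp.stronglyMeasurable (F t)).measurable).enorm).pow_const 2).aemeasurable
  filter_upwards [ae_lt_top' h4 h2] with x hx
  refine Tendsto.limUnder_eq ?_
  rw [tendsto_iff_edist_tendsto_0]
  have h5 := ENNReal.tendsto_atTop_zero_of_tsum_ne_top hx.ne
  have h6 := (ENNReal.continuous_rpow_const (y := (1 / 2 : ℝ))).tendsto 0 |>.comp h5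
  simp only [Function.comp_def, ENNReal.zero_rpow_of_pos (by norm_num : (0 : ℝ) < 1 / 2)] at h6
  refine h6.congr fun k => ?_
  rw [edist_eq_enorm_sub, ← ENNReal.rpow_natCast, ← ENNReal.rpow_mul]
  norm_num

/-! ### The localised fractional derivative -/

/-- The bounded symbol `ρ` for which `|ω|^{s+β} = ⟨ω⟩^s (|ω|^β + ρ)`, `ω = 2πξ`. -/
def lowSymbol (s β : ℝ) (ξ : E n) : ℝ :=
  (2 * Real.pi * ‖ξ‖) ^ β * ((2 * Real.pi * ‖ξ‖ / bracket ξ) ^ s - 1)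

theorem rpow_add_eq_lowSymbol {s β : ℝ} (hs : 0 ≤ s) (hβ : 0 < β) (ξ : E n) :
    (2 * Real.pi * ‖ξ‖) ^ (s + β) =
      bracket ξ ^ s * ((2 * Real.pi * ‖ξ‖) ^ β + lowSymbol s β ξ) := by
  have hb := bracket_pos ξ
  have hw : 0 ≤ 2 * Real.pi * ‖ξ‖ := by positivity
  rw [lowSymbol, Real.div_rpow hw hb.le]
  rcases hw.eq_or_lt with h | h
  · rw [← h, Real.zero_rpow (by linarith), Real.zero_rpow hβ.ne']; ring
  · have := (Real.rpow_pos_of_pos hb s).ne'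
    rw [Real.rpow_add h]
    field_simp
    ring

/-- `ρ` is bounded: `(|ω|/⟨ω⟩)^s - 1` is of size `⟨ω⟩^{-2}`, by Bernoulli's inequality. -/
theorem abs_lowSymbol_le {s β : ℝ} (hs : 2 ≤ s) (h0 : 0 < β) (h1 : β < 1) (ξ : E n) :
    |lowSymbol s β ξ| ≤ s / 2 := by
  have hb := bracket_pos ξ
  have hb1 := one_le_bracket ξ
  have hw : 0 ≤ 2 * Real.pi * ‖ξ‖ := by positivity
  set w := 2 * Real.pi * ‖ξ‖ with hwd
  set b := bracket ξ with hbd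
  have hsq : b ^ 2 = 1 + w ^ 2 := sq_bracket ξ
  have hwb : w ≤ b := by nlinarith
  have e1 : (w / b) ^ s = (1 + -(1 / b ^ 2)) ^ (s / 2) := by
    have : 1 + -(1 / b ^ 2) = (w / b) ^ (2 : ℝ) := by
      rw [Real.rpow_two]; field_simp; rw [hsq]; ring
    rw [this, ← Real.rpow_mul (by positivity)]; congr 1; ring
  have e2 : 1 - s / 2 * (1 / b ^ 2) ≤ (w / b) ^ s := by
    rw [e1]
    have h3 : 1 / b ^ 2 ≤ 1 := by rw [div_le_one (by positivity)]; nlinarith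
    have := one_add_mul_self_le_rpow_one_add (s := -(1 / b ^ 2)) (by linarith)
      (p := s / 2) (by linarith)
    linarith
  have e3 : (w / b) ^ s ≤ 1 :=
    Real.rpow_le_one (by positivity) ((div_le_one hb).2 hwb) (by linarith)
  have e4 : w ^ β ≤ b ^ 2 := by
    calc w ^ β ≤ b ^ β := by gcongr
      _ ≤ b ^ (2 : ℝ) := Real.rpow_le_rpow_of_exponent_le hb1 (by linarith)
      _ = _ := Real.rpow_two b
  have e5 : 0 ≤ w ^ β := by positivity
  rw [lowSymbol, abs_mul, abs_of_nonneg e5, abs_of_nonpos (by linarith)]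
  calc _ ≤ b ^ 2 * (s / 2 * (1 / b ^ 2)) :=
        mul_le_mul e4 (by linarith) (by linarith) (by positivity)
    _ = s / 2 := by field_simp

theorem bddMeas_lowSymbol {s β : ℝ} (hs : 2 ≤ s) (h0 : 0 < β) (h1 : β < 1) :
    BddMeas (fun ξ : E n => (lowSymbol s β ξ : ℂ)) (s / 2) := by
  refine ⟨by unfold lowSymbol; fun_prop, fun ξ => ?_⟩
  rw [Complex.norm_real]; exact abs_lowSymbol_le hs h0 h1 ξ

theorem memLp_one_add_norm_mul_fourier (ψ : 𝓢(E n, ℂ)) :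
    MemLp (fun ξ => ((1 + ‖ξ‖ : ℝ) : ℂ) *
      (𝓕 (ψ.toLp 2 (volume : Measure (E n))) : L2C n) ξ) 2 volume := by
  have h := (integrable_and_memLp_mul_schwartz (m := fun ξ : E n => ((1 + ‖ξ‖ : ℝ) : ℂ))
    (by fun_prop) (D := 1) (N := 1) (fun ξ => by
      rw [Complex.norm_real, Real.norm_of_nonneg (by positivity)]; simp) (𝓕 ψ)).2
  refine h.ae_eq ?_
  filter_upwards [fourier_toLp_schwartz ψ] with ξ hξ
  rw [hξ]

/-- `h` times the fractional derivative of order `s + β` of `f`, for a function `h` that localises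
the smoothing effect: with `v = J^s f`, it is
`(2π)^β (|D|^β (h v) + [h, |D|^β] v) + h ρ(D) v`, where `|D|^β` has symbol `|ξ|^β` and `ρ` is
`lowSymbol`. The argument `Y` stands for `|ξ|^β 𝓕(h v)`, so that the definition makes sense for
every `f`; the commutator is the adjoint of `commOp`. -/
def localDeriv {h : E n → ℝ} {C : ℝ} (hb : BddReal h C)
    (hL : ∀ x z, |h (x + z) - h x| ≤ C * ‖z‖) {β : ℝ} (h0 : 0 < β) (h1 : β < 1) (s : ℝ)
    (f : L2 n) (Y : L2C n) : L2C n :=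
  (((2 * Real.pi) ^ β : ℝ) : ℂ) • ((𝓕⁻ Y : L2C n) +
    ((subConst β)⁻¹ : ℂ) • (commOp hb hL h0 h1).adjoint (besselLp s f)) +
  rmul h (𝓕⁻ (mulOp (fun ξ => (lowSymbol s β ξ : ℂ)) (sobolevLp s f)) : L2C n)

/-- Tested against functions divisible by `h`, the distribution `(-Δ)^{(s+β)/2} f` is an `L²`
function divided by `h`. -/
theorem fracLaplacianPairing_eq_inner {h : E n → ℝ} {C : ℝ} (hb : BddReal h C)
    (hL : ∀ x z, |h (x + z) - h x| ≤ C * ‖z‖) {β : ℝ} (h0 : 0 < β) (h1 : β < 1) {s : ℝ}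
    (hs : 2 ≤ s) {f : L2 n} (hf : sobolevNorm s f < ⊤) {Y : L2C n}
    (hY : Y =ᵐ[volume] fun ξ => ((‖ξ‖ ^ β : ℝ) : ℂ) * (𝓕 (rmul h (besselLp s f)) : L2C n) ξ)
    (ψ χ : 𝓢(E n, ℂ)) (hψ : ∀ x, ψ x = h x * χ x) :
    fracLaplacianPairing ((s + β) / 2) f ψ =
      inner ℂ (localDeriv hb hL h0 h1 s f Y) (χ.toLp 2) := by
  have hv : (𝓕 (besselLp s f) : L2C n) = sobolevLp s f := by
    rw [besselLp]; exact FourierTransform.fourier_fourierInv_eq _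
  set V := sobolevLp s f with hV
  set ψL : L2C n := ψ.toLp 2 with hψL
  set χL : L2C n := χ.toLp 2 with hχL
  have hψχ : ψL = rmul h χL := by
    refine Lp.ext ?_
    filter_upwards [ψ.coeFn_toLp 2 volume, χ.coeFn_toLp 2 volume, hb.bddMeas.coeFn χL]
      with x e1 e2 e3
    rw [e1, e3, e2, hψ]
  have hlow := bddMeas_lowSymbol (n := n) hs h0 h1
  have hconst := (subConst_pos (θ := β) h0 (by linarith)).ne'
  have hβm : MemLp (fun ξ => ((‖ξ‖ ^ β : ℝ) : ℂ) * (𝓕 ψL : L2C n) ξ) 2 volume := by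
    refine (memLp_one_add_norm_mul_fourier ψ).mono
      (Measurable.aestronglyMeasurable (by fun_prop) |>.mul (Lp.aestronglyMeasurable _))
      (Eventually.of_forall fun ξ => ?_)
    rw [norm_mul, norm_mul, Complex.norm_real, Complex.norm_real,
      Real.norm_of_nonneg (by positivity), Real.norm_of_nonneg (by positivity)]
    gcongr
    rcases le_total ‖ξ‖ 1 with h | h
    · linarith [Real.rpow_le_one (norm_nonneg ξ) h h0.le, norm_nonneg ξ]
    · have := Real.rpow_le_rpow_of_exponent_le h h1.le
      rw [Real.rpow_one] at this
      linarith
  have i1 : Integrable (fun ξ => starRingEnd ℂ (V ξ) * (((‖ξ‖ ^ β : ℝ) : ℂ) * (𝓕 ψL : L2C n) ξ)) := by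
    refine (integrable_conj_mul V (hβm.toLp _)).congr ?_
    filter_upwards [hβm.coeFn_toLp] with ξ e
    rw [e]
  have i2 := integrable_conj_mul V (mulOp (fun ξ => (lowSymbol s β ξ : ℂ)) (𝓕 ψL : L2C n))
  -- the symbol splits into a main part and the bounded part `ρ`; in the main part `h` is then moved
  -- from the test function to `J^s f`, at the price of the commutator
  have e1 : fracLaplacianPairing ((s + β) / 2) f ψ =
      (((2 * Real.pi) ^ β : ℝ) : ℂ) *
        (∫ ξ, starRingEnd ℂ (V ξ) * (((‖ξ‖ ^ β : ℝ) : ℂ) * (𝓕 ψL : L2C n) ξ)) +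
      inner ℂ V (mulOp (fun ξ => (lowSymbol s β ξ : ℂ)) (𝓕 ψL : L2C n)) := by
    rw [fracLaplacianPairing_eq (by linarith), inner_eq_integral, ← integral_const_mul,
      ← integral_add (i1.const_mul _) i2]
    refine integral_congr_ae ?_
    filter_upwards [coeFn_sobolevLp hf, fourier_toLp_schwartz ψ, hlow.coeFn (𝓕 ψL : L2C n)]
      with ξ a1 a2 a3
    rw [a3, a2, a1, mul_div_cancel₀ (s + β) two_ne_zero, rpow_add_eq_lowSymbol (by linarith) h0,
      Real.mul_rpow (by positivity) (norm_nonneg ξ), map_mul, Complex.conj_ofReal]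
    push_cast
    ring
  have e2 : inner ℂ V (mulOp (fun ξ => (lowSymbol s β ξ : ℂ)) (𝓕 ψL : L2C n)) =
      inner ℂ (rmul h (𝓕⁻ (mulOp (fun ξ => (lowSymbol s β ξ : ℂ)) V) : L2C n)) χL := by
    rw [hlow.inner_right, hb.inner_rmul_left, ← hψχ]
    simp only [Complex.conj_ofReal]
    rw [← inner_fourier (𝓕⁻ _ : L2C n) ψL, FourierTransform.fourier_fourierInv_eq]
  have e3 : ∫ ξ, starRingEnd ℂ (V ξ) * (((‖ξ‖ ^ β : ℝ) : ℂ) * (𝓕 ψL : L2C n) ξ) =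
      inner ℂ ((𝓕⁻ Y : L2C n) + ((subConst β)⁻¹ : ℂ) •
        (commOp hb hL h0 h1).adjoint (besselLp s f)) χL := by
    have a1 := integral_rpow_rmul_eq hb hL h0 h1 (besselLp s f) χL
      (memLp_one_add_norm_mul_fourier χ) (by rw [← hψχ]; exact memLp_one_add_norm_mul_fourier ψ)
    rw [← hψχ, hv] at a1
    have a2 : ∫ ξ, starRingEnd ℂ ((𝓕 (rmul h (besselLp s f)) : L2C n) ξ) *
        (((‖ξ‖ ^ β : ℝ) : ℂ) * (𝓕 χL : L2C n) ξ) = inner ℂ (𝓕⁻ Y : L2C n) χL := by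
      rw [← inner_fourier, FourierTransform.fourier_fourierInv_eq, inner_eq_integral]
      refine integral_congr_ae ?_
      filter_upwards [hY] with ξ b1
      rw [b1, map_mul, Complex.conj_ofReal]; ring
    rw [a2] at a1
    have hc' : (subConst β : ℂ) ≠ 0 := by exact_mod_cast hconst
    rw [inner_add_left, inner_smul_left, ContinuousLinearMap.adjoint_inner_left, map_inv₀,
      Complex.conj_ofReal]
    refine mul_left_cancel₀ hc' ?_
    rw [a1, mul_add, mul_inv_cancel_left₀ hc']
  rw [localDeriv, inner_add_left, inner_smul_left, Complex.conj_ofReal, e1, e2, e3]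

/-- The localised derivative is bounded by the smoothing norm `‖|D|^β (h J^s f)‖` and the `H^s` norm,
with a constant depending on `h` through its bounds only. -/
theorem exists_norm_localDeriv_le (n : ℕ) {β : ℝ} (h0 : 0 < β) (h1 : β < 1) {s : ℝ}
    (hs : 2 ≤ s) (C : ℝ) : ∃ B : ℝ, 0 ≤ B ∧ ∀ (h : E n → ℝ) (hb : BddReal h C)
    (hL : ∀ x z, |h (x + z) - h x| ≤ C * ‖z‖) (f : L2 n) (Y : L2C n),
      ‖localDeriv hb hL h0 h1 s f Y‖ ≤ B * (‖Y‖ + ‖sobolevLp s f‖) := by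
  set K₁ := |commConst n β * C|
  set c := (subConst β)⁻¹
  have hc : 0 ≤ c := inv_nonneg.2 (subConst_pos (θ := β) h0 (by linarith)).le
  refine ⟨(2 * Real.pi) ^ β * (1 + c * K₁) + |C| * (s / 2), by positivity, fun h hb hL f Y => ?_⟩
  have hC := hb.nonneg
  have hA : ‖(commOp hb hL h0 h1).adjoint (besselLp s f)‖ ≤ K₁ * ‖sobolevLp s f‖ := by
    refine (ContinuousLinearMap.le_opNorm _ _).trans ?_
    rw [LinearIsometryEquiv.norm_map, besselLp, norm_fourierInv]
    gcongr
    refine ContinuousLinearMap.opNorm_le_bound _ (abs_nonneg _) fun χ => ?_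
    exact (norm_integral_commKer_le hb hL h0 h1 χ).trans
      (mul_le_mul_of_nonneg_right (le_abs_self _) (norm_nonneg _))
  have hR : ‖rmul h (𝓕⁻ (mulOp (fun ξ => (lowSymbol s β ξ : ℂ)) (sobolevLp s f)) : L2C n)‖
      ≤ |C| * (s / 2 * ‖sobolevLp s f‖) := by
    refine (hb.bddMeas.norm_le _).trans ?_
    rw [norm_fourierInv, abs_of_nonneg hC]
    gcongr
    exact (bddMeas_lowSymbol hs h0 h1).norm_le _
  have hp : 0 ≤ (2 * Real.pi) ^ β := by positivity
  calc _ ≤ (2 * Real.pi) ^ β * (‖Y‖ + c * (K₁ * ‖sobolevLp s f‖)) +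
        |C| * (s / 2 * ‖sobolevLp s f‖) := by
        refine (norm_add_le _ _).trans (add_le_add ?_ hR)
        rw [norm_smul, Complex.norm_real, Real.norm_of_nonneg hp]
        gcongr
        refine (norm_add_le _ _).trans ?_
        rw [norm_fourierInv, norm_smul, ← Complex.ofReal_inv, Complex.norm_real,
          Real.norm_of_nonneg hc]
        gcongr
    _ ≤ _ := by
        have := norm_nonneg Y
        have := norm_nonneg (sobolevLp s f)
        have h3 : 0 ≤ K₁ := abs_nonneg _
        have h4 : 0 ≤ (2 * Real.pi) ^ β * ‖sobolevLp s f‖ := by positivity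
        have h5 : 0 ≤ ((2 * Real.pi) ^ β * (c * K₁) + |C| * (s / 2)) * ‖Y‖ := by positivity
        nlinarith

/-! ### Real values and localisation -/

theorem fourier_conj (g : E n → ℂ) (ξ : E n) :
    𝓕 (fun x => starRingEnd ℂ (g x)) ξ = starRingEnd ℂ (𝓕 g (-ξ)) := by
  rw [Real.fourier_eq', Real.fourier_eq', ← integral_conj]
  refine integral_congr_ae (Eventually.of_forall fun x => ?_)
  simp only [smul_eq_mul, map_mul, ← Complex.exp_conj, Complex.conj_ofReal, Complex.conj_I,
    inner_neg_right]
  push_cast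
  ring_nf

theorem fourierInv_conj_neg (g : E n → ℂ) (x : E n) :
    𝓕⁻ (fun ξ => starRingEnd ℂ (g (-ξ))) x = starRingEnd ℂ (𝓕⁻ g x) := by
  rw [Real.fourierInv_eq', Real.fourierInv_eq', ← integral_conj, ← integral_neg_eq_self]
  refine integral_congr_ae (Eventually.of_forall fun x => ?_)
  simp only [smul_eq_mul, map_mul, ← Complex.exp_conj, Complex.conj_ofReal, Complex.conj_I,
    inner_neg_left, neg_neg]
  push_cast
  ring_nf

/-- `(-Δ)^a` maps real distributions to real distributions. -/
theorem fracLaplacianPairing_conj (a : ℝ) (f : L2 n) (ψ ψ' : 𝓢(E n, ℂ))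
    (h : ∀ x, ψ' x = starRingEnd ℂ (ψ x)) :
    fracLaplacianPairing a f ψ' = starRingEnd ℂ (fracLaplacianPairing a f ψ) := by
  rw [fracLaplacianPairing, fracLaplacianPairing, ← integral_conj]
  refine integral_congr_ae (Eventually.of_forall fun x => ?_)
  simp only [map_mul, Complex.conj_ofReal]
  congr 1
  rw [fracLaplacian, fracLaplacian, ← fourierInv_conj_neg]
  refine congrArg (fun g : E n → ℂ => 𝓕⁻ g x) (funext fun ξ => ?_)
  have h' : (ψ' : E n → ℂ) = fun x => starRingEnd ℂ (ψ x) := funext h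
  rw [map_mul, Complex.conj_ofReal, norm_neg, SchwartzMap.fourier_coe, SchwartzMap.fourier_coe, h',
    fourier_conj]

/-- If `(-Δ)^a f` agrees with `H / k` when tested against functions divisible by `k`, it is
a function on the set where `k > 0`. -/
theorem isFracLaplacianOn_of_pairing {a : ℝ} {f : L2 n} {k : E n → ℝ} (hk : Continuous k)
    (hk' : ∀ x, 0 < k x → ContDiffAt ℝ ∞ k x) {H : L2C n} {G : E n → ℂ} (hG : G =ᵐ[volume] H)
    (hp : ∀ ψ χ : 𝓢(E n, ℂ), (∀ x, ψ x = k x * χ x) →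
      fracLaplacianPairing a f ψ = inner ℂ H (χ.toLp 2)) :
    IsFracLaplacianOn a f {x | 0 < k x} (fun x => (G x).re / k x) := by
  have hopen : IsOpen {x | 0 < k x} := isOpen_lt continuous_const hk
  have hGm : MemLp G 2 volume := (memLp_congr_ae hG).2 (Lp.memLp H)
  refine ⟨?_, fun ψ hc hs => ?_⟩
  · have h1 : LocallyIntegrableOn (fun x => (G x).re) {x | 0 < k x} volume :=
      (hGm.re.locallyIntegrable (by norm_num)).locallyIntegrableOn _
    simp_rw [div_eq_inv_mul]
    exact h1.continuousOn_mul (hk.continuousOn.inv₀ fun x hx => ne_of_gt hx)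
      hopen.isLocallyClosed
  have hkz : ∀ x, k x ≤ 0 → ψ x = 0 := fun x hx => by
    by_contra hne
    exact absurd (hs (subset_tsupport _ hne)) (not_lt.2 hx)
  -- `ψ / k` is a test function, since `k` is positive and smooth near the support of `ψ`
  have hsm : ContDiff ℝ ∞ fun x => ψ x / (k x : ℂ) := by
    rw [contDiff_iff_contDiffAt]
    intro x
    by_cases hx : x ∈ tsupport ψ
    · have hx' := hs hx
      have e1 : ContDiffAt ℝ ∞ (fun y => (k y : ℂ)) x :=
        Complex.ofRealCLM.contDiff.contDiffAt.comp x (hk' x hx')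
      have e2 : ContDiffAt ℝ ∞ (fun y => ψ y) x := (ψ.smooth ⊤).contDiffAt
      have hx2 : (k x : ℂ) ≠ 0 := by exact_mod_cast (ne_of_gt hx')
      simp_rw [div_eq_mul_inv]
      exact e2.mul (e1.inv hx2)
    · have e1 : (fun y => ψ y / (k y : ℂ)) =ᶠ[𝓝 x] fun _ => 0 := by
        filter_upwards [notMem_tsupport_iff_eventuallyEq.1 hx] with y hy
        rw [hy]; simp
      exact contDiffAt_const.congr_of_eventuallyEq e1
  have hcs : HasCompactSupport fun x => ψ x / (k x : ℂ) := by
    simp_rw [div_eq_mul_inv]; exact hc.mul_right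
  have conj_sm : ContDiff ℝ ∞ (fun z : ℂ => starRingEnd ℂ z) := Complex.conjCLE.contDiff
  let χ : 𝓢(E n, ℂ) := hcs.toSchwartzMap hsm
  -- `(-Δ)^a f` is real: testing against the conjugate of `ψ` as well shows that only the real part
  -- of `H` matters
  let χ' : 𝓢(E n, ℂ) := (hcs.comp_left (g := fun z : ℂ => starRingEnd ℂ z) (by simp)).toSchwartzMap
    (conj_sm.comp hsm)
  let ψ' : 𝓢(E n, ℂ) := (hc.comp_left (g := fun z : ℂ => starRingEnd ℂ z) (by simp)).toSchwartzMap
    (conj_sm.comp (ψ.smooth ⊤))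
  have hψ : ∀ x, ψ x = k x * χ x := fun x => by
    change ψ x = k x * (ψ x / (k x : ℂ))
    rcases lt_or_ge 0 (k x) with h | h
    · have : (k x : ℂ) ≠ 0 := by exact_mod_cast h.ne'
      field_simp
    · rw [hkz x h]; simp
  have hχ' : ∀ x, χ' x = starRingEnd ℂ (χ x) := fun x => rfl
  have hψ' : ∀ x, ψ' x = starRingEnd ℂ (ψ x) := fun x => rfl
  have hψχ' : ∀ x, ψ' x = k x * χ' x := fun x => by
    rw [hψ', hχ', hψ, map_mul, Complex.conj_ofReal]
  have e1 := hp ψ χ hψ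
  have e2 := hp ψ' χ' hψχ'
  rw [fracLaplacianPairing_conj a f ψ ψ' hψ', inner_eq_integral] at e2
  rw [inner_eq_integral] at e1
  have i1 := integrable_conj_mul H (χ.toLp 2)
  have i2 := (integrable_conj_mul H (χ'.toLp 2))
  have e3 := congrArg (starRingEnd ℂ) e2
  rw [Complex.conj_conj, ← integral_conj] at e3
  have i3 : Integrable fun x => starRingEnd ℂ (starRingEnd ℂ (H x) *
      (χ'.toLp 2 (volume : Measure (E n))) x) :=
    (Complex.conjCLE.toContinuousLinearMap.integrable_comp i2)
  have e4 : 2 * fracLaplacianPairing a f ψ = 2 * ∫ x, (((G x).re / k x : ℝ) : ℂ) * ψ x := by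
    rw [two_mul]
    nth_rw 1 [e1]
    rw [e3, ← integral_add i1 i3, ← integral_const_mul]
    refine integral_congr_ae ?_
    filter_upwards [hG, χ.coeFn_toLp 2 volume, χ'.coeFn_toLp 2 volume] with x a1 a2 a3
    rw [a2, a3, ← a1, hχ', map_mul, Complex.conj_conj, Complex.conj_conj, ← add_mul, add_comm,
      Complex.add_conj]
    change _ * (ψ x / (k x : ℂ)) = _
    push_cast
    ring
  exact (mul_left_cancel₀ two_ne_zero e4).symm

/-! ### Bounds on the whole time interval -/

theorem memLp_of_fracNorm {β : ℝ} {W : L2C n} (h : fracNorm β W < ⊤) :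
    MemLp (fun ξ => ((‖ξ‖ ^ β : ℝ) : ℂ) * W ξ) 2 volume :=
  ⟨Measurable.aestronglyMeasurable (by fun_prop) |>.mul (Lp.aestronglyMeasurable _), h⟩

theorem enorm_mulOp_rpow {β : ℝ} {W : L2C n} (h : fracNorm β W < ⊤) :
    ‖mulOp (fun ξ => ((‖ξ‖ ^ β : ℝ) : ℂ)) W‖ₑ = fracNorm β W := by
  rw [Lp.enorm_def]
  exact eLpNorm_congr_ae (coeFn_mulOp_of_memLp (memLp_of_fracNorm h))

theorem tendsto_mulOp_truncPow {β : ℝ} (hβ : 0 ≤ β) {W : L2C n} (h : fracNorm β W < ⊤) :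
    Tendsto (fun R : ℕ => mulOp (truncPow β R) W) atTop
      (𝓝 (mulOp (fun ξ => ((‖ξ‖ ^ β : ℝ) : ℂ)) W)) := by
  set Y := mulOp (fun ξ => ((‖ξ‖ ^ β : ℝ) : ℂ)) W
  have hY : Y =ᵐ[volume] _ := coeFn_mulOp_of_memLp (memLp_of_fracNorm h)
  rw [tendsto_iff_norm_sub_tendsto_zero]
  have hsq : Tendsto (fun R : ℕ => ‖mulOp (truncPow β R) W - Y‖ ^ 2) atTop (𝓝 0) := by
    have hz : (∫ _ξ : E n, (0 : ℝ)) = 0 := by simp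
    simp_rw [norm_sq_eq_integral]
    rw [← hz]
    refine tendsto_integral_of_dominated_convergence (fun ξ => ‖Y ξ‖ ^ 2)
      (fun R => (integrable_norm_sq _).aestronglyMeasurable) (integrable_norm_sq Y)
      (fun R => ?_) ?_
    · filter_upwards [Lp.coeFn_sub (mulOp (truncPow β R) W) Y, (bddMeas_truncPow hβ R).coeFn W, hY]
        with ξ e1 e2 e3
      rw [e1, Pi.sub_apply, e2, e3, Real.norm_of_nonneg (by positivity)]
      unfold truncPow
      split_ifs
      · rw [sub_self, norm_zero, zero_pow two_ne_zero]; positivity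
      · rw [zero_mul, zero_sub, norm_neg]
    · have hall : ∀ᵐ ξ : E n, ∀ R : ℕ,
          (mulOp (truncPow β R) W - Y : L2C n) ξ = truncPow β R ξ * W ξ - Y ξ :=
        ae_all_iff.2 fun R => by
          filter_upwards [Lp.coeFn_sub (mulOp (truncPow β R) W) Y, (bddMeas_truncPow hβ R).coeFn W]
            with ξ e1 e2
          rw [e1, Pi.sub_apply, e2]
      filter_upwards [hall, hY] with ξ e1 e2
      refine tendsto_const_nhds.congr' ?_
      obtain ⟨R₀, hR₀⟩ := exists_nat_ge ‖ξ‖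
      filter_upwards [eventually_ge_atTop R₀] with R hR
      have : ‖ξ‖ ≤ R := hR₀.trans (by exact_mod_cast hR)
      rw [e1, e2, truncPow, if_pos this, sub_self]; simp
  have := hsq.sqrt
  simpa only [Real.sqrt_sq (norm_nonneg _), Real.sqrt_zero] using this

theorem Ioo_eq_iUnion_Icc (T : ℝ) :
    Ioo 0 T = ⋃ k : ℕ, Icc (1 / ((k : ℝ) + 1)) (T - 1 / ((k : ℝ) + 1)) := by
  ext t
  simp only [mem_Ioo, mem_iUnion, mem_Icc]
  constructor
  · rintro ⟨h1, h2⟩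
    obtain ⟨k, hk⟩ := exists_nat_one_div_lt (lt_min h1 (sub_pos.2 h2))
    exact ⟨k, (hk.trans_le (min_le_left _ _)).le, by
      linarith [(hk.trans_le (min_le_right _ _)).le]⟩
  · rintro ⟨k, h1, h2⟩
    have : 0 < 1 / ((k : ℝ) + 1) := by positivity
    exact ⟨by linarith, by linarith⟩

theorem setLIntegral_Ioo_le {T : ℝ} {f : ℝ → ℝ≥0∞} {D : ℝ≥0∞}
    (h : ∀ t₁ t₂, 0 < t₁ → t₁ ≤ t₂ → t₂ < T → ∫⁻ t in Icc t₁ t₂, f t ≤ D) :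
    ∫⁻ t in Ioo 0 T, f t ≤ D := by
  rw [Ioo_eq_iUnion_Icc, setLIntegral_iUnion_of_directed]
  · refine iSup_le fun k => ?_
    have hk : 0 < 1 / ((k : ℝ) + 1) := by positivity
    rcases le_or_gt (1 / ((k : ℝ) + 1)) (T - 1 / ((k : ℝ) + 1)) with hle | hlt
    · exact h _ _ hk hle (by linarith)
    · rw [Icc_eq_empty (not_le.2 hlt)]; simp
  · refine Monotone.directed_le fun k l hkl => ?_
    have : 1 / ((l : ℝ) + 1) ≤ 1 / ((k : ℝ) + 1) :=
      one_div_le_one_div_of_le (by positivity) (by exact_mod_cast Nat.succ_le_succ hkl)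
    exact Icc_subset_Icc this (by linarith)

theorem ae_Ioo_of_ae_Icc {T : ℝ} {p : ℝ → Prop}
    (h : ∀ t₁ t₂, 0 < t₁ → t₁ ≤ t₂ → t₂ < T → ∀ᵐ t ∂(volume.restrict (Icc t₁ t₂)), p t) :
    ∀ᵐ t ∂(volume.restrict (Ioo 0 T)), p t := by
  rw [Ioo_eq_iUnion_Icc, ae_restrict_iUnion_iff]
  intro k
  have hk : 0 < 1 / ((k : ℝ) + 1) := by positivity
  rcases le_or_gt (1 / ((k : ℝ) + 1)) (T - 1 / ((k : ℝ) + 1)) with hle | hlt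
  · exact h _ _ hk hle (by linarith)
  · rw [Icc_eq_empty (not_le.2 hlt)]; simp

theorem ContinuousInSobolev.mono {r s T : ℝ} (h : r ≤ s) {u : ℝ → L2 n}
    (hu : ContinuousInSobolev s T u) : ContinuousInSobolev r T u := fun t ht =>
  ⟨(sobolevNorm_mono h _).trans_lt (hu t ht).1,
    tendsto_of_tendsto_of_tendsto_of_le_of_le tendsto_const_nhds (hu t ht).2
      (fun _ => zero_le) fun _ => sobolevNorm_mono h _⟩

/-- For a curve continuous in `H^s`, the essential bound holds at every time. -/
theorem sobolevNorm_le_normLinfSobolev {s T : ℝ} {u : ℝ → L2 n} (hu : ContinuousInSobolev s T u)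
    {t : ℝ} (ht : t ∈ Ioo 0 T) : sobolevNorm s (u t) ≤ normLinfSobolev s T u := by
  by_contra hlt
  rw [not_le, ← enorm_sobolevLp (hu t ht).1] at hlt
  have hc := (continuousOn_sobolevLp hu).continuousAt (Ioo_mem_nhds ht.1 ht.2)
  have hev := (hc.enorm.eventually (lt_mem_nhds hlt)).and (Ioo_mem_nhds ht.1 ht.2)
  obtain ⟨U, hU, hUo, htU⟩ := eventually_nhds_iff.1 hev
  have hae : ∀ᵐ τ, τ ∈ Ioo 0 T → sobolevNorm s (u τ) ≤ normLinfSobolev s T u :=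
    (ae_restrict_iff' measurableSet_Ioo).1 (ENNReal.ae_le_essSup _)
  obtain ⟨τ, hτU, hτ⟩ := (Measure.dense_of_ae hae).inter_open_nonempty U hUo ⟨t, htU⟩
  obtain ⟨h1, h2⟩ := hU τ hτU
  rw [enorm_sobolevLp (hu τ h2).1] at h1
  exact absurd (hτ h2) (not_le.2 h1)

theorem exists_norm_sobolevLp_le {s T : ℝ} {u : ℝ → L2 n} (hu : ContinuousInSobolev s T u)
    {t₁ t₂ : ℝ} (h1 : 0 < t₁) (h2 : t₂ < T) :
    ∃ M : ℝ, ∀ t ∈ Icc t₁ t₂, ‖sobolevLp s (u t)‖ ≤ M :=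
  isCompact_Icc.exists_bound_of_continuousOn ((continuousOn_sobolevLp hu).mono fun _ ht =>
    ⟨h1.trans_le ht.1, ht.2.trans_lt h2⟩)

/-- The smoothing effect on the whole time interval. The finiteness for almost every time follows
from compact subintervals, on which the norms are bounded by continuity, and does not need a bound
on the whole interval. -/
theorem exists_global_smoothing [NeZero n] {α s r : ℝ} (h0 : 0 < α) (h2 : α < 2)
    (hs : (n : ℝ) / 2 + 1 < s) (hr : (n : ℝ) / 2 + 1 < r) (hrs : r ≤ s) (ν : E n) {c₀ : ℝ}
    (hc₀ : 0 < c₀) (hell : ∀ ξ : E n, c₀ * ‖ξ‖ ^ 2 ≤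
      inner ℝ (basisVec 0) ν * ‖ξ‖ ^ 2 + α * (inner ℝ (basisVec 0) ξ * inner ℝ ν ξ)) (C : ℝ) :
    ∃ K : ℝ, 0 ≤ K ∧ ∀ φ h : E n → ℝ, WeightData ν φ h C →
      ∀ (T : ℝ) (u : ℝ → L2 n), 0 < T → ContinuousInSobolev s T u → IsSolution α T u →
      (∀ᵐ t ∂(volume.restrict (Ioo 0 T)),
        fracNorm (α / 2) (𝓕 (rmul h (besselLp s (u t)))) < ⊤) ∧
      (normLinfSobolev s T u < ⊤ →
        ∫⁻ t in Ioo 0 T, fracNorm (α / 2) (𝓕 (rmul h (besselLp s (u t)))) ^ 2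
          ≤ ENNReal.ofReal K * (1 + ENNReal.ofReal T + ENNReal.ofReal T * normLinfSobolev r T u) *
            normLinfSobolev s T u ^ 2) := by
  obtain ⟨K, hK0, hK⟩ := exists_smoothing h0 h2 hs hr hrs ν hc₀ hell C
  refine ⟨K, hK0, fun φ h W T u hT hu hsol => ⟨?_, fun hfin => ?_⟩⟩
  · refine ae_Ioo_of_ae_Icc fun t₁ t₂ ht₁ ht ht₂ => ?_
    obtain ⟨M, hM⟩ := exists_norm_sobolevLp_le hu ht₁ ht₂
    obtain ⟨N, hN⟩ := exists_norm_sobolevLp_le (hu.mono hrs) ht₁ ht₂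
    have hb := hK φ h W T u hu hsol t₁ t₂ ht₁ ht ht₂ M N hM hN
    have hβ : 0 ≤ α / 2 := by positivity
    have hmeas : AEMeasurable
        (fun t => fracNorm (α / 2) (𝓕 (rmul h (besselLp s (u t)))) ^ 2)
        (volume.restrict (Icc t₁ t₂)) := by
      simp_rw [fracNorm_sq_eq_iSup hβ]
      refine AEMeasurable.iSup fun R => ?_
      have hc : Continuous fun w : L2C n => ‖mulOp (truncPow (α / 2) R) (𝓕 (rmul h w))‖ₑ ^ 2 :=
        (ENNReal.continuous_pow 2).comp (continuous_enorm.comp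
          ((bddMeas_truncPow hβ R).continuous.comp
            (continuous_fourier.comp W.bdd_h.bddMeas.continuous)))
      exact ((hc.comp_continuousOn (continuousOn_besselLp hu)).mono fun _ ht' =>
        ⟨ht₁.trans_le ht'.1, ht'.2.trans_lt ht₂⟩).aemeasurable measurableSet_Icc
    filter_upwards [ae_lt_top' hmeas (ne_top_of_le_ne_top ENNReal.ofReal_ne_top hb)] with t ht'
    by_contra htop
    rw [not_lt, top_le_iff] at htop
    rw [htop] at ht'
    simp at ht'
  · set M := (normLinfSobolev s T u).toReal
    set N := (normLinfSobolev r T u).toReal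
    have hfr : normLinfSobolev r T u ≠ ⊤ := ne_top_of_le_ne_top hfin.ne
      (essSup_mono_ae (Eventually.of_forall fun t => sobolevNorm_mono hrs _))
    have hbound : ∀ t ∈ Ioo 0 T, ‖sobolevLp s (u t)‖ ≤ M ∧ ‖sobolevLp r (u t)‖ ≤ N := fun t ht => by
      rw [norm_sobolevLp (hu t ht).1, norm_sobolevLp (hu.mono hrs t ht).1]
      exact ⟨ENNReal.toReal_mono hfin.ne (sobolevNorm_le_normLinfSobolev hu ht),
        ENNReal.toReal_mono hfr (sobolevNorm_le_normLinfSobolev (hu.mono hrs) ht)⟩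
    have hN0 : 0 ≤ N := ENNReal.toReal_nonneg
    have e : ENNReal.ofReal K * (1 + ENNReal.ofReal T + ENNReal.ofReal T * normLinfSobolev r T u) *
        normLinfSobolev s T u ^ 2 = ENNReal.ofReal (K * (1 + T * (1 + N)) * M ^ 2) := by
      rw [ENNReal.ofReal_mul (by positivity), ENNReal.ofReal_mul hK0,
        ENNReal.ofReal_pow ENNReal.toReal_nonneg, ENNReal.ofReal_toReal hfin.ne,
        show 1 + T * (1 + N) = 1 + T + T * N by ring, ENNReal.ofReal_add (by positivity)
          (by positivity), ENNReal.ofReal_add one_pos.le hT.le, ENNReal.ofReal_one,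
        ENNReal.ofReal_mul hT.le, ENNReal.ofReal_toReal hfr]
    rw [e]
    refine setLIntegral_Ioo_le fun t₁ t₂ ht₁ ht ht₂ => ?_
    refine (hK φ h W T u hu hsol t₁ t₂ ht₁ ht ht₂ M N
      (fun t ht' => (hbound t ⟨ht₁.trans_le ht'.1, ht'.2.trans_lt ht₂⟩).1)
      (fun t ht' => (hbound t ⟨ht₁.trans_le ht'.1, ht'.2.trans_lt ht₂⟩).2)).trans ?_
    refine ENNReal.ofReal_le_ofReal ?_
    have : t₂ - t₁ ≤ T := by linarith
    gcongr

/-! ### Measurability and size of the localised derivative -/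

/-- The localised derivative of the solution is a measurable curve in `L²`: its commutator and
low-order parts are continuous, and the main part is a limit of continuous curves. -/
theorem aestronglyMeasurable_localDeriv {h : E n → ℝ} {C : ℝ} (hb : BddReal h C)
    (hL : ∀ x z, |h (x + z) - h x| ≤ C * ‖z‖) {β : ℝ} (h0 : 0 < β) (h1 : β < 1) {s T : ℝ}
    (hs : 2 ≤ s) {u : ℝ → L2 n} (hu : ContinuousInSobolev s T u)
    (hfr : ∀ᵐ t ∂(volume.restrict (Ioo 0 T)),
      fracNorm β (𝓕 (rmul h (besselLp s (u t)))) < ⊤) :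
    AEStronglyMeasurable (fun t => localDeriv hb hL h0 h1 s (u t)
      (mulOp (fun ξ => ((‖ξ‖ ^ β : ℝ) : ℂ)) (𝓕 (rmul h (besselLp s (u t))))))
      (volume.restrict (Ioo 0 T)) := by
  have hv := (continuousOn_besselLp hu)
  have hY : AEStronglyMeasurable (fun t => mulOp (fun ξ => ((‖ξ‖ ^ β : ℝ) : ℂ))
      (𝓕 (rmul h (besselLp s (u t))))) (volume.restrict (Ioo 0 T)) := by
    refine aestronglyMeasurable_of_tendsto_ae atTop (f := fun (R : ℕ) t =>
      mulOp (truncPow β R) (𝓕 (rmul h (besselLp s (u t))))) (fun R => ?_)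
      (hfr.mono fun t ht => tendsto_mulOp_truncPow h0.le ht)
    have hc : Continuous fun w : L2C n => mulOp (truncPow β R) (𝓕 (rmul h w)) :=
      (bddMeas_truncPow h0.le R).continuous.comp (continuous_fourier.comp hb.bddMeas.continuous)
    exact (hc.comp_continuousOn hv).aestronglyMeasurable measurableSet_Ioo
  have hY' : AEStronglyMeasurable (fun t => (𝓕⁻ (mulOp (fun ξ => ((‖ξ‖ ^ β : ℝ) : ℂ))
      (𝓕 (rmul h (besselLp s (u t))))) : L2C n)) (volume.restrict (Ioo 0 T)) :=
    continuous_fourierInv.comp_aestronglyMeasurable hY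
  have hA : AEStronglyMeasurable (fun t => (commOp hb hL h0 h1).adjoint (besselLp s (u t)))
      (volume.restrict (Ioo 0 T)) :=
    ((commOp hb hL h0 h1).adjoint.continuous.comp_continuousOn hv).aestronglyMeasurable
      measurableSet_Ioo
  have hR : AEStronglyMeasurable (fun t => rmul h
      (𝓕⁻ (mulOp (fun ξ => (lowSymbol s β ξ : ℂ)) (sobolevLp s (u t))) : L2C n))
      (volume.restrict (Ioo 0 T)) := by
    have hc : Continuous fun V : L2C n =>
        rmul h (𝓕⁻ (mulOp (fun ξ => (lowSymbol s β ξ : ℂ)) V) : L2C n) :=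
      hb.bddMeas.continuous.comp (continuous_fourierInv.comp
        (bddMeas_lowSymbol hs h0 h1).continuous)
    exact (hc.comp_continuousOn (continuousOn_sobolevLp hu)).aestronglyMeasurable measurableSet_Ioo
  unfold localDeriv
  exact ((hY'.fun_add (hA.fun_const_smul _)).fun_const_smul _).fun_add hR

theorem lintegral_sq_div_le {k : E n → ℝ} {G : E n → ℂ} {H : L2C n} (hG : G =ᵐ[volume] H) {c : ℝ}
    (hc : 0 ≤ c) :
    ∫⁻ x, ENNReal.ofReal (((G x).re / k x) ^ 2 * (c * k x ^ 2)) ≤ ENNReal.ofReal c * ‖H‖ₑ ^ 2 := by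
  rw [Lp.enorm_def, eLpNorm_two_sq, ← lintegral_const_mul' _ _ ENNReal.ofReal_ne_top]
  refine lintegral_mono_ae ?_
  filter_upwards [hG] with x hx
  rw [← hx, ← ofReal_norm, ← ENNReal.ofReal_pow (norm_nonneg _), ← ENNReal.ofReal_mul hc]
  refine ENNReal.ofReal_le_ofReal ?_
  have h1 : (G x).re ^ 2 ≤ ‖G x‖ ^ 2 := sq_le_sq' (by
    linarith [abs_le.1 (Complex.abs_re_le_norm (G x))]) (Complex.re_le_norm _)
  -- where `k x = 0` the quotient has the value `0`, and so has the weight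
  rcases eq_or_ne (k x) 0 with h | h
  · rw [h]; simp; positivity
  · rw [div_pow]
    calc _ = c * (G x).re ^ 2 := by field_simp
      _ ≤ _ := by gcongr

theorem enorm_sq_le_of_norm_le {H Y V : L2C n} {B : ℝ}
    (h : ‖H‖ ≤ B * (‖Y‖ + ‖V‖)) :
    ‖H‖ₑ ^ 2 ≤ ENNReal.ofReal (2 * B ^ 2) * (‖Y‖ₑ ^ 2 + ‖V‖ₑ ^ 2) := by
  simp only [← ofReal_norm]
  rw [← ENNReal.ofReal_pow (norm_nonneg _), ← ENNReal.ofReal_pow (norm_nonneg _),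
    ← ENNReal.ofReal_pow (norm_nonneg _), ← ENNReal.ofReal_add (by positivity) (by positivity),
    ← ENNReal.ofReal_mul (by positivity)]
  refine ENNReal.ofReal_le_ofReal ?_
  calc ‖H‖ ^ 2 ≤ (B * (‖Y‖ + ‖V‖)) ^ 2 := by gcongr
    _ ≤ _ := by nlinarith [mul_nonneg (sq_nonneg B) (sq_nonneg (‖Y‖ - ‖V‖))]

end FZK

end

theorem corollary1p3 {n : ℕ} [NeZero n] (hn : 2 ≤ n)
    (α : ℝ) (hα₀ : 0 < α) (hα₂ : α < 2)
    (s : ℝ) (hs : (n : ℝ) / 2 + 1 < s)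
    (r : ℝ) (hr : ((n : ℝ) + 2) / 2 < r)
    (ν : FZK.E n) (hν : FZK.AdmissibleDirection α ν) (c : ℝ) :
    ∃ K : ℝ, 0 < K ∧
      ∀ φ : FZK.E n → ℝ, FZK.AdmissibleWeight ν c φ →
      ∀ T : ℝ, 0 < T →
      ∀ u : ℝ → FZK.L2 n, FZK.ContinuousInSobolev s T u → FZK.IsSolution α T u →
        ∃ g : ℝ → FZK.E n → ℝ,
          Measurable (Function.uncurry g) ∧
          (∀ᵐ t ∂(volume.restrict (Ioo 0 T)),
            FZK.IsFracLaplacianOn ((s + α / 2) / 2) (u t) {x | 0 < FZK.partialOne φ x} (g t)) ∧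
          (∫⁻ t in Ioo 0 T, ∫⁻ x, ENNReal.ofReal (g t x ^ 2 * FZK.partialOne φ x))
              ^ (1 / 2 : ℝ)
            ≤ ENNReal.ofReal K *
              (1 + ENNReal.ofReal T + FZK.normGradL1Linf T u
                + ENNReal.ofReal T * FZK.normLinfSobolev r T u) ^ (1 / 2 : ℝ)
              * FZK.normLinfSobolev s T u := by
  obtain ⟨hν0, c₀, hc₀, hell⟩ := FZK.exists_elliptic hn hα₀ hα₂ hν
  have hn2 : (2 : ℝ) ≤ n := by exact_mod_cast hn
  -- `u` is known to be in `H^s` only, and `r > s` is allowed: the estimates run with `min r s`, and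
  -- the norm in `H^r` is the larger one
  have hr' : (n : ℝ) / 2 + 1 < min r s := lt_min (by linarith) hs
  have hs2 : 2 ≤ s := by linarith
  have hβ0 : 0 < α / 2 := by positivity
  have hβ1 : α / 2 < 1 := by linarith
  set C : ℝ := 2 * (1 + c) * (1 + ‖ν‖) ^ 3
  obtain ⟨K, hK0, hK⟩ := FZK.exists_global_smoothing hα₀ hα₂ hs hr' (min_le_right r s) ν hc₀ hell C
  obtain ⟨B, hB0, hB⟩ := FZK.exists_norm_localDeriv_le n hβ0 hβ1 hs2 C
  -- the last summand makes the constant positive even if the estimates hold with `B = 0`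
  refine ⟨Real.sqrt (ν 0 * (2 * B ^ 2) * (K + 1)) + 1, by positivity, fun φ hφ T hT u hu hsol => ?_⟩
  obtain ⟨k, W, hk0, hkc, hksm, hpart⟩ := FZK.exists_weightData hφ
  obtain ⟨hfr, hint⟩ := hK φ k W T u hT hu hsol
  have hmeas := FZK.aestronglyMeasurable_localDeriv W.bdd_h W.lip_h hβ0 hβ1 hs2 hu hfr
  obtain ⟨G, hG, hGF⟩ := FZK.exists_measurable_representative hmeas.stronglyMeasurable_mk
  have hset : {x | 0 < FZK.partialOne φ x} = {x | 0 < k x} := by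
    ext x
    simp only [mem_ofPred_eq, hpart, mul_pos_iff_of_pos_left hν0]
    exact ⟨fun h => (hk0 x).lt_of_ne' fun h' => by simp [h'] at h, fun h => by positivity⟩
  refine ⟨fun t x => (G t x).re / k x,
    (Complex.measurable_re.comp hG).div (hkc.measurable.comp measurable_snd), ?_, ?_⟩
  · filter_upwards [hmeas.ae_eq_mk, hfr, ae_restrict_mem measurableSet_Ioo] with t h1 h2 ht
    rw [hset]
    refine FZK.isFracLaplacianOn_of_pairing hkc hksm (hGF t) fun ψ χ hψ => ?_
    rw [← h1]
    exact FZK.fracLaplacianPairing_eq_inner W.bdd_h W.lip_h hβ0 hβ1 hs2 (hu t ht).1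
      (FZK.coeFn_mulOp_of_memLp (FZK.memLp_of_fracNorm h2)) ψ χ hψ
  set M := FZK.normLinfSobolev s T u
  set N := FZK.normLinfSobolev r T u
  have hone : 1 ≤ 1 + ENNReal.ofReal T + FZK.normGradL1Linf T u + ENNReal.ofReal T * N := by
    rw [add_assoc, add_assoc]; exact le_self_add
  -- if `u` is unbounded in `H^s`, the right-hand side is infinite, as its first factors are nonzero
  rcases eq_or_ne M ⊤ with hM | hM
  · rw [hM, ENNReal.mul_top]
    · exact le_top
    · refine mul_ne_zero (ENNReal.ofReal_pos.2 (by positivity)).ne' ?_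
      exact ((one_pos.trans_le (ENNReal.one_le_rpow hone (by norm_num)))).ne'
  have hN : FZK.normLinfSobolev (min r s) T u ≤ N :=
    essSup_mono_ae (Eventually.of_forall fun t => FZK.sobolevNorm_mono (min_le_left r s) _)
  set A := 1 + ENNReal.ofReal T + ENNReal.ofReal T * N
  have hV : ∫⁻ t in Ioo 0 T, ‖FZK.sobolevLp s (u t)‖ₑ ^ 2 ≤ A * M ^ 2 := by
    calc _ ≤ ∫⁻ _ in Ioo 0 T, M ^ 2 := setLIntegral_mono' measurableSet_Ioo fun t ht => by
          rw [FZK.enorm_sobolevLp (hu t ht).1]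
          gcongr
          exact FZK.sobolevNorm_le_normLinfSobolev hu ht
      _ = ENNReal.ofReal T * M ^ 2 := by
          rw [setLIntegral_const, Real.volume_Ioo, sub_zero, mul_comm]
      _ ≤ _ := by
          gcongr
          exact le_add_self.trans le_self_add
  have hmain : ∫⁻ t in Ioo 0 T, ∫⁻ x,
      ENNReal.ofReal (((G t x).re / k x) ^ 2 * FZK.partialOne φ x) ≤
      ENNReal.ofReal (ν 0 * (2 * B ^ 2) * (K + 1)) * A * M ^ 2 := by
    calc _ ≤ ∫⁻ t in Ioo 0 T, ENNReal.ofReal (ν 0 * (2 * B ^ 2)) *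
          (FZK.fracNorm (α / 2) (𝓕 (FZK.rmul k (FZK.besselLp s (u t)))) ^ 2 +
            ‖FZK.sobolevLp s (u t)‖ₑ ^ 2) := by
          refine lintegral_mono_ae ?_
          filter_upwards [hmeas.ae_eq_mk, hfr] with t h1 h2
          simp_rw [hpart]
          refine (FZK.lintegral_sq_div_le (hGF t) hν0.le).trans ?_
          have h3 := FZK.enorm_sq_le_of_norm_le (hB k W.bdd_h W.lip_h (u t)
            (FZK.mulOp (fun ξ => ((‖ξ‖ ^ (α / 2) : ℝ) : ℂ))
              (𝓕 (FZK.rmul k (FZK.besselLp s (u t))))))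
          rw [FZK.enorm_mulOp_rpow h2] at h3
          rw [← h1, ENNReal.ofReal_mul hν0.le, mul_assoc (ENNReal.ofReal _)]
          gcongr
      _ ≤ ENNReal.ofReal (ν 0 * (2 * B ^ 2)) * (ENNReal.ofReal K * A * M ^ 2 + A * M ^ 2) := by
          rw [lintegral_const_mul' _ _ ENNReal.ofReal_ne_top, lintegral_add_right']
          · gcongr
            refine (hint hM.lt_top).trans ?_
            gcongr
            change _ ≤ 1 + ENNReal.ofReal T + ENNReal.ofReal T * N
            gcongr
          · exact ((FZK.continuousOn_sobolevLp hu).aestronglyMeasurable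
              measurableSet_Ioo).enorm.pow_const 2
      _ = _ := by
          rw [ENNReal.ofReal_mul (p := ν 0 * (2 * B ^ 2)) (by positivity), ENNReal.ofReal_add hK0 one_pos.le,
            ENNReal.ofReal_one]
          ring
  calc _ ≤ (ENNReal.ofReal (ν 0 * (2 * B ^ 2) * (K + 1)) * A * M ^ 2) ^ (1 / 2 : ℝ) := by gcongr
    _ = ENNReal.ofReal (Real.sqrt (ν 0 * (2 * B ^ 2) * (K + 1))) * A ^ (1 / 2 : ℝ) * M := by
        rw [ENNReal.mul_rpow_of_nonneg _ _ (by norm_num),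
          ENNReal.mul_rpow_of_nonneg _ _ (by norm_num),
          ENNReal.ofReal_rpow_of_nonneg (by positivity) (by norm_num), Real.sqrt_eq_rpow,
          ← ENNReal.rpow_natCast, ← ENNReal.rpow_mul]
        norm_num
    _ ≤ _ := by
        gcongr
        · linarith
        · rw [add_right_comm]
          exact le_self_add
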